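/- **Setting.** A fixed prompt induces a law of intermediate states $s$; from a state $s$ one can generate i.i.d. responses, whose reward has law $F_s$. Put $V_N(s)=\mathbb E[\max_{i\le N}R^{(i)}]$ for $R^{(i)}\overset{iid}{\sim}F_s$. Let $\phi,\Phi$ be the standard normal density and distribution function, and let $E(N)$ be the expected maximum of $N$ i.i.d. standard normal variables. *Prediction.* From a sample $\mathcal D$ of $m$ rewards, let $\hat\mu_{\rm tail},\hat\sigma^2_{\rm tail}$ be the mean and variance of the points of $\mathcal D$ that are at least its empirical $(1-\alpha/2)$-quantile. With $z=\Phi^{-1}(1-\alpha/2)$, $\lambda=\phi(z)/(1-\Phi(z))$ and $\delta_z=1+z\lambda-\lambda^2$, set $\hat\sigma=\sqrt{\hat\sigma^2_{\rm tail}/\delta_z}$, $\hat\mu=\hat\mu_{\rm tail}-\hat\sigma\lambda$ and $\hat V_N=\hat\mu+\hat\sigma E(N)$. *SLG search* with budget $N$, width $K$ and $m$ estimation samples: draw $K$ i.i.d. states, generate $m$ responses from each, compute $\hat V_N(s_i)$ from the $m$ rewards of $s_i$, spend the remaining $N-Km$ generations on a state with the largest $\hat V_N(s_i)$, and return the best of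 all generated responses. *Oracle* $\mathcal A^*$ with budget $N$: draw $N$ i.i.d. states and generate $N$ responses from one with the largest $V_N(s)$. For both, $V_N(\mathcal A)$ is the expected largest reward among the generated responses. Ties are broken by any measurable rule. **Assumptions.** Let $\alpha\in(0,1)$ and $0<\sigma_{\min}\le\sigma_{\max}$. For almost every state $s$, the law $F_s$ has on $[F_s^{-1}(1-\alpha),\infty)$ the density of $\mathcal N(\mu(s),\sigma(s)^2)$, and $\sigma(s)\in[\sigma_{\min},\sigma_{\max}]$. Over the random state, $\mathbb E[\mu(s)^2]\le M_\mu$, and the reward $R$ of a response generated from the random state satisfies $\mathbb E[R^2]\le C_R$. Moreover: 1. $\mu(s)$ and $\sigma(s)$ are independent; 2. $\mathbb P(\sigma(s)\ge\sigma_{\max}-\delta)\ge\delta^{\kappa}$ for all $\delta\in(0,\delta_0]$, where $\kappa,\delta_0>0$; 3. for i.i.d. copies $\mu_i$ of $\mu(s)$ and all $n\ge2$, $\big|\mathbb E[\max_{i\le n}\mu_i]-\mu_0-C_\mu(\log n)^\gamma\big|\le C_\beta(\log n)^{-\beta}$, where $\mu_0,C_\beta\in\mathbb R$, $C_\mu,\beta>0$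 and $\gamma\in(0,1)$. **Claim.** Let $a_1,b_1>0$, let $a_2,b_2\in\mathbb R$ and let $\rho<1$. There are $c>0$ and $N_0$, depending only on $\alpha,\sigma_{\min},\sigma_{\max},C_R,M_\mu,\kappa,\delta_0,\mu_0,C_\mu,\gamma,\beta,C_\beta$ and $a_1,a_2,b_1,b_2,\rho$, such that for all $N\ge N_0$ and all integers $K,m\ge0$ with $$a_1(\log N)^3\le m\le a_2(\log N)^3,\qquad b_1\frac{N}{(\log N)^{3}}\le K\le b_2\frac{N}{(\log N)^{3}},\qquad Km\le\rho N,$$ the largest rewards found by $\mathcal A^*$ and by SLG are integrable, and $$V_N(\mathcal A^*)-V_N(\mathcal A_{\rm SLG})\le\frac{c\,\log\log N}{(\log N)^{\min\{\beta,\,1-\gamma,\,1/2\}}}.$$ -/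

import Mathlib

open MeasureTheory ProbabilityTheory Set
open scoped ENNReal

noncomputable section

/-! ### Quantiles, expected maxima, Gaussian tails -/

/-- Generalized inverse `F⁻¹(p) = inf {t | p ≤ F t}` of a distribution function `F`. -/
def quantile (F : ℝ → ℝ) (p : ℝ) : ℝ := sInf {t : ℝ | p ≤ F t}

/-- Expected maximum of `n` i.i.d. draws from the law `P`. -/
def expectedMax (P : Measure ℝ) (n : ℕ) : ℝ :=
  ∫ x : Fin n → ℝ, (⨆ j, x j) ∂(Measure.pi fun _ : Fin n => P)

/-- Above its `(1 - α)`-quantile, the law `P` has the density of the normal distribution with mean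
`μ` and variance `σ ^ 2`. Nothing is required below the quantile. -/
def HasGaussianTail (P : Measure ℝ) (α μ σ : ℝ) : Prop :=
  P.restrict (Ici (quantile (cdf P) (1 - α))) =
    (gaussianReal μ (σ ^ 2).toNNReal).restrict (Ici (quantile (cdf P) (1 - α)))

/-! ### Prediction of the value of a state by tail extrapolation -/

/-- The standard normal quantile `Φ⁻¹(1 - a)`. -/
def normalQuantile (a : ℝ) : ℝ := quantile (cdf (gaussianReal 0 1)) (1 - a)

/-- Inverse Mills ratio `φ z / (1 - Φ z)`. -/
def invMills (z : ℝ) : ℝ := gaussianPDFReal 0 1 z / (1 - cdf (gaussianReal 0 1) z)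

/-- Variance of a standard normal variable conditioned to be at least `z`. -/
def truncVar (z : ℝ) : ℝ := 1 + z * invMills z - invMills z ^ 2

/-- Empirical distribution function of the sample `r`. -/
def empiricalCDF {m : ℕ} (r : Fin m → ℝ) (t : ℝ) : ℝ :=
  ((Finset.univ.filter fun j => r j ≤ t).card : ℝ) / m

/-- Indices of the sample points that are at least the empirical `(1 - a)`-quantile. -/
def tailSet {m : ℕ} (a : ℝ) (r : Fin m → ℝ) : Finset (Fin m) :=
  Finset.univ.filter fun j => quantile (empiricalCDF r) (1 - a) ≤ r j

/-- Sample mean of the tail set. -/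
def tailMean {m : ℕ} (a : ℝ) (r : Fin m → ℝ) : ℝ :=
  (∑ j ∈ tailSet a r, r j) / (tailSet a r).card

/-- Sample variance of the tail set. -/
def tailVar {m : ℕ} (a : ℝ) (r : Fin m → ℝ) : ℝ :=
  (∑ j ∈ tailSet a r, (r j - tailMean a r) ^ 2) / (tailSet a r).card

/-- Moment estimator of the tail standard deviation, from the top `α / 2` fraction. -/
def sigmaHat {m : ℕ} (α : ℝ) (r : Fin m → ℝ) : ℝ :=
  Real.sqrt (tailVar (α / 2) r / truncVar (normalQuantile (α / 2)))

/-- Moment estimator of the tail mean parameter, from the top `α / 2` fraction. -/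
def muHat {m : ℕ} (α : ℝ) (r : Fin m → ℝ) : ℝ :=
  tailMean (α / 2) r - sigmaHat α r * invMills (normalQuantile (α / 2))

/-- Predicted expected maximum at budget `N`, computed from the reward sample `r`. -/
def predictedValue {m : ℕ} (α : ℝ) (N : ℕ) (r : Fin m → ℝ) : ℝ :=
  muHat α r + sigmaHat α r * expectedMax (gaussianReal 0 1) N

/-! ### Two-stage generation -/

/-- The kernel that sends `a` to the law of an i.i.d. sequence drawn from `κ a`. -/
def iidKernel {A B : Type*} [MeasurableSpace A] [MeasurableSpace B] (κ : Kernel A B)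
    [IsMarkovKernel κ] : Kernel A (ℕ → B) where
  toFun a := Measure.infinitePi fun _ : ℕ => κ a
  measurable' := by
    refine Measurable.measure_of_isPiSystem_of_isProbabilityMeasure
      (S := squareCylinders fun _ : ℕ => {s : Set B | MeasurableSet s})
      generateFrom_squareCylinders.symm
      (isPiSystem_squareCylinders (fun _ => MeasurableSpace.isPiSystem_measurableSet)
        fun _ => MeasurableSet.univ) ?_
    rintro _ ⟨s, t, ht, rfl⟩
    have ht' : ∀ i ∈ s, MeasurableSet (t i) := fun i _ => ht i (Set.mem_univ i)
    simp_rw [Measure.infinitePi_pi _ ht']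
    exact Finset.measurable_fun_prod s fun i hi => κ.measurable_coe (ht' i hi)

instance {A B : Type*} [MeasurableSpace A] [MeasurableSpace B] (κ : Kernel A B)
    [IsMarkovKernel κ] : IsMarkovKernel (iidKernel κ) :=
  ⟨fun a => inferInstanceAs (IsProbabilityMeasure (Measure.infinitePi fun _ : ℕ => κ a))⟩

/-- Two-stage generation from a fixed prompt: the law of the intermediate state, the law of the
response given the state, and the reward of a response. -/
structure TwoStageModel (S Y : Type*) [MeasurableSpace S] [MeasurableSpace Y] where
  stateLaw : Measure S
  isProb : IsProbabilityMeasure stateLaw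
  response : Kernel S Y
  isMarkov : IsMarkovKernel response
  reward : Y → ℝ
  measurable_reward : Measurable reward

attribute [instance] TwoStageModel.isProb TwoStageModel.isMarkov

/-- A measurable rule that picks a maximizing index, with any way of breaking ties. -/
structure IsArgmaxRule {n : ℕ} (pick : (Fin n → ℝ) → Fin n) : Prop where
  measurable : Measurable pick
  le : ∀ (v : Fin n → ℝ) (i : Fin n), v i ≤ v (pick v)

namespace TwoStageModel

variable {S Y : Type*} [MeasurableSpace S] [MeasurableSpace Y] (M : TwoStageModel S Y)

/-- The reward distribution `F_s` of the state `s`. -/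
def rewardLaw (s : S) : Measure ℝ := (M.response s).map M.reward

/-- The value `V_N(s)`: expected best reward of `N` responses generated from `s`. -/
def stateValue (N : ℕ) (s : S) : ℝ := expectedMax (M.rewardLaw s) N

/-- Probability space on which the search algorithms run: i.i.d. intermediate states, and with each
state the i.i.d. sequence of the responses that successive generations from it produce.
For `ω : ℕ → S × (ℕ → Y)`, the `i`-th state is `(ω i).1` and the `j`-th response generated from it
is `(ω i).2 j`. -/
def runLaw : Measure (ℕ → S × (ℕ → Y)) :=
  Measure.infinitePi fun _ : ℕ => M.stateLaw ⊗ₘ iidKernel M.response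

/-- Best reward found by the full-information oracle at budget `N`: among `N` states it takes one
with the largest `V_N(s)`, and generates `N` responses from it. -/
def oracleOutcome (N : ℕ) (pick : (Fin N → ℝ) → Fin N) (ω : ℕ → S × (ℕ → Y)) : ℝ :=
  ⨆ l : Fin N, M.reward ((ω (pick fun i : Fin N => M.stateValue N (ω i).1)).2 l)

/-- The state selected by SLG search: among `K` states, one with the largest predicted value at
budget `N`, each prediction being made from `m` responses generated from that state. -/
def slgChoice (α : ℝ) (N K m : ℕ) (pick : (Fin K → ℝ) → Fin K) (ω : ℕ → S × (ℕ → Y)) : Fin K :=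
  pick fun i : Fin K => predictedValue α N fun j : Fin m => M.reward ((ω i).2 j)

/-- Best reward found by SLG search with total budget `N`, search width `K` and `m` estimation
samples: the maximum over the `K * m` exploration responses and the `N - K * m` further responses
generated from the selected state. -/
def slgOutcome (α : ℝ) (N K m : ℕ) (pick : (Fin K → ℝ) → Fin K) (ω : ℕ → S × (ℕ → Y)) : ℝ :=
  max (⨆ i : Fin K, ⨆ j : Fin m, M.reward ((ω i).2 j))
    (⨆ l : Fin (N - K * m), M.reward ((ω (M.slgChoice α N K m pick ω)).2 (m + l)))

/-- Expected reward of the full-information oracle at budget `N`. -/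
def oracleValue (N : ℕ) (pick : (Fin N → ℝ) → Fin N) : ℝ :=
  ∫ ω, M.oracleOutcome N pick ω ∂M.runLaw

/-- Expected reward of SLG search at budget `N`. -/
def slgValue (α : ℝ) (N K m : ℕ) (pick : (Fin K → ℝ) → Fin K) : ℝ :=
  ∫ ω, M.slgOutcome α N K m pick ω ∂M.runLaw

/-- Uniform Gaussian tail assumption, with tail parameters `μ s` and `σ s`. The second moment of
the reward is bounded on average over the random state, which is weaker than a bound at every
state (a bound at every state would force `μ` to be bounded). -/
structure UniformGaussianTail (μ σ : S → ℝ) (α σmin σmax CR Mμ : ℝ) : Prop where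
  measurable_mu : Measurable μ
  measurable_sigma : Measurable σ
  tail : ∀ᵐ s ∂M.stateLaw, HasGaussianTail (M.rewardLaw s) α (μ s) (σ s)
  sigma_mem : ∀ᵐ s ∂M.stateLaw, σ s ∈ Icc σmin σmax
  reward_sq : ∫⁻ s, ∫⁻ r, ENNReal.ofReal (r ^ 2) ∂(M.rewardLaw s) ∂M.stateLaw ≤ ENNReal.ofReal CR
  mu_sq : ∫⁻ s, ENNReal.ofReal (μ s ^ 2) ∂M.stateLaw ≤ ENNReal.ofReal Mμ

/-- Regularity of the law of the tail parameters: independence, mass of `σ` near `σmax`, and the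
scaling law of the expected maximum of the means. -/
structure RegularParameters (μ σ : S → ℝ) (σmax κ δ₀ μ₀ Cμ γ β Cβ : ℝ) : Prop where
  indep : IndepFun μ σ M.stateLaw
  mass : ∀ δ : ℝ, 0 < δ → δ ≤ δ₀ → δ ^ κ ≤ M.stateLaw.real {s | σmax - δ ≤ σ s}
  scaling : ∀ n : ℕ, 2 ≤ n →
    |expectedMax (M.stateLaw.map μ) n - (μ₀ + Cμ * Real.log n ^ γ)| ≤ Cβ * Real.log n ^ (-β)

end TwoStageModel

/-- The schedule `m ≍ (log N)³`, `K ≍ N (log N)⁻³` with explicit constants, where exploration uses at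
most the fraction `ρ` of the budget. -/
structure IsSchedule (a₁ a₂ b₁ b₂ ρ : ℝ) (N K m : ℕ) : Prop where
  le_m : a₁ * Real.log N ^ 3 ≤ m
  m_le : (m : ℝ) ≤ a₂ * Real.log N ^ 3
  le_K : b₁ * (N / Real.log N ^ 3) ≤ K
  K_le : (K : ℝ) ≤ b₂ * (N / Real.log N ^ 3)
  budget : (K * m : ℝ) ≤ ρ * N

end

noncomputable section

/-! ### Product measures and maxima -/

/-! Write L = log N and let W(s) = μ(s) + σ(s) E(N) be the exact score of a state. Clipping rewards
at the (1 - α)-quantile leaves a law that depends on the Gaussian tail only, and it changes the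
maximum of n draws only when all of them fall below the quantile. Hence V_n(s) is μ(s) + σ(s) E(n)
up to (1 - α)^(n - 1) times a first moment (`HasStdGaussianTail.expectedMax_eq`).

Oracle. With σ ≤ σmax, its value is at most E[max of N means] + σmax E(N) up to a negligible term
(`oracle_le`). By the scaling law the first summand is at most μ₀ + Cμ L^γ + |Cβ| L^(-β).

SLG. Only the n = N - Km ≥ (1 - ρ)N responses of the second stage are used. The selection does not
look at them, so their best has the mean of V_n at the selected state (`integral_laterBest_pick`).
Four losses have to be paid. (a) Replacing E(n) by E(N) costs O(log L / √L)
(`exists_expectedMax_gaussian_sub_le`). (b) Tail estimation with error of order s fails with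
probability at most 8 exp(-c m s²), uniformly over the laws with the assumed tail
(`exists_measure_predictedValue_error`). Since m is of order L³, the choice s = D / L makes the
failure probability O(N⁻⁴), and the score error is of order s E(N), that is L^(-1/2). Selecting by
approximate scores then loses twice this error, and second moments control the failure event
(`iSup_sub_le_of_argmax`). (c) The best W among K states is bounded below by the states with σ ≥
σmax - 1/L. A fraction of at least L^(-κ) of them is expected, so with high probability there are j
≥ K L^(-κ) / 2. By independence their means are still i.i.d. (`le_integral_iSup_prod`), and giving
up 1/L in σ costs E(N) / L = O(L^(-1/2)). (d) log j ≥ L - (4 + κ) log L, so the scaling law at j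
instead of N loses O(L^(γ - 1) log L + L^(-β)) (`sub_scalingBound_le`). The terms σmax E(N) cancel
in the difference, and every remaining term is O(log L / L^θ) with θ = min(β, 1 - γ, 1/2). -/

lemma map_pi_of_injective {A ι ι' : Type*} [MeasurableSpace A] [Fintype ι] [Fintype ι']
    (P : Measure A) [IsProbabilityMeasure P] {e : ι' → ι} (he : Function.Injective e) :
    (Measure.pi fun _ : ι => P).map (fun x k => x (e k)) = Measure.pi fun _ : ι' => P := by
  rw [← Measure.infinitePi_eq_pi, ← Measure.infinitePi_eq_pi]
  exact Measure.map_infinitePi_infinitePi_of_inj (P := fun _ : ι => P) he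

lemma map_infinitePi_of_injective {A ι : Type*} [MeasurableSpace A] [Fintype ι]
    (P : Measure A) [IsProbabilityMeasure P] {e : ι → ℕ} (he : Function.Injective e) :
    (Measure.infinitePi fun _ : ℕ => P).map (fun x k => x (e k)) = Measure.pi fun _ : ι => P := by
  rw [← Measure.infinitePi_eq_pi]
  exact Measure.map_infinitePi_infinitePi_of_inj (P := fun _ : ℕ => P) he

lemma map_pi_comp {A B ι : Type*} [MeasurableSpace A] [MeasurableSpace B] [Fintype ι]
    (P : Measure A) [IsProbabilityMeasure P] {f : A → B} (hf : Measurable f) :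
    (Measure.pi fun _ : ι => P).map (fun x k => f (x k)) = Measure.pi fun _ : ι => P.map f :=
  have := Measure.isProbabilityMeasure_map (μ := P) hf.aemeasurable
  Measure.pi_map_pi (fun _ => hf.aemeasurable)

lemma measurePreserving_eval_pi {A ι : Type*} [MeasurableSpace A] [Fintype ι] (P : Measure A)
    [IsProbabilityMeasure P] (i : ι) :
    MeasurePreserving (fun x : ι → A => x i) (Measure.pi fun _ : ι => P) P :=
  measurePreserving_eval (fun _ : ι => P) i

lemma le_iSup_fin {ι : Type*} [Finite ι] (x : ι → ℝ) (i : ι) : x i ≤ ⨆ j, x j :=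
  le_ciSup (Set.finite_range x).bddAbove i

lemma abs_iSup_le_sum {ι : Type*} [Fintype ι] (x : ι → ℝ) : |⨆ j, x j| ≤ ∑ j, |x j| := by
  rcases isEmpty_or_nonempty ι with h | h
  · simp
  · obtain ⟨i, hi⟩ := exists_eq_ciSup_of_finite (f := x)
    rw [← hi]
    exact Finset.single_le_sum (f := fun j => |x j|) (fun j _ => abs_nonneg _) (Finset.mem_univ i)

lemma measurable_iSup_fin {A ι : Type*} [MeasurableSpace A] [Fintype ι] {f : ι → A → ℝ}
    (hf : ∀ i, Measurable (f i)) : Measurable fun a => ⨆ i, f i a :=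
  Measurable.iSup hf

lemma integrable_iSup_fin {A ι : Type*} [MeasurableSpace A] [Fintype ι] {Q : Measure A}
    {f : ι → A → ℝ} (hm : ∀ i, Measurable (f i)) (hf : ∀ i, Integrable (f i) Q) :
    Integrable (fun a => ⨆ i, f i a) Q := by
  refine Integrable.mono' (g := fun a => ∑ i, |f i a|)
    (integrable_finsetSum _ fun i _ => (hf i).abs)
    (measurable_iSup_fin hm).aestronglyMeasurable (ae_of_all _ fun a => ?_)
  exact abs_iSup_le_sum _

lemma integrable_eval_pi {ι : Type*} [Fintype ι] {P : Measure ℝ} [IsProbabilityMeasure P]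
    (hP : Integrable (fun x => x) P) (i : ι) :
    Integrable (fun x : ι → ℝ => x i) (Measure.pi fun _ : ι => P) :=
  (measurePreserving_eval_pi P i).integrable_comp_of_integrable (g := fun x => x) hP

lemma integrable_iSup_pi {ι : Type*} [Fintype ι] {P : Measure ℝ} [IsProbabilityMeasure P]
    (hP : Integrable (fun x => x) P) :
    Integrable (fun x : ι → ℝ => ⨆ j, x j) (Measure.pi fun _ : ι => P) :=
  integrable_iSup_fin (fun i => measurable_pi_apply i) fun i => integrable_eval_pi hP i

lemma integral_eval_pi {A ι : Type*} [MeasurableSpace A] [Fintype ι] {P : Measure A}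
    [IsProbabilityMeasure P] {f : A → ℝ} (hf : AEStronglyMeasurable f P) (i : ι) :
    ∫ x : ι → A, f (x i) ∂(Measure.pi fun _ : ι => P) = ∫ a, f a ∂P := by
  have h := (measurePreserving_eval_pi (ι := ι) P i).map_eq
  conv_rhs => rw [← h]
  rw [integral_map (measurable_pi_apply i).aemeasurable (by rwa [h])]

lemma integral_le_expectedMax {P : Measure ℝ} [IsProbabilityMeasure P]
    (hP : Integrable (fun x => x) P) {n : ℕ} (hn : 1 ≤ n) : ∫ x, x ∂P ≤ expectedMax P n := by
  have h := integral_eval_pi (ι := Fin n) hP.aestronglyMeasurable ⟨0, hn⟩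
  rw [← h, expectedMax]
  exact integral_mono (integrable_eval_pi hP _) (integrable_iSup_pi hP) fun x => le_iSup_fin x _

lemma iSup_affine {n : ℕ} (hn : 1 ≤ n) {b : ℝ} (a : ℝ) (hb : 0 ≤ b) (x : Fin n → ℝ) :
    ⨆ j, (a + b * x j) = a + b * ⨆ j, x j := by
  have : Nonempty (Fin n) := ⟨⟨0, hn⟩⟩
  obtain ⟨i, hi⟩ := exists_eq_ciSup_of_finite (f := x)
  apply le_antisymm
  · refine ciSup_le fun j => ?_
    have := mul_le_mul_of_nonneg_left (le_iSup_fin x j) hb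
    linarith
  · rw [← hi]
    exact le_iSup_fin (fun j => a + b * x j) i

lemma expectedMax_map {P : Measure ℝ} [IsProbabilityMeasure P] {f : ℝ → ℝ} (hf : Measurable f)
    (n : ℕ) : expectedMax (P.map f) n = ∫ x : Fin n → ℝ, ⨆ j, f (x j) ∂(Measure.pi fun _ => P) := by
  rw [expectedMax, ← map_pi_comp P hf, integral_map]
  · exact (measurable_pi_lambda _ fun i => hf.comp (measurable_pi_apply i)).aemeasurable
  · exact (measurable_iSup_fin fun i => measurable_pi_apply i).aestronglyMeasurable

lemma expectedMax_map_affine {P : Measure ℝ} [IsProbabilityMeasure P]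
    (hP : Integrable (fun x => x) P) {n : ℕ} (hn : 1 ≤ n) (a : ℝ) {b : ℝ} (hb : 0 ≤ b) :
    expectedMax (P.map fun x => a + b * x) n = a + b * expectedMax P n := by
  rw [expectedMax_map (by fun_prop)]
  simp_rw [iSup_affine hn a hb]
  rw [integral_add (integrable_const _) ((integrable_iSup_pi hP).const_mul b),
    integral_const_mul]
  simp [expectedMax]

lemma integrable_sub_iSup_posPart {ι : Type*} [Fintype ι] {P : Measure ℝ}
    [IsProbabilityMeasure P] (hP : Integrable (fun x => x) P) (q : ℝ) :
    Integrable (fun x : ι → ℝ => max (q - ⨆ j, x j) 0) (Measure.pi fun _ : ι => P) :=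
  ((integrable_const q).sub (integrable_iSup_pi hP)).pos_part

/-- The shortfall (q - max)⁺ is at most (q - x₀)⁺ times the product of the indicators of x_i < q
over the other coordinates, and the integral of this product factorizes. One coordinate pays the
moment, hence the exponent n - 1. -/
lemma integral_sub_max_posPart_le {P : Measure ℝ} [IsProbabilityMeasure P]
    (hP : Integrable (fun x => x) P) {n : ℕ} (hn : 1 ≤ n) (q : ℝ) :
    ∫ x : Fin n → ℝ, max (q - ⨆ j, x j) 0 ∂(Measure.pi fun _ => P) ≤
      P.real (Iio q) ^ (n - 1) * ∫ x, max (q - x) 0 ∂P := by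
  obtain ⟨k, rfl⟩ : ∃ k, n = k + 1 := ⟨n - 1, by omega⟩
  let f : Fin (k + 1) → ℝ → ℝ :=
    Fin.cons (fun x => max (q - x) 0) fun _ => (Iio q).indicator 1
  have hint : ∀ i, Integrable (f i) P := by
    intro i
    refine Fin.cases ?_ (fun j => ?_) i
    · exact ((integrable_const q).sub hP).pos_part
    · exact (integrable_const (1 : ℝ)).indicator measurableSet_Iio
  have h := integral_fintype_prod_eq_prod (μ := fun _ : Fin (k + 1) => P) f
  rw [Fin.prod_univ_succ (fun i => ∫ x, f i x ∂P)] at h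
  simp only [f, Fin.cons_zero, Fin.cons_succ, integral_indicator_one measurableSet_Iio,
    Finset.prod_const, Finset.card_univ, Fintype.card_fin] at h
  rw [Nat.add_sub_cancel, mul_comm, ← h]
  refine integral_mono (integrable_sub_iSup_posPart hP q)
    (Integrable.fintype_prod (f := f) hint) fun x => ?_
  have hx : ∀ i, x i ≤ ⨆ j, x j := le_iSup_fin x
  simp only [Fin.prod_univ_succ, Fin.cons_zero, Fin.cons_succ]
  by_cases hq : (⨆ j, x j) < q
  · have h1 : ∀ i : Fin k, (Iio q).indicator (1 : ℝ → ℝ) (x i.succ) = 1 := fun i =>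
      indicator_of_mem (show x i.succ ∈ Iio q from lt_of_le_of_lt (hx _) hq) _
    simp only [h1, Finset.prod_const_one, mul_one]
    exact max_le_max (by linarith [hx 0]) le_rfl
  · rw [max_eq_right (by linarith)]
    exact mul_nonneg (le_max_right _ _) (Finset.prod_nonneg fun i _ =>
      indicator_nonneg (fun _ _ => zero_le_one) _)

/-- Pointwise, the maximum plus its shortfall below q is the maximum of the draws clipped at q. The
right-hand side no longer sees P below q, which is how the unknown bulk of a reward law is removed.
-/
lemma expectedMax_add_integral_sub_posPart {P : Measure ℝ} [IsProbabilityMeasure P]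
    (hP : Integrable (fun x => x) P) {n : ℕ} (hn : 1 ≤ n) (q : ℝ) :
    expectedMax P n + ∫ x : Fin n → ℝ, max (q - ⨆ j, x j) 0 ∂(Measure.pi fun _ => P) =
      expectedMax (P.map fun x => max x q) n := by
  have : Nonempty (Fin n) := ⟨⟨0, hn⟩⟩
  rw [expectedMax_map (by fun_prop), expectedMax, ← integral_add (integrable_iSup_pi hP)
    (integrable_sub_iSup_posPart hP q)]
  congr 1 with x
  have h : ⨆ j, max (x j) q = max (⨆ j, x j) q := by
    apply le_antisymm
    · exact ciSup_le fun j => max_le_max (le_iSup_fin x j) le_rfl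
    · refine max_le (ciSup_le fun j => ?_) ?_
      · exact (le_max_left _ _).trans (le_iSup_fin (fun j => max (x j) q) j)
      · exact (le_max_right _ _).trans (le_iSup_fin (fun j => max (x j) q) ⟨0, hn⟩)
  rw [h, add_max]
  simp [max_comm]

/-- The expected maximum is at least `q`, up to the probability that all draws fall below `q`. -/
lemma le_expectedMax {P : Measure ℝ} [IsProbabilityMeasure P]
    (hP : Integrable (fun x => x) P) {n : ℕ} (hn : 1 ≤ n) (q : ℝ) :
    q - P.real (Iio q) ^ (n - 1) * ∫ x, max (q - x) 0 ∂P ≤ expectedMax P n := by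
  have h1 := integral_sub_max_posPart_le hP hn q
  have h2 : q ≤ expectedMax P n +
      ∫ x : Fin n → ℝ, max (q - ⨆ j, x j) 0 ∂(Measure.pi fun _ => P) := by
    rw [expectedMax, ← integral_add (integrable_iSup_pi hP)
      (integrable_sub_iSup_posPart hP q)]
    calc q = ∫ x : Fin n → ℝ, q ∂(Measure.pi fun _ => P) := by simp
      _ ≤ _ := integral_mono (integrable_const _) ((integrable_iSup_pi hP).add
          (integrable_sub_iSup_posPart hP q)) fun x => by
            have := le_max_left (q - ⨆ j, x j) 0
            change q ≤ (⨆ j, x j) + max (q - ⨆ j, x j) 0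
            linarith
  linarith

/-! ### The standard normal distribution -/

instance nullSingletonClass_stdGaussian : NullSingletonClass (gaussianReal 0 1) :=
  nullSingletonClass_gaussianReal one_ne_zero

lemma gaussianPDFReal_std (x : ℝ) :
    gaussianPDFReal 0 1 x = (Real.sqrt (2 * Real.pi))⁻¹ * Real.exp (-x ^ 2 / 2) := by
  simp [gaussianPDFReal]

lemma gaussianPDFReal_std_le_one (x : ℝ) : gaussianPDFReal 0 1 x ≤ 1 := by
  rw [gaussianPDFReal_std]
  have h1 : (1 : ℝ) ≤ Real.sqrt (2 * Real.pi) := by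
    rw [Real.one_le_sqrt]; linarith [Real.pi_gt_three]
  exact mul_le_one₀ (inv_le_one_of_one_le₀ h1) (Real.exp_pos _).le
    (Real.exp_le_one_iff.mpr (by nlinarith [sq_nonneg x]))

lemma gaussianReal_std_real (s : Set ℝ) :
    (gaussianReal 0 1).real s = ∫ x in s, gaussianPDFReal 0 1 x := by
  rw [measureReal_def, gaussianReal_apply_eq_integral 0 one_ne_zero,
    ENNReal.toReal_ofReal (integral_nonneg fun x => gaussianPDFReal_nonneg _ _ _)]

lemma gaussianReal_std_Ico_le {s t : ℝ} (h : s ≤ t) : (gaussianReal 0 1).real (Ico s t) ≤ t - s := by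
  rw [gaussianReal_std_real]
  calc ∫ x in Ico s t, gaussianPDFReal 0 1 x ≤ ∫ _ in Ico s t, (1 : ℝ) :=
        setIntegral_mono (integrable_gaussianPDFReal 0 1).integrableOn
          (integrableOn_const (by simp)) gaussianPDFReal_std_le_one
    _ = t - s := by simp [h]

lemma le_gaussianReal_std_Ico {s t c : ℝ} (h : s ≤ t)
    (hc : ∀ x ∈ Ico s t, c ≤ gaussianPDFReal 0 1 x) :
    c * (t - s) ≤ (gaussianReal 0 1).real (Ico s t) := by
  rw [gaussianReal_std_real]
  calc c * (t - s) = ∫ _ in Ico s t, c := by simp [h, mul_comm]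
    _ ≤ ∫ x in Ico s t, gaussianPDFReal 0 1 x :=
      setIntegral_mono_on (integrableOn_const (by simp))
        (integrable_gaussianPDFReal 0 1).integrableOn measurableSet_Ico hc

lemma gaussianPDFReal_std_anti {x y : ℝ} (h : |x| ≤ y) :
    gaussianPDFReal 0 1 y ≤ gaussianPDFReal 0 1 x := by
  rw [gaussianPDFReal_std, gaussianPDFReal_std]
  have : x ^ 2 ≤ y ^ 2 := sq_le_sq' (by linarith [(abs_le.mp h).1]) (abs_le.mp h).2
  gcongr

lemma gaussianReal_std_Ici_sub {s t : ℝ} (h : s ≤ t) :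
    (gaussianReal 0 1).real (Ici s) = (gaussianReal 0 1).real (Ico s t) +
      (gaussianReal 0 1).real (Ici t) := by
  rw [← Ico_union_Ici_eq_Ici h, measureReal_union _ measurableSet_Ici]
  exact Set.disjoint_left.mpr fun x hx hx' => not_lt.mpr hx' hx.2

lemma gaussianReal_std_Ici_strictAnti : StrictAnti fun t => (gaussianReal 0 1).real (Ici t) := by
  intro s t h
  have h1 := gaussianReal_std_Ici_sub h.le
  have h2 := le_gaussianReal_std_Ico (c := gaussianPDFReal 0 1 (max |s| |t|)) h.le fun x hx =>
    gaussianPDFReal_std_anti (by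
      rw [abs_le]
      constructor
      · linarith [neg_abs_le s, le_max_left |s| |t|, hx.1]
      · linarith [le_abs_self t, le_max_right |s| |t|, hx.2])
  have h3 := mul_pos (gaussianPDFReal_pos 0 1 (max |s| |t|) one_ne_zero) (sub_pos.mpr h)
  simp only
  linarith

lemma cdf_gaussianReal_std (t : ℝ) :
    cdf (gaussianReal 0 1) t = 1 - (gaussianReal 0 1).real (Ici t) := by
  rw [cdf_eq_real, ← measureReal_congr (Iio_ae_eq_Iic (a := t)),
    ← probReal_compl_eq_one_sub measurableSet_Ici, compl_Ici]

lemma continuous_cdf_gaussianReal_std : Continuous (cdf (gaussianReal 0 1)) := by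
  have h : ∀ s t : ℝ, s ≤ t →
      |cdf (gaussianReal 0 1) s - cdf (gaussianReal 0 1) t| ≤ t - s := fun s t hst => by
    rw [cdf_gaussianReal_std, cdf_gaussianReal_std, gaussianReal_std_Ici_sub hst]
    have h1 := gaussianReal_std_Ico_le hst
    have h2 := measureReal_nonneg (μ := gaussianReal 0 1) (s := Ico s t)
    rw [abs_le]; constructor <;> linarith
  refine LipschitzWith.continuous (K := 1) (LipschitzWith.of_dist_le_mul fun s t => ?_)
  rw [Real.dist_eq, Real.dist_eq, NNReal.coe_one, one_mul]
  rcases le_total s t with hst | hst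
  · rw [abs_sub_comm s t, abs_of_nonneg (sub_nonneg.mpr hst)]; exact h s t hst
  · rw [abs_sub_comm, abs_of_nonneg (sub_nonneg.mpr hst)]; exact h t s hst

lemma gaussianReal_Ici_normalQuantile {a : ℝ} (ha : 0 < a) (ha1 : a < 1) :
    (gaussianReal 0 1).real (Ici (normalQuantile a)) = a := by
  obtain ⟨t, ht⟩ : ∃ t, cdf (gaussianReal 0 1) t = 1 - a := by
    have h0 := (tendsto_cdf_atBot (gaussianReal 0 1)).eventually (gt_mem_nhds (sub_pos.mpr ha1))
    have h1 := (tendsto_cdf_atTop (gaussianReal 0 1)).eventually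
      (lt_mem_nhds (show 1 - a < 1 by linarith))
    obtain ⟨u, hu⟩ := h0.exists
    obtain ⟨v, hv⟩ := h1.exists
    exact mem_range_of_exists_le_of_exists_ge continuous_cdf_gaussianReal_std
      ⟨u, hu.le⟩ ⟨v, hv.le⟩
  have hm : StrictMono (cdf (gaussianReal 0 1)) := fun s t h => by
    rw [cdf_gaussianReal_std, cdf_gaussianReal_std]
    have := gaussianReal_std_Ici_strictAnti h
    simp only at this
    linarith
  have hs : {x | 1 - a ≤ cdf (gaussianReal 0 1) x} = Ici t := by
    ext x
    rw [mem_ofPred_eq, ← ht, hm.le_iff_le, mem_Ici]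
  rw [normalQuantile, quantile, hs, csInf_Ici]
  rw [cdf_gaussianReal_std] at ht
  linarith

lemma integrable_id_gaussianReal_std : Integrable (fun x => x) (gaussianReal 0 1) := by
  have h := memLp_id_gaussianReal (μ := 0) (v := 1) 1
  exact memLp_one_iff_integrable.mp h

/-! ### Laws with a standard normal upper tail -/

/-- On `[Φ⁻¹(1 - α), ∞)` the law `P` coincides with the standard normal law. -/
def HasStdGaussianTail (α : ℝ) (P : Measure ℝ) : Prop :=
  P.restrict (Ici (normalQuantile α)) = (gaussianReal 0 1).restrict (Ici (normalQuantile α))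

/-- To the left of the quantile the distribution function is at most 1 - α, and the open half-line
below the quantile is an increasing union of closed ones. -/
lemma le_measure_Ici_quantile (P : Measure ℝ) [IsProbabilityMeasure P] {α : ℝ} (hα1 : α < 1) :
    α ≤ P.real (Ici (quantile (cdf P) (1 - α))) := by
  set q := quantile (cdf P) (1 - α) with hq
  have hbdd : BddBelow {t : ℝ | 1 - α ≤ cdf P t} := by
    have h0 := (tendsto_cdf_atBot P).eventually (gt_mem_nhds (sub_pos.mpr hα1))
    obtain ⟨u, hu⟩ := h0.exists
    refine ⟨u, fun t ht => le_of_not_gt fun htu => ?_⟩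
    have : cdf P t ≤ cdf P u := monotone_cdf P htu.le
    have ht' : 1 - α ≤ cdf P t := ht
    linarith
  have hlt : ∀ t < q, cdf P t ≤ 1 - α := fun t ht => by
    by_contra! h
    exact absurd (csInf_le hbdd (show t ∈ {t : ℝ | 1 - α ≤ cdf P t} from h.le)) (not_le.mpr ht)
  have hIio : P.real (Iio q) ≤ 1 - α := by
    obtain ⟨u, humono, hult, hutend⟩ := exists_seq_strictMono_tendsto q
    have hU : Iio q = ⋃ n, Iic (u n) := by
      ext x
      simp only [mem_Iio, mem_iUnion, mem_Iic]
      constructor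
      · intro hx
        obtain ⟨n, hn⟩ := (hutend.eventually (lt_mem_nhds hx)).exists
        exact ⟨n, hn.le⟩
      · rintro ⟨n, hn⟩
        exact lt_of_le_of_lt hn (hult n)
    have ht := tendsto_measure_iUnion_atTop (μ := P) (s := fun n => Iic (u n))
      (fun m n h => Iic_subset_Iic.mpr (humono.monotone h))
    rw [← hU] at ht
    have ht' := (ENNReal.tendsto_toReal (measure_ne_top P _)).comp ht
    refine le_of_tendsto ht' (Filter.Eventually.of_forall fun n => ?_)
    have := hlt (u n) (hult n)
    rwa [cdf_eq_real] at this
  rw [← compl_Iio, probReal_compl_eq_one_sub measurableSet_Iio]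
  linarith

lemma gaussianReal_map_standardize (μ : ℝ) {σ : ℝ} (hσ : 0 < σ) :
    (gaussianReal μ (σ ^ 2).toNNReal).map (fun x => (x - μ) / σ) = gaussianReal 0 1 := by
  have h : (fun x => (x - μ) / σ) = (fun x => x / σ) ∘ fun x => x - μ := rfl
  rw [h, ← Measure.map_map (by fun_prop) (by fun_prop), gaussianReal_map_sub_const,
    gaussianReal_map_div_const]
  congr 1
  · simp
  · ext
    simp [Real.coe_toNNReal _ (sq_nonneg σ), hσ.ne']

lemma preimage_standardize_Ici (μ z : ℝ) {σ : ℝ} (hσ : 0 < σ) :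
    (fun x => (x - μ) / σ) ⁻¹' Ici z = Ici (μ + σ * z) := by
  ext x
  rw [mem_preimage, mem_Ici, mem_Ici, le_div_iff₀ hσ]
  constructor <;> intro h <;> linarith

/-- The quantile of P is defined by P itself, so it has to be compared with the Gaussian quantile μ
+ σ z. The Gaussian mass above the quantile of P equals the mass of P there, which is at least α;
the quantile therefore cannot exceed μ + σ z, and [μ + σ z, ∞) lies in the region where the density
is known. -/
lemma HasGaussianTail.standardize {P : Measure ℝ} [IsProbabilityMeasure P] {α μ σ : ℝ}
    (h : HasGaussianTail P α μ σ) (hα : 0 < α) (hα1 : α < 1) (hσ : 0 < σ) :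
    HasStdGaussianTail α (P.map fun x => (x - μ) / σ) := by
  set q := quantile (cdf P) (1 - α) with hq
  have hT : Measurable fun x : ℝ => (x - μ) / σ := by fun_prop
  have hqz : q ≤ μ + σ * normalQuantile α := by
    by_contra! hlt
    have h1 : α ≤ (gaussianReal μ (σ ^ 2).toNNReal).real (Ici q) := by
      have h2 := congrArg (fun ν => ν.real (Ici q)) h
      simp only [measureReal_restrict_apply_self, ← hq] at h2
      rw [← h2]
      exact le_measure_Ici_quantile P hα1
    have hqe : Ici q = (fun x => (x - μ) / σ) ⁻¹' Ici ((q - μ) / σ) := by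
      rw [preimage_standardize_Ici _ _ hσ, mul_div_cancel₀ _ hσ.ne', add_sub_cancel]
    rw [hqe, ← map_measureReal_apply hT measurableSet_Ici, gaussianReal_map_standardize _ hσ] at h1
    have h3 : normalQuantile α < (q - μ) / σ := by
      rw [lt_div_iff₀ hσ]; linarith
    have h4 := gaussianReal_std_Ici_strictAnti h3
    simp only [gaussianReal_Ici_normalQuantile hα hα1] at h4
    linarith
  rw [HasStdGaussianTail, Measure.restrict_map hT measurableSet_Ici,
    ← gaussianReal_map_standardize μ hσ, Measure.restrict_map hT measurableSet_Ici,
    preimage_standardize_Ici _ _ hσ]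
  have h5 : Ici (μ + σ * normalQuantile α) ⊆ Ici q := Ici_subset_Ici.mpr hqz
  have h6 := congrArg (fun ν => ν.restrict (Ici (μ + σ * normalQuantile α))) h
  simp only [← hq, Measure.restrict_restrict_of_subset h5] at h6
  rw [h6]

namespace HasStdGaussianTail

variable {α : ℝ} {P : Measure ℝ} [IsProbabilityMeasure P]

lemma measureReal_Iio (h : HasStdGaussianTail α P) (hα : 0 < α) (hα1 : α < 1) :
    P.real (Iio (normalQuantile α)) = 1 - α := by
  have h2 := congrArg (fun ν => ν.real (Ici (normalQuantile α))) h
  simp only [measureReal_restrict_apply_self, gaussianReal_Ici_normalQuantile hα hα1] at h2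
  rw [← compl_Ici, probReal_compl_eq_one_sub measurableSet_Ici, h2]

/-- The part of P below the quantile has total mass 1 - α, however it is spread, and g sends all of
it to the single point c. This makes all later estimates uniform over P. -/
lemma map_eq {B : Type*} [MeasurableSpace B] (h : HasStdGaussianTail α P)
    (hα : 0 < α) (hα1 : α < 1)
    {g : ℝ → B} (hg : Measurable g) {c : B} (hc : ∀ x < normalQuantile α, g x = c) :
    P.map g = (gaussianReal 0 1).map g := by
  have key : ∀ (R : Measure ℝ) [IsProbabilityMeasure R], HasStdGaussianTail α R →
      ∀ s : Set B, MeasurableSet s → R.real (g ⁻¹' s) =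
        ((gaussianReal 0 1).restrict (Ici (normalQuantile α))).real (g ⁻¹' s) +
          s.indicator (fun _ => 1 - α) c := by
    intro R _ hR s hs
    rw [← hR, measureReal_restrict_apply (hg hs), ← measureReal_inter_add_sdiff (μ := R)
      (s := g ⁻¹' s) (t := Ici (normalQuantile α)) measurableSet_Ici]
    congr 1
    by_cases hcs : c ∈ s
    · rw [indicator_of_mem hcs, ← hR.measureReal_Iio hα hα1]
      congr 1
      ext x
      simp only [mem_sdiff, mem_preimage, mem_Ici, not_le, mem_Iio]
      exact ⟨fun hx => hx.2, fun hx => ⟨by rwa [hc x hx], hx⟩⟩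
    · rw [indicator_of_notMem hcs]
      have : g ⁻¹' s \ Ici (normalQuantile α) = ∅ := by
        ext x
        simp only [mem_sdiff, mem_preimage, mem_Ici, not_le, mem_empty_iff_false, iff_false, not_and]
        intro hx hlt
        rw [hc x hlt] at hx
        exact hcs hx
      rw [this, measureReal_empty]
  ext s hs
  rw [Measure.map_apply hg hs, Measure.map_apply hg hs]
  have e := (key P h s hs).trans (key (gaussianReal 0 1) rfl s hs).symm
  rwa [measureReal_def, measureReal_def,
    ENNReal.toReal_eq_toReal_iff' (measure_ne_top _ _) (measure_ne_top _ _)] at e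

/-- Both sides are the expected maximum of draws clipped at the quantile. The two inequalities that
follow drop the shortfall on one side and bound the other one. -/
lemma expectedMax_eq (h : HasStdGaussianTail α P) (hα : 0 < α) (hα1 : α < 1)
    (hP : Integrable (fun x => x) P) {n : ℕ} (hn : 1 ≤ n) :
    expectedMax P n + ∫ x : Fin n → ℝ, max (normalQuantile α - ⨆ j, x j) 0 ∂(Measure.pi fun _ => P)
      = expectedMax (gaussianReal 0 1) n +
        ∫ x : Fin n → ℝ, max (normalQuantile α - ⨆ j, x j) 0
          ∂(Measure.pi fun _ => gaussianReal 0 1) := by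
  rw [expectedMax_add_integral_sub_posPart hP hn,
    expectedMax_add_integral_sub_posPart integrable_id_gaussianReal_std hn,
    h.map_eq hα hα1 (c := normalQuantile α) (by fun_prop) fun x hx => max_eq_right hx.le]

lemma expectedMax_le (h : HasStdGaussianTail α P) (hα : 0 < α) (hα1 : α < 1)
    (hP : Integrable (fun x => x) P) {n : ℕ} (hn : 1 ≤ n) :
    expectedMax P n ≤ expectedMax (gaussianReal 0 1) n +
      (1 - α) ^ (n - 1) * ∫ x, max (normalQuantile α - x) 0 ∂(gaussianReal 0 1) := by
  have h1 := h.expectedMax_eq hα hα1 hP hn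
  have h2 := integral_sub_max_posPart_le integrable_id_gaussianReal_std hn (normalQuantile α)
  rw [measureReal_Iio (P := gaussianReal 0 1) rfl hα hα1] at h2
  have h3 : 0 ≤ ∫ x : Fin n → ℝ, max (normalQuantile α - ⨆ j, x j) 0 ∂(Measure.pi fun _ => P) :=
    integral_nonneg fun x => le_max_right _ _
  linarith

lemma le_expectedMax (h : HasStdGaussianTail α P) (hα : 0 < α) (hα1 : α < 1)
    (hP : Integrable (fun x => x) P) {n : ℕ} (hn : 1 ≤ n) :
    expectedMax (gaussianReal 0 1) n -
      (1 - α) ^ (n - 1) * ∫ x, max (normalQuantile α - x) 0 ∂P ≤ expectedMax P n := by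
  have h1 := h.expectedMax_eq hα hα1 hP hn
  have h2 := integral_sub_max_posPart_le hP hn (normalQuantile α)
  rw [h.measureReal_Iio hα hα1] at h2
  have h3 : 0 ≤ ∫ x : Fin n → ℝ, max (normalQuantile α - ⨆ j, x j) 0
      ∂(Measure.pi fun _ => gaussianReal 0 1) :=
    integral_nonneg fun x => le_max_right _ _
  linarith

end HasStdGaussianTail

/-! ### Expected maxima of standard normal samples -/

lemma expectedMax_gaussian_nonneg {n : ℕ} (hn : 1 ≤ n) : 0 ≤ expectedMax (gaussianReal 0 1) n := by
  have h := integral_le_expectedMax integrable_id_gaussianReal_std hn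
  rwa [integral_id_gaussianReal] at h

lemma integral_exp_mul_gaussianReal_std (s : ℝ) :
    ∫ x, Real.exp (s * x) ∂(gaussianReal 0 1) = Real.exp (s ^ 2 / 2) := by
  have h := congrFun (mgf_fun_id_gaussianReal (μ := 0) (v := 1)) s
  simpa [mgf] using h

/-- The exponential-moment bound with parameter s = √(2 log n): the sum of the exp(s x_j) has mean n
exp(s²/2) = exp(s²). -/
lemma expectedMax_gaussian_le {n : ℕ} (hn : 2 ≤ n) :
    expectedMax (gaussianReal 0 1) n ≤ Real.sqrt (2 * Real.log n) := by
  have hne : Nonempty (Fin n) := ⟨⟨0, by omega⟩⟩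
  have hn0 : (0 : ℝ) < n := by positivity
  have hlog : 0 < Real.log n := Real.log_pos (by exact_mod_cast hn)
  set s := Real.sqrt (2 * Real.log n) with hs
  have hs0 : 0 < s := Real.sqrt_pos.mpr (by positivity)
  have hs2 : s ^ 2 = 2 * Real.log n := Real.sq_sqrt (by positivity)
  set A := s ^ 2 with hA
  have hint : ∀ j : Fin n, Integrable (fun x : Fin n → ℝ => Real.exp (s * x j))
      (Measure.pi fun _ => gaussianReal 0 1) := fun j =>
    (measurePreserving_eval_pi (gaussianReal 0 1) j).integrable_comp_of_integrable
      (g := fun x => Real.exp (s * x)) (integrable_exp_mul_gaussianReal s)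
  have hsum : ∫ x : Fin n → ℝ, (∑ j, Real.exp (s * x j))
      ∂(Measure.pi fun _ => gaussianReal 0 1) = Real.exp A := by
    rw [integral_finsetSum _ fun j _ => hint j]
    have : ∀ j : Fin n, ∫ x : Fin n → ℝ, Real.exp (s * x j)
        ∂(Measure.pi fun _ => gaussianReal 0 1) = Real.exp (s ^ 2 / 2) := fun j => by
      rw [← integral_exp_mul_gaussianReal_std]
      exact integral_eval_pi (f := fun x => Real.exp (s * x))
        (integrable_exp_mul_gaussianReal s).aestronglyMeasurable j
    simp only [this, Finset.sum_const, Finset.card_univ, Fintype.card_fin, nsmul_eq_mul]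
    rw [show s ^ 2 = A from rfl, hs2, mul_div_cancel_left₀ _ two_ne_zero, two_mul, Real.exp_add, Real.exp_log hn0]
  have hpt : ∀ x : Fin n → ℝ, s * (⨆ j, x j) ≤
      A - 1 + Real.exp (-A) * ∑ j, Real.exp (s * x j) := fun x => by
    obtain ⟨i, hi⟩ := exists_eq_ciSup_of_finite (f := x)
    have h1 : Real.exp (s * x i) ≤ ∑ j, Real.exp (s * x j) :=
      Finset.single_le_sum (f := fun j => Real.exp (s * x j)) (fun j _ => (Real.exp_pos _).le)
        (Finset.mem_univ i)
    have h2 := Real.add_one_le_exp (s * x i - A)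
    rw [sub_eq_add_neg, add_comm (s * x i) (-A), Real.exp_add] at h2
    have h3 := mul_le_mul_of_nonneg_left h1 (Real.exp_pos (-A)).le
    rw [← hi]
    linarith
  have h4 := integral_mono ((integrable_iSup_pi integrable_id_gaussianReal_std).const_mul s)
    ((integrable_const (A - 1)).add
      ((integrable_finsetSum _ fun j _ => hint j).const_mul (Real.exp (-A)))) hpt
  rw [integral_const_mul] at h4
  have h5 : ∫ x : Fin n → ℝ, (A - 1 + Real.exp (-A) * ∑ j, Real.exp (s * x j))
      ∂(Measure.pi fun _ => gaussianReal 0 1) = A := by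
    rw [integral_add (integrable_const _)
      ((integrable_finsetSum _ fun j _ => hint j).const_mul (Real.exp (-A))), integral_const_mul,
      hsum, ← Real.exp_add]
    simp
  have h6 : s * expectedMax (gaussianReal 0 1) n ≤ s * s := by
    calc _ ≤ A := h4.trans_eq h5
      _ = s * s := by rw [hA, sq]
  exact le_of_mul_le_mul_left h6 hs0

/-- Only the mass of [t, t + 1/t] is kept. On this interval the exponent x²/2 exceeds t²/2 by at
most 1 + 1/(2t²) ≤ 3/2. -/
lemma le_gaussianReal_std_Ici {t : ℝ} (ht : 1 ≤ t) :
    (Real.sqrt (2 * Real.pi))⁻¹ * Real.exp (-(3 / 2)) * (Real.exp (-t ^ 2 / 2) / t) ≤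
      (gaussianReal 0 1).real (Ici t) := by
  have ht0 : 0 < t := by linarith
  have hle : t ≤ t + 1 / t := by have := one_div_pos.mpr ht0; linarith
  have h1 := le_gaussianReal_std_Ico (c := gaussianPDFReal 0 1 (t + 1 / t)) hle fun x hx =>
    gaussianPDFReal_std_anti (by rw [abs_of_nonneg (ht0.le.trans hx.1)]; exact hx.2.le)
  have h2 := gaussianReal_std_Ici_sub hle
  have h3 : (0 : ℝ) ≤ (gaussianReal 0 1).real (Ici (t + 1 / t)) := measureReal_nonneg
  refine le_trans ?_ (h1.trans (by linarith))
  rw [gaussianPDFReal_std, add_sub_cancel_left, mul_assoc, mul_assoc]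
  refine mul_le_mul_of_nonneg_left ?_ (by positivity)
  rw [← mul_div_assoc, ← Real.exp_add, mul_one_div]
  refine div_le_div_of_nonneg_right (Real.exp_le_exp.mpr ?_) ht0.le
  have h4 : (t + 1 / t) ^ 2 = t ^ 2 + 2 + (1 / t) ^ 2 := by field_simp; ring
  have h5 : 1 / t ≤ 1 := by rw [div_le_one ht0]; exact ht
  have h6 : 0 ≤ 1 / t := by positivity
  rw [h4]
  nlinarith

lemma eventually_mul_exp_neg_le (c d : ℝ) (hc : 0 < c) :
    ∀ᶠ x : ℝ in Filter.atTop, (x + d) * x * Real.exp (-(c * x)) ≤ 1 := by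
  have h1 : (fun x : ℝ => (x + d) * x) =O[Filter.atTop] fun x : ℝ => x ^ 2 := by
    refine Asymptotics.IsBigO.of_bound (1 + |d|) ?_
    filter_upwards [Filter.eventually_ge_atTop (1 : ℝ)] with x hx
    rw [Real.norm_eq_abs, Real.norm_eq_abs, abs_mul, abs_of_nonneg (sq_nonneg x),
      abs_of_nonneg (by linarith : (0 : ℝ) ≤ x)]
    have := abs_add_le x d
    rw [abs_of_nonneg (by linarith : (0 : ℝ) ≤ x)] at this
    have h2 : |x + d| * x ≤ (x + |d|) * x := mul_le_mul_of_nonneg_right this (by linarith)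
    have h3 : |d| * x ≤ |d| * x ^ 2 := mul_le_mul_of_nonneg_left (by nlinarith) (abs_nonneg d)
    linarith
  have h2 := h1.trans_isLittleO (isLittleO_pow_exp_pos_mul_atTop 2 hc)
  filter_upwards [h2.bound one_pos] with x hx
  rw [Real.norm_eq_abs, Real.norm_eq_abs, Real.abs_exp, one_mul] at hx
  rw [Real.exp_neg, ← div_eq_mul_inv, div_le_one (Real.exp_pos _)]
  exact (le_abs_self _).trans hx

lemma tendsto_log_natCast : Filter.Tendsto (fun n : ℕ => Real.log n) Filter.atTop Filter.atTop :=
  Real.tendsto_log_atTop.comp tendsto_natCast_atTop_atTop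

lemma eventually_mul_log_add_le (a b c : ℝ) (hc : 0 < c) :
    ∀ᶠ x : ℝ in Filter.atTop, a * Real.log x + b ≤ c * x := by
  have h1 := (Real.isLittleO_log_id_atTop.const_mul_left a).bound (half_pos hc)
  filter_upwards [h1, Filter.eventually_ge_atTop (2 * b / c), Filter.eventually_ge_atTop 0]
    with x hx hx2 hx0
  rw [Real.norm_eq_abs, Real.norm_eq_abs, id, abs_of_nonneg hx0] at hx
  rw [div_le_iff₀ hc] at hx2
  have := le_abs_self (a * Real.log x)
  linarith

/-- With l = log n and t² = 2l - 4 log l one has exp(-t²/2) = l²/n, so the expected number of draws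
above t is at least a constant times l²/t ≥ l. All draws lie below t with probability at most exp(-c
l), which also absorbs the mean shortfall of order l. The correction 4 log l is chosen for room, not
for sharpness. -/
lemma eventually_le_expectedMax_gaussian : ∀ᶠ n : ℕ in Filter.atTop,
    Real.sqrt (2 * Real.log n - 4 * Real.log (Real.log n)) - 1 / Real.sqrt (Real.log n) ≤
      expectedMax (gaussianReal 0 1) n := by
  set c₀ := (Real.sqrt (2 * Real.pi))⁻¹ * Real.exp (-(3 / 2)) with hc₀
  have hc₀pos : 0 < c₀ := by positivity
  set d := ∫ x, |x| ∂(gaussianReal 0 1) with hd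
  filter_upwards [tendsto_log_natCast.eventually (eventually_mul_exp_neg_le (c₀ / 2) d (by positivity)),
    tendsto_log_natCast.eventually (eventually_mul_log_add_le 4 1 1 one_pos),
    tendsto_log_natCast.eventually_ge_atTop 2, Filter.eventually_ge_atTop 2] with n h1 h2 h3 h4
  set l := Real.log n with hl
  have hn0 : (0 : ℝ) < n := by positivity
  have hl0 : 0 < l := by linarith
  have hll : 0 ≤ Real.log l := Real.log_nonneg (by linarith)
  set t := Real.sqrt (2 * l - 4 * Real.log l) with ht
  have ht2 : t ^ 2 = 2 * l - 4 * Real.log l := Real.sq_sqrt (by linarith)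
  have ht1 : 1 ≤ t := by
    rw [ht, Real.one_le_sqrt]; linarith
  have htl : t ≤ l := by
    rw [ht, Real.sqrt_le_left hl0.le]; nlinarith
  have hexp : Real.exp (-t ^ 2 / 2) = l ^ 2 / n := by
    rw [ht2, show -(2 * l - 4 * Real.log l) / 2 = Real.log l + Real.log l - l by ring, Real.exp_sub,
      Real.exp_add, Real.exp_log hl0, hl, Real.exp_log hn0, sq]
  have hp := le_gaussianReal_std_Ici ht1
  rw [hexp, ← hc₀] at hp
  set p := (gaussianReal 0 1).real (Ici t) with hpdef
  have hp2 : c₀ / 2 * l ≤ (n - 1 : ℕ) * p := by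
    have hn1 : (n : ℝ) / 2 ≤ (n - 1 : ℕ) := by
      rw [Nat.cast_sub (by omega)]
      have : (2 : ℝ) ≤ n := by exact_mod_cast h4
      push_cast; linarith
    calc c₀ / 2 * l ≤ n / 2 * (c₀ * (l ^ 2 / n / t)) := by
          rw [show (n : ℝ) / 2 * (c₀ * (l ^ 2 / n / t)) = c₀ / 2 * (l ^ 2 / t) by field_simp]
          refine mul_le_mul_of_nonneg_left ?_ (by positivity)
          rw [le_div_iff₀ (by linarith)]
          nlinarith
      _ ≤ (n - 1 : ℕ) * p := mul_le_mul hn1 hp (by positivity) (by positivity)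
  have hq : (gaussianReal 0 1).real (Iio t) ^ (n - 1) ≤ Real.exp (-(c₀ / 2 * l)) := by
    rw [← compl_Ici, probReal_compl_eq_one_sub measurableSet_Ici, ← hpdef]
    calc (1 - p) ^ (n - 1) ≤ Real.exp (-p) ^ (n - 1) :=
          pow_le_pow_left₀ (sub_nonneg.mpr measureReal_le_one) (Real.one_sub_le_exp_neg p) _
      _ = Real.exp (-((n - 1 : ℕ) * p)) := by rw [← Real.exp_nat_mul]; ring_nf
      _ ≤ _ := Real.exp_le_exp.mpr (by linarith)
  have hd' : ∫ x, max (t - x) 0 ∂(gaussianReal 0 1) ≤ l + d := by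
    have hi := integrable_id_gaussianReal_std
    calc ∫ x, max (t - x) 0 ∂(gaussianReal 0 1) ≤ ∫ x, (l + |x|) ∂(gaussianReal 0 1) :=
          integral_mono ((integrable_const t).sub hi).pos_part ((integrable_const l).add hi.abs)
            fun x => max_le (by have := neg_abs_le x; simp only; linarith)
              (by have := abs_nonneg x; linarith)
      _ = l + d := by rw [integral_add (integrable_const l) hi.abs]; simp [hd]
  have hd0 : 0 ≤ d := integral_nonneg fun x => abs_nonneg x
  have hmain := le_expectedMax integrable_id_gaussianReal_std (by omega : 1 ≤ n) t
  have herr : (gaussianReal 0 1).real (Iio t) ^ (n - 1) * ∫ x, max (t - x) 0 ∂(gaussianReal 0 1) ≤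
      1 / Real.sqrt l := by
    calc _ ≤ Real.exp (-(c₀ / 2 * l)) * (l + d) :=
          mul_le_mul hq hd' (integral_nonneg fun x => le_max_right _ _) (Real.exp_pos _).le
      _ ≤ 1 / l := by rw [le_div_iff₀ hl0]; linarith
      _ ≤ 1 / Real.sqrt l := by
          refine one_div_le_one_div_of_le (Real.sqrt_pos.mpr hl0) ?_
          rw [Real.sqrt_le_left hl0.le]; nlinarith
  linarith

lemma sqrt_sub_sqrt_sub_le {a x : ℝ} (ha : 0 < a) (hx : 0 ≤ x) :
    Real.sqrt a - Real.sqrt (a - x) ≤ x / Real.sqrt a := by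
  have h := Real.sqrt_pos.mpr ha
  rw [le_div_iff₀ h]
  have h1 := Real.mul_self_sqrt ha.le
  by_cases hax : x ≤ a
  · have h2 : a - x ≤ Real.sqrt (a - x) * Real.sqrt a := by
      calc a - x = Real.sqrt (a - x) * Real.sqrt (a - x) :=
            (Real.mul_self_sqrt (by linarith)).symm
        _ ≤ _ := mul_le_mul_of_nonneg_left (Real.sqrt_le_sqrt (by linarith)) (Real.sqrt_nonneg _)
    nlinarith
  · have := mul_nonneg (Real.sqrt_nonneg (a - x)) h.le
    nlinarith

/-- The logarithms of n and N differ by at most |log(1 - ρ)|. The upper bound at N and the lower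
bound at n then differ by O(log log N) under the square root; the iterated logarithm comes from the
lower bound, not from the loss of budget. -/
lemma exists_expectedMax_gaussian_sub_le {ρ : ℝ} (hρ : ρ < 1) : ∃ C : ℝ, 0 < C ∧
    ∀ᶠ N : ℕ in Filter.atTop, ∀ n : ℕ, n ≤ N → (1 - ρ) * N ≤ n →
      expectedMax (gaussianReal 0 1) N - expectedMax (gaussianReal 0 1) n ≤
        C * Real.log (Real.log N) / Real.sqrt (Real.log N) := by
  set r := |Real.log (1 - ρ)| with hr
  have hr0 : 0 ≤ r := abs_nonneg _
  have h1ρ : 0 < 1 - ρ := by linarith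
  refine ⟨2 * r + 4 + 2, by positivity, ?_⟩
  obtain ⟨n₀, hn₀⟩ := Filter.eventually_atTop.mp eventually_le_expectedMax_gaussian
  have hN : ∀ᶠ N : ℕ in Filter.atTop, (n₀ + 2) / (1 - ρ) ≤ (N : ℝ) :=
    tendsto_natCast_atTop_atTop.eventually_ge_atTop _
  filter_upwards [hN, tendsto_log_natCast.eventually_ge_atTop (2 * r + 2),
    tendsto_log_natCast.eventually_ge_atTop (Real.exp 1), Filter.eventually_ge_atTop 2]
    with N hN1 hN2 hN3 hN4 n hnN hn
  rw [div_le_iff₀ h1ρ] at hN1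
  have hnn : (n₀ : ℝ) + 2 ≤ n := by linarith
  have hnn0 : n₀ ≤ n := by
    have : (n₀ : ℝ) ≤ n := by linarith
    exact_mod_cast this
  have hn0 : (0 : ℝ) < n := by have : (0 : ℝ) ≤ n₀ := by positivity
                               linarith
  have hNpos : (0 : ℝ) < N := by positivity
  have hup := expectedMax_gaussian_le hN4
  have hlow := hn₀ n hnn0
  set L := Real.log N with hL
  set l := Real.log n with hl
  have hlL : l ≤ L := Real.log_le_log hn0 (by exact_mod_cast hnN)
  have hLl : L - r ≤ l := by
    have h1 := Real.log_le_log (by positivity) hn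
    rw [Real.log_mul h1ρ.ne' hNpos.ne'] at h1
    have := neg_abs_le (Real.log (1 - ρ))
    linarith
  have hL0 : 0 < L := by linarith
  have hLhalf : L / 2 ≤ l := by linarith
  have hl0 : 0 < l := by linarith
  have hlogL : 1 ≤ Real.log L := by
    rw [Real.le_log_iff_exp_le hL0]; exact hN3
  have hloglL : Real.log l ≤ Real.log L := Real.log_le_log hl0 hlL
  have hsL := Real.sqrt_pos.mpr hL0
  have h1 : Real.sqrt (2 * L - (2 * r + 4 * Real.log L)) ≤
      Real.sqrt (2 * l - 4 * Real.log l) := Real.sqrt_le_sqrt (by linarith)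
  have h2 := sqrt_sub_sqrt_sub_le (a := 2 * L) (x := 2 * r + 4 * Real.log L) (by linarith)
    (by linarith)
  have h3 : (2 * r + 4 * Real.log L) / Real.sqrt (2 * L) ≤
      (2 * r + 4 * Real.log L) / Real.sqrt L :=
    div_le_div_of_nonneg_left (by linarith) hsL (Real.sqrt_le_sqrt (by linarith))
  have h4 : 1 / Real.sqrt l ≤ 2 / Real.sqrt L := by
    rw [div_le_div_iff₀ (Real.sqrt_pos.mpr hl0) hsL, one_mul]
    rw [Real.sqrt_le_left (by positivity), mul_pow, Real.sq_sqrt hl0.le]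
    linarith
  calc _ ≤ (2 * r + 4 * Real.log L) / Real.sqrt L + 2 / Real.sqrt L := by linarith
    _ = (2 * r + 4 * Real.log L + 2) / Real.sqrt L := by rw [← add_div]
    _ ≤ _ := by
      refine div_le_div_of_nonneg_right ?_ hsL.le
      nlinarith

/-! ### A Bernstein inequality for empirical means -/

lemma exp_le_one_add_add_sq (y : ℝ) : Real.exp y ≤ 1 + y + y ^ 2 * Real.exp |y| := by
  have h1 : Real.exp y - 1 ≤ y * Real.exp y := by
    have h := Real.add_one_le_exp (-y)
    have h2 := mul_le_mul_of_nonneg_left h (Real.exp_pos y).le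
    rw [← Real.exp_add, add_neg_cancel, Real.exp_zero] at h2
    linarith
  rcases le_total 0 y with hy | hy
  · rw [abs_of_nonneg hy]
    nlinarith [mul_le_mul_of_nonneg_left h1 hy]
  · have h2 := Real.add_one_le_exp y
    have h3 : (1 : ℝ) ≤ Real.exp |y| := Real.one_le_exp (abs_nonneg y)
    nlinarith [mul_le_mul_of_nonneg_left h3 (sq_nonneg y)]

lemma exp_mul_le_one_add_add_sq {s t : ℝ} (hs : 0 ≤ s) (hst : s ≤ t) (x : ℝ) :
    Real.exp (s * x) ≤ 1 + s * x + s ^ 2 * (x ^ 2 * Real.exp (t * |x|)) := by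
  have h := exp_le_one_add_add_sq (s * x)
  have h1 : Real.exp |s * x| ≤ Real.exp (t * |x|) := by
    rw [abs_mul, abs_of_nonneg hs]
    exact Real.exp_le_exp.mpr (mul_le_mul_of_nonneg_right hst (abs_nonneg x))
  have h2 := mul_le_mul_of_nonneg_left h1 (sq_nonneg (s * x))
  rw [mul_pow, mul_assoc (s ^ 2) (x ^ 2)] at h2
  rw [mul_pow, mul_assoc (s ^ 2)] at h
  linarith

/-- Chernoff's method: the second-order expansion of exp, with remainder controlled by the weight
exp(t|X|), bounds the moment generating function by exp(C s²) for 0 ≤ s ≤ t. -/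
lemma measure_sum_ge_le {A : Type*} [MeasurableSpace A] (P : Measure A) [IsProbabilityMeasure P]
    {X : A → ℝ} (hX : Measurable X) (hXi : Integrable X P) (hX0 : ∫ x, X x ∂P = 0) {t C : ℝ}
    (hi : Integrable (fun x => X x ^ 2 * Real.exp (t * |X x|)) P)
    (hC : ∫ x, X x ^ 2 * Real.exp (t * |X x|) ∂P ≤ C) (hC0 : 0 < C) {ε : ℝ} (hε : 0 ≤ ε)
    (hεt : ε ≤ 2 * C * t) (m : ℕ) :
    (Measure.pi fun _ : Fin m => P).real {x | m * ε ≤ ∑ j, X (x j)} ≤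
      Real.exp (-(1 / (4 * C) * m * ε ^ 2)) := by
  -- The minimizer of C s² - s ε; the hypothesis `hεt` says exactly that it is at most t.
  set s := ε / (2 * C) with hs
  have hs0 : 0 ≤ s := by positivity
  have hst : s ≤ t := by rw [hs, div_le_iff₀ (by positivity)]; linarith
  have hbd : Integrable (fun x => 1 + s * X x + s ^ 2 * (X x ^ 2 * Real.exp (t * |X x|))) P :=
    ((integrable_const _).add (hXi.const_mul s)).add (hi.const_mul _)
  have hexp : Integrable (fun x => Real.exp (s * X x)) P :=
    hbd.mono' (by fun_prop) (ae_of_all _ fun x => by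
      rw [Real.norm_eq_abs, Real.abs_exp]
      exact exp_mul_le_one_add_add_sq hs0 hst (X x))
  have hmgf : mgf X P s ≤ Real.exp (C * s ^ 2) := by
    calc mgf X P s ≤ ∫ x, (1 + s * X x + s ^ 2 * (X x ^ 2 * Real.exp (t * |X x|))) ∂P :=
          integral_mono hexp hbd fun x => exp_mul_le_one_add_add_sq hs0 hst (X x)
      _ = 1 + s ^ 2 * ∫ x, X x ^ 2 * Real.exp (t * |X x|) ∂P := by
          rw [integral_add (f := fun x => 1 + s * X x)
              ((integrable_const _).add (hXi.const_mul s)) (hi.const_mul _),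
            integral_add (integrable_const _) (hXi.const_mul s), integral_const_mul,
            integral_const_mul, hX0]
          simp
      _ ≤ 1 + C * s ^ 2 := by nlinarith [mul_le_mul_of_nonneg_left hC (sq_nonneg s)]
      _ ≤ _ := by linarith [Real.add_one_le_exp (C * s ^ 2)]
  set Q := Measure.pi fun _ : Fin m => P
  have hind : iIndepFun (fun (j : Fin m) (x : Fin m → A) => X (x j)) Q :=
    iIndepFun_pi fun _ => hX.aemeasurable
  have hmeas : ∀ j : Fin m, Measurable fun x : Fin m → A => X (x j) := fun j =>
    hX.comp (measurable_pi_apply j)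
  have hone : ∀ j : Fin m, mgf (fun x : Fin m → A => X (x j)) Q s = mgf X P s := fun j =>
    integral_eval_pi (f := fun x => Real.exp (s * X x)) hexp.aestronglyMeasurable j
  have hsum : mgf (∑ j, fun x : Fin m → A => X (x j)) Q s = mgf X P s ^ m := by
    rw [hind.mgf_sum hmeas]
    simp [hone]
  have hint : Integrable (fun x : Fin m → A =>
      Real.exp (s * (∑ j, fun x : Fin m → A => X (x j)) x)) Q := by
    have h := Integrable.fintype_prod (μ := fun _ : Fin m => P)
      (f := fun _ => fun x => Real.exp (s * X x)) fun _ => hexp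
    refine h.congr (ae_of_all _ fun x => ?_)
    simp only [Finset.sum_apply]
    rw [Finset.mul_sum, Real.exp_sum]
  have hcher := measure_ge_le_exp_mul_mgf (μ := Q) (m * ε) hs0 hint
  simp only [Finset.sum_apply] at hcher
  refine hcher.trans ?_
  rw [hsum]
  calc Real.exp (-s * (m * ε)) * mgf X P s ^ m
      ≤ Real.exp (-s * (m * ε)) * Real.exp (C * s ^ 2) ^ m := by
        refine mul_le_mul_of_nonneg_left (pow_le_pow_left₀ mgf_nonneg hmgf m) (Real.exp_pos _).le
    _ = Real.exp (-(1 / (4 * C) * m * ε ^ 2)) := by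
        rw [← Real.exp_nat_mul, ← Real.exp_add, hs]
        congr 1
        field_simp
        ring

/-- Two-sided Bernstein inequality for the empirical mean of a law on the line. -/
lemma measure_empiricalMean_sub_ge_le (ν : Measure ℝ) [IsProbabilityMeasure ν]
    (hRi : Integrable (fun x => x) ν) {t C a : ℝ} (ha : ∫ x, x ∂ν = a)
    (hi : Integrable (fun x => (x - a) ^ 2 * Real.exp (t * |x - a|)) ν)
    (hC : ∫ x, (x - a) ^ 2 * Real.exp (t * |x - a|) ∂ν ≤ C) (hC0 : 0 < C) {ε : ℝ} (hε : 0 ≤ ε)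
    (hεt : ε ≤ 2 * C * t) {m : ℕ} (hm : 1 ≤ m) :
    (Measure.pi fun _ : Fin m => ν).real {x | ε ≤ |(∑ j, x j) / m - a|} ≤
      2 * Real.exp (-(1 / (4 * C) * m * ε ^ 2)) := by
  have hm0 : (0 : ℝ) < m := by exact_mod_cast hm
  have hXi : Integrable (fun x => x - a) ν := hRi.sub (integrable_const a)
  have h0 : ∫ x, (x - a) ∂ν = 0 := by
    rw [integral_sub hRi (integrable_const a), ha]; simp
  have h1 := measure_sum_ge_le ν (X := fun x => x - a) (by fun_prop) hXi h0 hi hC hC0 hε hεt m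
  have h2 := measure_sum_ge_le ν (X := fun x => -(x - a)) (by fun_prop) hXi.neg
    (by rw [integral_neg, h0, neg_zero]) (C := C) (t := t)
    (by simpa only [abs_neg, neg_sq] using hi) (by simpa only [abs_neg, neg_sq] using hC)
    hC0 hε hεt m
  have hsub : {x : Fin m → ℝ | ε ≤ |(∑ j, x j) / m - a|} ⊆
      {x | m * ε ≤ ∑ j, (x j - a)} ∪ {x | m * ε ≤ ∑ j, -(x j - a)} := by
    intro x hx
    have hx' : ε ≤ |(∑ j, x j) / m - a| := hx
    have hs : ∑ j, (x j - a) = m * ((∑ j, x j) / m - a) := by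
      rw [Finset.sum_sub_distrib]
      simp
      field_simp
    rcases le_abs.mp hx' with h | h
    · left
      change m * ε ≤ ∑ j, (x j - a)
      rw [hs]
      exact mul_le_mul_of_nonneg_left h hm0.le
    · right
      change m * ε ≤ ∑ j, -(x j - a)
      rw [Finset.sum_neg_distrib, hs, ← mul_neg]
      exact mul_le_mul_of_nonneg_left h hm0.le
  calc _ ≤ _ := measureReal_mono hsub
    _ ≤ _ := measureReal_union_le _ _
    _ ≤ _ := by linarith

lemma measure_empiricalMean_comp_eq {A : Type*} [MeasurableSpace A] (P : Measure A)
    [IsProbabilityMeasure P] {Y : A → ℝ} (hY : Measurable Y) (m : ℕ) (ε a : ℝ) :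
    (Measure.pi fun _ : Fin m => P).real {x | ε ≤ |(∑ j, Y (x j)) / m - a|} =
      (Measure.pi fun _ : Fin m => P.map Y).real {x | ε ≤ |(∑ j, x j) / m - a|} := by
  rw [← map_pi_comp P hY, map_measureReal_apply]
  · rfl
  · exact measurable_pi_lambda _ fun i => hY.comp (measurable_pi_apply i)
  · exact measurableSet_le measurable_const (by fun_prop)

/-- A centred indicator is bounded by 1, so the Bernstein bound applies with t = 1 and C = exp 1. -/
lemma measure_empiricalMean_indicator_le {A : Type*} [MeasurableSpace A] (P : Measure A)
    [IsProbabilityMeasure P] {s : Set A} (hs : MeasurableSet s) {ε : ℝ} (hε : 0 ≤ ε) (hε1 : ε ≤ 1)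
    {m : ℕ} (hm : 1 ≤ m) :
    (Measure.pi fun _ : Fin m => P).real
        {x | ε ≤ |(∑ j, s.indicator (fun _ => (1 : ℝ)) (x j)) / m - P.real s|} ≤
      2 * Real.exp (-(1 / (4 * Real.exp 1) * m * ε ^ 2)) := by
  have hY : Measurable (s.indicator fun _ => (1 : ℝ)) := measurable_const.indicator hs
  have := Measure.isProbabilityMeasure_map (μ := P) hY.aemeasurable
  set a := P.real s
  set ν := P.map (s.indicator fun _ => (1 : ℝ)) with hR
  have ha0 : 0 ≤ a := measureReal_nonneg
  have ha1 : a ≤ 1 := measureReal_le_one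
  have hmem : ∀ᵐ x ∂ν, |x| ≤ 1 ∧ |x - a| ≤ 1 := by
    have hset : MeasurableSet {x : ℝ | |x| ≤ 1 ∧ |x - a| ≤ 1} :=
      (measurableSet_le (f := fun x : ℝ => |x|) (g := fun _ => 1) (by fun_prop) (by fun_prop)).inter
        (measurableSet_le (f := fun x : ℝ => |x - a|) (g := fun _ => 1) (by fun_prop) (by fun_prop))
    rw [hR, ae_map_iff hY.aemeasurable hset]
    refine ae_of_all _ fun x => ?_
    by_cases hx : x ∈ s
    · rw [indicator_of_mem hx]
      simp only [abs_one, le_refl, true_and]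
      rw [abs_le]; constructor <;> linarith
    · rw [indicator_of_notMem hx]
      simp only [abs_zero, zero_le_one, true_and, zero_sub, abs_neg]
      rw [abs_le]; constructor <;> linarith
  have hle : ∀ᵐ x ∂ν, (x - a) ^ 2 * Real.exp (1 * |x - a|) ≤ Real.exp 1 := by
    filter_upwards [hmem] with x hx
    have h1 : (x - a) ^ 2 ≤ 1 := by rw [sq_le_one_iff_abs_le_one]; exact hx.2
    have h2 : Real.exp (1 * |x - a|) ≤ Real.exp 1 := Real.exp_le_exp.mpr (by linarith [hx.2])
    calc _ ≤ 1 * Real.exp 1 := mul_le_mul h1 h2 (Real.exp_pos _).le zero_le_one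
      _ = _ := one_mul _
  have hi : Integrable (fun x => (x - a) ^ 2 * Real.exp (1 * |x - a|)) ν :=
    Integrable.of_bound (by fun_prop) (Real.exp 1) (by
      filter_upwards [hle] with x hx
      rwa [Real.norm_of_nonneg (by positivity)])
  have hRi : Integrable (fun x => x) ν := Integrable.of_bound (by fun_prop) 1 (by
      filter_upwards [hmem] with x hx using hx.1)
  have hmean : ∫ x, x ∂ν = a := by
    rw [hR, integral_map hY.aemeasurable (by fun_prop), integral_indicator_const _ hs]
    simp [a]
  rw [measure_empiricalMean_comp_eq P hY]
  refine measure_empiricalMean_sub_ge_le ν hRi hmean hi ?_ (Real.exp_pos 1) hε ?_ hm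
  · calc _ ≤ ∫ _, Real.exp 1 ∂ν := integral_mono_ae hi (integrable_const _) hle
      _ = _ := by simp
  · have := Real.add_one_le_exp 1
    linarith

/-- An exponential moment of order τ is spent in two halves: one dominates the square (x - a)², the
other is the weight in the Bernstein bound. -/
lemma exists_measure_empiricalMean_le (ν : Measure ℝ) [IsProbabilityMeasure ν] {τ : ℝ} (hτ : 0 < τ)
    (hR : Integrable (fun x => Real.exp (τ * |x|)) ν) :
    ∃ c t : ℝ, 0 < c ∧ 0 < t ∧ ∀ m : ℕ, 1 ≤ m → ∀ ε : ℝ, 0 ≤ ε → ε ≤ t →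
      (Measure.pi fun _ : Fin m => ν).real {x | ε ≤ |(∑ j, x j) / m - ∫ y, y ∂ν|} ≤
        2 * Real.exp (-(c * m * ε ^ 2)) := by
  set a := ∫ y, y ∂ν
  have hRi : Integrable (fun x => x) ν := by
    refine (hR.const_mul τ⁻¹).mono' (by fun_prop) (ae_of_all _ fun x => ?_)
    have := Real.add_one_le_exp (τ * |x|)
    rw [Real.norm_eq_abs, inv_mul_eq_div, le_div_iff₀ hτ]
    linarith
  have hle : ∀ x : ℝ, (x - a) ^ 2 * Real.exp (τ / 2 * |x - a|) ≤
      (8 / τ ^ 2 * Real.exp (τ * |a|)) * Real.exp (τ * |x|) := fun x => by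
    have h1 := Real.quadratic_le_exp_of_nonneg (x := τ / 2 * |x - a|) (by positivity)
    have h1' : (x - a) ^ 2 ≤ 8 / τ ^ 2 * Real.exp (τ / 2 * |x - a|) := by
      have h2 : (τ / 2 * |x - a|) ^ 2 / 2 ≤ Real.exp (τ / 2 * |x - a|) := by
        have : 0 ≤ τ / 2 * |x - a| := by positivity
        linarith
      rw [mul_pow, sq_abs] at h2
      rw [div_mul_eq_mul_div, le_div_iff₀ (by positivity)]
      linarith
    calc _ ≤ 8 / τ ^ 2 * Real.exp (τ / 2 * |x - a|) * Real.exp (τ / 2 * |x - a|) :=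
          mul_le_mul_of_nonneg_right h1' (Real.exp_pos _).le
      _ = 8 / τ ^ 2 * Real.exp (τ * |x - a|) := by
          rw [mul_assoc, ← Real.exp_add]; ring_nf
      _ ≤ 8 / τ ^ 2 * Real.exp (τ * |a| + τ * |x|) := by
          refine mul_le_mul_of_nonneg_left (Real.exp_le_exp.mpr ?_) (by positivity)
          have := mul_le_mul_of_nonneg_left (abs_sub x a) hτ.le
          linarith
      _ = _ := by rw [Real.exp_add, mul_assoc]
  have hi : Integrable (fun x => (x - a) ^ 2 * Real.exp (τ / 2 * |x - a|)) ν :=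
    (hR.const_mul _).mono' (by fun_prop) (ae_of_all _ fun x => by
      rw [Real.norm_of_nonneg (by positivity)]
      exact hle x)
  set C := (∫ x, (x - a) ^ 2 * Real.exp (τ / 2 * |x - a|) ∂ν) + 1 with hC
  have hC0 : 0 < C := by
    have : 0 ≤ ∫ x, (x - a) ^ 2 * Real.exp (τ / 2 * |x - a|) ∂ν :=
      integral_nonneg fun x => by positivity
    linarith
  refine ⟨1 / (4 * C), 2 * C * (τ / 2), by positivity, by positivity, fun m hm ε hε hεt => ?_⟩
  exact measure_empiricalMean_sub_ge_le ν hRi rfl hi (by rw [hC]; linarith) hC0 hε hεt hm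

/-! ### Moments of the truncated standard normal distribution -/

lemma hasDerivAt_gaussianPDFReal_std (x : ℝ) :
    HasDerivAt (gaussianPDFReal 0 1) (-x * gaussianPDFReal 0 1 x) x := by
  have h1 : HasDerivAt (fun x : ℝ => -x ^ 2 / 2) (-x) x := by
    have := ((hasDerivAt_pow 2 x).neg).div_const 2
    exact this.congr_deriv (by push_cast; ring)
  have h2 := (h1.exp).const_mul (Real.sqrt (2 * Real.pi))⁻¹
  have h3 : gaussianPDFReal 0 1 = fun x => (Real.sqrt (2 * Real.pi))⁻¹ * Real.exp (-x ^ 2 / 2) :=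
    funext gaussianPDFReal_std
  rw [gaussianPDFReal_std, h3]
  exact h2.congr_deriv (by ring)

lemma integrable_pow_gaussianReal_std (k : ℕ) : Integrable (fun x => x ^ k) (gaussianReal 0 1) := by
  have h := (memLp_id_gaussianReal (μ := 0) (v := 1) (k : NNReal)).integrable_norm_pow'
  refine h.mono' (by fun_prop) (ae_of_all _ fun x => ?_)
  simp

lemma integrable_pow_mul_gaussianPDFReal_std (k : ℕ) :
    Integrable (fun x : ℝ => x ^ k * gaussianPDFReal 0 1 x) := by
  have h := integrable_pow_gaussianReal_std k
  rw [gaussianReal_of_var_ne_zero 0 one_ne_zero, integrable_withDensity_iff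
    (measurable_gaussianPDF 0 1) (ae_of_all _ fun x => gaussianPDF_lt_top)] at h
  simpa [toReal_gaussianPDF] using h

lemma setIntegral_gaussianReal_std (s : Set ℝ) (hs : MeasurableSet s) (f : ℝ → ℝ) :
    ∫ x in s, f x ∂(gaussianReal 0 1) = ∫ x in s, f x * gaussianPDFReal 0 1 x := by
  rw [← integral_indicator hs, integral_gaussianReal_eq_integral_smul one_ne_zero,
    ← integral_indicator hs]
  congr 1 with x
  by_cases hx : x ∈ s
  · simp [hx, mul_comm]
  · simp [hx]

lemma tendsto_pow_mul_gaussianPDFReal_std (k : ℕ) :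
    Filter.Tendsto (fun x : ℝ => x ^ k * gaussianPDFReal 0 1 x) Filter.atTop (nhds 0) := by
  have h1 : ∀ᶠ x : ℝ in Filter.atTop, ‖x ^ k * gaussianPDFReal 0 1 x‖ ≤ x ^ k * Real.exp (-x) := by
    filter_upwards [Filter.eventually_ge_atTop (2 : ℝ)] with x hx
    rw [Real.norm_of_nonneg (mul_nonneg (by positivity) (gaussianPDFReal_nonneg _ _ _))]
    refine mul_le_mul_of_nonneg_left ?_ (by positivity)
    rw [gaussianPDFReal_std]
    have h2 : (Real.sqrt (2 * Real.pi))⁻¹ ≤ 1 := by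
      refine inv_le_one_of_one_le₀ ?_
      rw [Real.one_le_sqrt]; linarith [Real.pi_gt_three]
    calc _ ≤ 1 * Real.exp (-x ^ 2 / 2) := mul_le_mul_of_nonneg_right h2 (Real.exp_pos _).le
      _ = Real.exp (-x ^ 2 / 2) := one_mul _
      _ ≤ _ := Real.exp_le_exp.mpr (by nlinarith)
  exact squeeze_zero_norm' h1 (Real.tendsto_pow_mul_exp_neg_atTop_nhds_zero k)

lemma setIntegral_Ici_id_gaussianReal (z : ℝ) :
    ∫ x in Ici z, x ∂(gaussianReal 0 1) = gaussianPDFReal 0 1 z := by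
  rw [setIntegral_gaussianReal_std _ measurableSet_Ici, integral_Ici_eq_integral_Ioi]
  have hi := integrable_pow_mul_gaussianPDFReal_std 1
  simp only [pow_one] at hi
  have h := integral_Ioi_of_hasDerivAt_of_tendsto (a := z)
    (f := fun x => -gaussianPDFReal 0 1 x) (f' := fun x => x * gaussianPDFReal 0 1 x) (m := 0)
    (hasDerivAt_gaussianPDFReal_std z).continuousAt.neg.continuousWithinAt
    (fun x _ => by
      have := (hasDerivAt_gaussianPDFReal_std x).neg
      exact this.congr_deriv (by ring))
    hi.integrableOn (by
      have := (tendsto_pow_mul_gaussianPDFReal_std 0).neg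
      simpa using this)
  rw [h]; ring

/-- The function -x φ(x) is a primitive of x² φ(x) - φ(x). -/
lemma setIntegral_Ici_sq_gaussianReal (z : ℝ) :
    ∫ x in Ici z, x ^ 2 ∂(gaussianReal 0 1) =
      (gaussianReal 0 1).real (Ici z) + z * gaussianPDFReal 0 1 z := by
  rw [setIntegral_gaussianReal_std _ measurableSet_Ici, gaussianReal_std_real,
    integral_Ici_eq_integral_Ioi, integral_Ici_eq_integral_Ioi]
  have hi := integrable_pow_mul_gaussianPDFReal_std 2
  have hi0 := integrable_gaussianPDFReal 0 1
  have h := integral_Ioi_of_hasDerivAt_of_tendsto (a := z)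
    (f := fun x => -(x * gaussianPDFReal 0 1 x))
    (f' := fun x => x ^ 2 * gaussianPDFReal 0 1 x - gaussianPDFReal 0 1 x) (m := 0)
    (((continuousAt_id).mul (hasDerivAt_gaussianPDFReal_std z).continuousAt).neg).continuousWithinAt
    (fun x _ => by
      have := ((hasDerivAt_id x).mul (hasDerivAt_gaussianPDFReal_std x)).neg
      exact this.congr_deriv (by simp only [id]; ring))
    (hi.sub hi0).integrableOn (by
      have := (tendsto_pow_mul_gaussianPDFReal_std 1).neg
      simpa using this)
  rw [integral_sub hi.integrableOn hi0.integrableOn] at h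
  linarith

lemma integral_posPart_pow_gaussianReal (z : ℝ) {k : ℕ} (hk : k ≠ 0) :
    ∫ x, max (x - z) 0 ^ k ∂(gaussianReal 0 1) = ∫ x in Ici z, (x - z) ^ k ∂(gaussianReal 0 1) := by
  rw [← integral_indicator measurableSet_Ici]
  congr 1 with x
  by_cases hx : z ≤ x
  · rw [indicator_of_mem (show x ∈ Ici z from hx), max_eq_left (by linarith)]
  · rw [indicator_of_notMem (show x ∉ Ici z from hx), max_eq_right (by linarith), zero_pow hk]

lemma invMills_eq (z : ℝ) :
    invMills z = gaussianPDFReal 0 1 z / (gaussianReal 0 1).real (Ici z) := by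
  rw [invMills, cdf_gaussianReal_std, sub_sub_cancel]

lemma gaussianReal_std_Ici_pos (z : ℝ) : 0 < (gaussianReal 0 1).real (Ici z) :=
  measureReal_nonneg.trans_lt (gaussianReal_std_Ici_strictAnti (lt_add_one z))

lemma integrable_id_restrict (z : ℝ) :
    Integrable (fun x => x) ((gaussianReal 0 1).restrict (Ici z)) :=
  integrable_id_gaussianReal_std.integrableOn

lemma integrable_sq_restrict (z : ℝ) :
    Integrable (fun x => x ^ 2) ((gaussianReal 0 1).restrict (Ici z)) :=
  (integrable_pow_gaussianReal_std 2).integrableOn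

lemma setIntegral_Ici_sub_sq_gaussianReal (z b : ℝ) :
    ∫ x in Ici z, (x - b) ^ 2 ∂(gaussianReal 0 1) =
      (gaussianReal 0 1).real (Ici z) * (1 + z * invMills z - 2 * b * invMills z + b ^ 2) := by
  have h : ∀ x : ℝ, (x - b) ^ 2 = x ^ 2 - 2 * b * x + b ^ 2 := fun x => by ring
  simp_rw [h]
  rw [integral_add (f := fun x => x ^ 2 - 2 * b * x)
    ((integrable_sq_restrict z).sub ((integrable_id_restrict z).const_mul _)) (integrable_const _),
    integral_sub (integrable_sq_restrict z) ((integrable_id_restrict z).const_mul _),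
    integral_const_mul, setIntegral_Ici_sq_gaussianReal, setIntegral_Ici_id_gaussianReal]
  have hpos := (gaussianReal_std_Ici_pos z).ne'
  simp only [integral_const, measureReal_restrict_apply_univ, smul_eq_mul]
  rw [invMills_eq]
  field_simp

lemma integral_posPart_gaussianReal (z : ℝ) :
    ∫ x, max (x - z) 0 ∂(gaussianReal 0 1) =
      (gaussianReal 0 1).real (Ici z) * (invMills z - z) := by
  have h := integral_posPart_pow_gaussianReal z one_ne_zero
  simp only [pow_one] at h
  rw [h, integral_sub (integrable_id_restrict z) (integrable_const _),
    setIntegral_Ici_id_gaussianReal]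
  have hpos := (gaussianReal_std_Ici_pos z).ne'
  simp only [integral_const, measureReal_restrict_apply_univ, smul_eq_mul]
  rw [invMills_eq]
  field_simp

lemma integral_posPart_sq_gaussianReal (z : ℝ) :
    ∫ x, max (x - z) 0 ^ 2 ∂(gaussianReal 0 1) =
      (gaussianReal 0 1).real (Ici z) * (1 - z * invMills z + z ^ 2) := by
  rw [integral_posPart_pow_gaussianReal z two_ne_zero, setIntegral_Ici_sub_sq_gaussianReal]
  ring

/-- Multiplied by the tail mass, it is the integral over the tail of (x - λ)² with λ the inverse
Mills ratio; the integrand vanishes at one point only, which is a null set. Positivity is needed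
because the estimator divides by this number. -/
lemma truncVar_pos (z : ℝ) : 0 < truncVar z := by
  have hpos := gaussianReal_std_Ici_pos z
  have h := setIntegral_Ici_sub_sq_gaussianReal z (invMills z)
  have h1 : (gaussianReal 0 1).real (Ici z) * truncVar z =
      ∫ x in Ici z, (x - invMills z) ^ 2 ∂(gaussianReal 0 1) := by
    rw [h, truncVar]; ring
  have h2 : 0 < ∫ x in Ici z, (x - invMills z) ^ 2 ∂(gaussianReal 0 1) := by
    rw [integral_pos_iff_support_of_nonneg (fun x => sq_nonneg _)]
    · have hs : Function.support (fun x : ℝ => (x - invMills z) ^ 2) = {invMills z}ᶜ := by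
        ext x
        simp [sub_eq_zero]
      rw [hs, measure_compl (measurableSet_singleton _) (measure_ne_top _ _),
        Measure.restrict_apply_univ, Measure.restrict_apply (measurableSet_singleton _),
        measure_mono_null inter_subset_left (measure_singleton _), tsub_zero]
      exact (ENNReal.toReal_pos_iff.mp hpos).1
    · have h : ∀ x : ℝ, (x - invMills z) ^ 2 = x ^ 2 - 2 * invMills z * x + invMills z ^ 2 :=
        fun x => by ring
      simp_rw [h]
      exact ((integrable_sq_restrict z).sub ((integrable_id_restrict z).const_mul _)).add
        (integrable_const _)
  rw [← h1] at h2
  exact (mul_pos_iff_of_pos_left hpos).mp h2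

lemma invMills_nonneg (z : ℝ) : 0 ≤ invMills z := by
  rw [invMills_eq]
  exact div_nonneg (gaussianPDFReal_nonneg _ _ _) measureReal_nonneg

/-! ### Exponential integrability of the truncated moments -/

/-- By Fernique's theorem exp(C x²) is integrable for some C > 0, and (x - z)⁺ squared is at most
2x² + 2z². The squared excess thus has only some exponential moment, which is why a Bernstein bound
is used. -/
lemma exists_integrable_exp_posPart_sq (z : ℝ) : ∃ τ : ℝ, 0 < τ ∧
    Integrable (fun x => Real.exp (τ * |max (x - z) 0 ^ 2|)) (gaussianReal 0 1) ∧
    Integrable (fun x => Real.exp (τ * |max (x - z) 0|)) (gaussianReal 0 1) := by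
  obtain ⟨C, hC, hi⟩ := IsGaussian.exists_integrable_exp_sq (gaussianReal 0 1)
  have h1 : ∀ x : ℝ, max (x - z) 0 ^ 2 ≤ 2 * x ^ 2 + 2 * z ^ 2 := fun x => by
    rcases le_total (x - z) 0 with h | h
    · rw [max_eq_right h]; nlinarith [sq_nonneg x, sq_nonneg z]
    · rw [max_eq_left h]; nlinarith [sq_nonneg (x + z)]
  have h2 : ∀ x : ℝ, C / 2 * |max (x - z) 0 ^ 2| ≤ C * z ^ 2 + C * ‖x‖ ^ 2 := fun x => by
    rw [abs_of_nonneg (sq_nonneg _), Real.norm_eq_abs, sq_abs]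
    nlinarith [h1 x]
  refine ⟨C / 2, half_pos hC, ?_, ?_⟩
  · refine (hi.const_mul (Real.exp (C * z ^ 2))).mono' (by fun_prop) (ae_of_all _ fun x => ?_)
    rw [Real.norm_eq_abs, Real.abs_exp, ← Real.exp_add]
    exact Real.exp_le_exp.mpr (h2 x)
  · refine (hi.const_mul (Real.exp (C / 2 + C * z ^ 2))).mono' (by fun_prop) (ae_of_all _ fun x => ?_)
    rw [Real.norm_eq_abs, Real.abs_exp, ← Real.exp_add]
    refine Real.exp_le_exp.mpr ?_
    have h3 := h2 x
    have h4 : |max (x - z) 0| ≤ 1 + |max (x - z) 0 ^ 2| := by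
      rw [abs_pow]
      nlinarith [sq_nonneg (|max (x - z) 0| - 1), abs_nonneg (max (x - z) 0)]
    nlinarith

/-! ### The tail set of a sample -/

lemma empiricalCDF_mono {m : ℕ} (r : Fin m → ℝ) : Monotone (empiricalCDF r) := fun s t h => by
  unfold empiricalCDF
  refine div_le_div_of_nonneg_right ?_ (Nat.cast_nonneg m)
  exact_mod_cast Finset.card_le_card
    (Finset.monotone_filter_right _ fun j _ hj => le_trans hj h)

/-- The set is a finite union, over the index sets J that are large enough, of intersections of
closed half-lines. Closedness makes the infimum in the empirical quantile attained. -/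
lemma isClosed_le_empiricalCDF {m : ℕ} (r : Fin m → ℝ) (p : ℝ) :
    IsClosed {t | p ≤ empiricalCDF r t} := by
  have h : {t | p ≤ empiricalCDF r t} =
      ⋃ J ∈ {J : Finset (Fin m) | p ≤ (J.card : ℝ) / m}, ⋂ j ∈ J, Ici (r j) := by
    ext t
    simp only [mem_ofPred_eq, mem_iUnion, mem_iInter, mem_Ici, exists_prop]
    constructor
    · intro ht
      exact ⟨_, ht, fun j hj => (Finset.mem_filter.mp hj).2⟩
    · rintro ⟨J, hJ, hJt⟩
      refine hJ.trans (div_le_div_of_nonneg_right ?_ (Nat.cast_nonneg m))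
      exact_mod_cast Finset.card_le_card fun j hj =>
        Finset.mem_filter.mpr ⟨Finset.mem_univ j, hJt j hj⟩
  rw [h]
  exact (Set.toFinite _).isClosed_biUnion fun J _ =>
    isClosed_biInter fun j _ => isClosed_Ici

lemma quantile_empiricalCDF_le_iff {m : ℕ} (hm : 1 ≤ m) (r : Fin m → ℝ) {a : ℝ} (ha : 0 < a)
    (ha1 : a < 1) (x : ℝ) :
    quantile (empiricalCDF r) (1 - a) ≤ x ↔ 1 - a ≤ empiricalCDF r x := by
  have hm0 : (0 : ℝ) < m := by exact_mod_cast hm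
  have hne : Nonempty (Fin m) := ⟨⟨0, hm⟩⟩
  have hbdd : BddBelow {t | 1 - a ≤ empiricalCDF r t} := by
    obtain ⟨b, hb⟩ := (Set.finite_range r).bddBelow
    refine ⟨b, fun t ht => le_of_not_gt fun htb => ?_⟩
    have hz : empiricalCDF r t = 0 := by
      unfold empiricalCDF
      rw [Finset.filter_false_of_mem]
      · simp
      · exact fun j _ => not_le.mpr (htb.trans_le (hb ⟨j, rfl⟩))
    have : 1 - a ≤ empiricalCDF r t := ht
    linarith
  have hnon : {t | 1 - a ≤ empiricalCDF r t}.Nonempty := by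
    refine ⟨⨆ j, r j, ?_⟩
    have : empiricalCDF r (⨆ j, r j) = 1 := by
      unfold empiricalCDF
      rw [Finset.filter_true_of_mem fun j _ => le_iSup_fin r j]
      simp [hm0.ne']
    change 1 - a ≤ empiricalCDF r (⨆ j, r j)
    linarith
  constructor
  · intro h
    exact ((isClosed_le_empiricalCDF r (1 - a)).csInf_mem hnon hbdd).trans (empiricalCDF_mono r h)
  · intro h
    exact csInf_le hbdd h

/-- This form mentions only the order of the sample, ties included. Measurability and invariance
under increasing affine maps are read off from it, and the quantile disappears from the rest of the
argument. -/
lemma mem_tailSet_iff {m : ℕ} (hm : 1 ≤ m) (r : Fin m → ℝ) {a : ℝ} (ha : 0 < a) (ha1 : a < 1)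
    (j : Fin m) :
    j ∈ tailSet a r ↔ ((Finset.univ.filter fun i => r j < r i).card : ℝ) ≤ a * m := by
  have hm0 : (0 : ℝ) < m := by exact_mod_cast hm
  have hc : ((Finset.univ.filter fun i => r i ≤ r j).card : ℝ) +
      (Finset.univ.filter fun i => r j < r i).card = m := by
    have := Finset.card_filter_add_card_filter_not (s := (Finset.univ : Finset (Fin m)))
      (fun i => r i ≤ r j)
    simp only [not_le, Finset.card_univ, Fintype.card_fin] at this
    exact_mod_cast this
  rw [tailSet, Finset.mem_filter, quantile_empiricalCDF_le_iff hm r ha ha1, empiricalCDF,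
    le_div_iff₀ hm0]
  simp only [Finset.mem_univ, true_and]
  constructor <;> intro h <;> linarith

lemma tailSet_affine {m : ℕ} (hm : 1 ≤ m) (r : Fin m → ℝ) {a : ℝ} (ha : 0 < a) (ha1 : a < 1)
    (b : ℝ) {c : ℝ} (hc : 0 < c) : tailSet a (fun j => b + c * r j) = tailSet a r := by
  ext j
  rw [mem_tailSet_iff hm _ ha ha1, mem_tailSet_iff hm _ ha ha1]
  simp only [add_lt_add_iff_left, mul_lt_mul_iff_right₀ hc]

lemma tailSet_nonempty {m : ℕ} (hm : 1 ≤ m) (r : Fin m → ℝ) {a : ℝ} (ha : 0 < a) (ha1 : a < 1) :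
    (tailSet a r).Nonempty := by
  have hne : Nonempty (Fin m) := ⟨⟨0, hm⟩⟩
  obtain ⟨i, hi⟩ := exists_eq_ciSup_of_finite (f := r)
  refine ⟨i, ?_⟩
  rw [mem_tailSet_iff hm r ha ha1, Finset.filter_false_of_mem]
  · simp only [Finset.card_empty, Nat.cast_zero]; positivity
  · intro j _
    rw [hi, not_lt]
    exact le_iSup_fin r j

lemma tailMean_affine {m : ℕ} (hm : 1 ≤ m) (r : Fin m → ℝ) {a : ℝ} (ha : 0 < a) (ha1 : a < 1)
    (b : ℝ) {c : ℝ} (hc : 0 < c) :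
    tailMean a (fun j => b + c * r j) = b + c * tailMean a r := by
  have h := Finset.card_pos.mpr (tailSet_nonempty hm r ha ha1)
  have h' : ((tailSet a r).card : ℝ) ≠ 0 := by exact_mod_cast h.ne'
  rw [tailMean, tailMean, tailSet_affine hm r ha ha1 b hc, Finset.sum_add_distrib,
    ← Finset.mul_sum, Finset.sum_const, nsmul_eq_mul]
  field_simp

lemma tailVar_affine {m : ℕ} (hm : 1 ≤ m) (r : Fin m → ℝ) {a : ℝ} (ha : 0 < a) (ha1 : a < 1)
    (b : ℝ) {c : ℝ} (hc : 0 < c) :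
    tailVar a (fun j => b + c * r j) = c ^ 2 * tailVar a r := by
  rw [tailVar, tailVar, tailMean_affine hm r ha ha1 b hc, tailSet_affine hm r ha ha1 b hc,
    ← mul_div_assoc, Finset.mul_sum]
  congr 1
  exact Finset.sum_congr rfl fun j _ => by ring

lemma sigmaHat_affine {m : ℕ} (hm : 1 ≤ m) (r : Fin m → ℝ) {α : ℝ} (hα : 0 < α) (hα1 : α < 1)
    (b : ℝ) {c : ℝ} (hc : 0 < c) :
    sigmaHat α (fun j => b + c * r j) = c * sigmaHat α r := by
  rw [sigmaHat, sigmaHat, tailVar_affine hm r (by linarith) (by linarith) b hc, mul_div_assoc,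
    Real.sqrt_mul (sq_nonneg c), Real.sqrt_sq hc.le]

/-- Equivariance reduces the analysis of the predictor to samples with standard normal tail, for
which the target is E(N). -/
lemma predictedValue_affine {m : ℕ} (hm : 1 ≤ m) (r : Fin m → ℝ) {α : ℝ} (hα : 0 < α)
    (hα1 : α < 1) (N : ℕ) (b : ℝ) {c : ℝ} (hc : 0 < c) :
    predictedValue α N (fun j => b + c * r j) = b + c * predictedValue α N r := by
  rw [predictedValue, predictedValue, muHat, muHat, sigmaHat_affine hm r hα hα1 b hc,
    tailMean_affine hm r (by linarith) (by linarith) b hc]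
  ring

/-! ### Measurability of the prediction -/

lemma measurableSet_mem_tailSet {m : ℕ} {a : ℝ} (ha : 0 < a) (ha1 : a < 1) (j : Fin m) :
    MeasurableSet {r : Fin m → ℝ | j ∈ tailSet a r} := by
  have hm : 1 ≤ m := by have := j.2; omega
  simp only [mem_tailSet_iff hm _ ha ha1, Finset.card_filter]
  refine measurableSet_le ?_ measurable_const
  push_cast
  refine Finset.measurable_fun_sum _ fun i _ => ?_
  exact Measurable.ite (measurableSet_lt (measurable_pi_apply j) (measurable_pi_apply i))
    measurable_const measurable_const

lemma measurable_sum_tailSet {m : ℕ} {a : ℝ} (ha : 0 < a) (ha1 : a < 1)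
    {f : Fin m → (Fin m → ℝ) → ℝ} (hf : ∀ j, Measurable (f j)) :
    Measurable fun r : Fin m → ℝ => ∑ j ∈ tailSet a r, f j r := by
  have h : ∀ r : Fin m → ℝ, ∑ j ∈ tailSet a r, f j r =
      ∑ j, {r : Fin m → ℝ | j ∈ tailSet a r}.indicator (f j) r := fun r => by
    simp only [indicator_apply, mem_ofPred_eq]
    rw [← Finset.sum_filter]
    congr 1
    ext j
    simp
  simp_rw [h]
  exact Finset.measurable_fun_sum _ fun j _ =>
    (hf j).indicator (measurableSet_mem_tailSet ha ha1 j)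

lemma measurable_card_tailSet {m : ℕ} {a : ℝ} (ha : 0 < a) (ha1 : a < 1) :
    Measurable fun r : Fin m → ℝ => ((tailSet a r).card : ℝ) := by
  have := measurable_sum_tailSet ha ha1 (f := fun (_ : Fin m) _ => (1 : ℝ))
    fun _ => measurable_const
  simpa using this

lemma measurable_tailMean {m : ℕ} {a : ℝ} (ha : 0 < a) (ha1 : a < 1) :
    Measurable fun r : Fin m → ℝ => tailMean a r :=
  (measurable_sum_tailSet ha ha1 fun j => measurable_pi_apply j).div
    (measurable_card_tailSet ha ha1)

lemma measurable_tailVar {m : ℕ} {a : ℝ} (ha : 0 < a) (ha1 : a < 1) :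
    Measurable fun r : Fin m → ℝ => tailVar a r :=
  (measurable_sum_tailSet ha ha1 fun j =>
    (((measurable_pi_apply j).sub (measurable_tailMean ha ha1)).pow_const 2)).div
    (measurable_card_tailSet ha ha1)

lemma measurable_predictedValue {m : ℕ} {α : ℝ} (hα : 0 < α) (hα1 : α < 1) (N : ℕ) :
    Measurable fun r : Fin m → ℝ => predictedValue α N r := by
  have hs : Measurable fun r : Fin m → ℝ => sigmaHat α r :=
    ((measurable_tailVar (by linarith) (by linarith)).div_const _).sqrt
  exact ((measurable_tailMean (by linarith) (by linarith)).sub (hs.mul_const _)).add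
    (hs.mul_const _)

/-! ### Deterministic error bounds for the tail statistics -/

/-- If the empirical frequencies at `z ± s` straddle `a`, the tail set lies between the
sample points above `z + s` and those above `z - s`. -/
lemma tailSet_sandwich {m : ℕ} (hm : 1 ≤ m) (r : Fin m → ℝ) {a u v : ℝ} (ha : 0 < a) (ha1 : a < 1)
    (hu : ((Finset.univ.filter fun i => v ≤ r i).card : ℝ) ≤ a * m)
    (hv : a * m < (Finset.univ.filter fun i => u ≤ r i).card) :
    (∀ j, v ≤ r j → j ∈ tailSet a r) ∧ ∀ j ∈ tailSet a r, u ≤ r j := by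
  constructor
  · intro j hj
    rw [mem_tailSet_iff hm r ha ha1]
    refine le_trans ?_ hu
    exact_mod_cast Finset.card_le_card
      (Finset.monotone_filter_right _ fun i _ hi => hj.trans (le_of_lt hi))
  · intro j hj
    rw [mem_tailSet_iff hm r ha ha1] at hj
    by_contra! hlt
    have : ((Finset.univ.filter fun i => u ≤ r i).card : ℝ) ≤
        (Finset.univ.filter fun i => r j < r i).card := by
      exact_mod_cast Finset.card_le_card
        (Finset.monotone_filter_right _ fun i _ hi => hlt.trans_le hi)
    linarith

/-- The random set T and the fixed threshold z disagree only at points within s of z, and each of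
these changes its own term by at most s^k. The sum over T, whose terms are dependent, is thereby
replaced by a sum of i.i.d. variables. -/
lemma abs_sum_tail_sub_le {m : ℕ} (hm : 1 ≤ m) (r : Fin m → ℝ) (T : Finset (Fin m)) {z s : ℝ}
    (hs : 0 ≤ s) (h1 : ∀ j, z + s ≤ r j → j ∈ T) (h2 : ∀ j ∈ T, z - s ≤ r j)
    {k : ℕ} (hk : k ≠ 0) :
    |(∑ j ∈ T, (r j - z) ^ k) / m - (∑ j, max (r j - z) 0 ^ k) / m| ≤ s ^ k := by
  have hm0 : (0 : ℝ) < m := by exact_mod_cast hm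
  have hT : ∑ j ∈ T, (r j - z) ^ k = ∑ j, if j ∈ T then (r j - z) ^ k else 0 := by
    rw [← Finset.sum_filter]
    congr 1
    ext j; simp
  rw [hT, ← sub_div, ← Finset.sum_sub_distrib, abs_div, abs_of_pos hm0, div_le_iff₀ hm0]
  refine (Finset.abs_sum_le_sum_abs _ _).trans ?_
  have hpt : ∀ j ∈ (Finset.univ : Finset (Fin m)),
      |(if j ∈ T then (r j - z) ^ k else 0) - max (r j - z) 0 ^ k| ≤ s ^ k := by
    intro j _
    by_cases hj : j ∈ T
    · rw [if_pos hj]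
      have := h2 j hj
      rcases le_total (r j - z) 0 with h | h
      · rw [max_eq_right h, zero_pow hk, sub_zero, abs_pow]
        exact pow_le_pow_left₀ (abs_nonneg _) (by rw [abs_of_nonpos h]; linarith) k
      · rw [max_eq_left h, sub_self, abs_zero]; positivity
    · rw [if_neg hj]
      have : r j < z + s := by by_contra! h; exact hj (h1 j h)
      rw [zero_sub, abs_neg, abs_pow, abs_of_nonneg (le_max_right _ _)]
      exact pow_le_pow_left₀ (le_max_right _ _) (max_le (by linarith) hs) k
  calc _ ≤ ∑ _j : Fin m, s ^ k := Finset.sum_le_sum hpt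
    _ = _ := by simp [mul_comm]

lemma abs_div_sub_div_le {x y k a e : ℝ} (ha : 0 < a) (hk : a / 2 ≤ k) (hx : |x - y| ≤ e)
    (hka : |k - a| ≤ e) : |x / k - y / a| ≤ (2 / a + 2 * |y| / a ^ 2) * e := by
  have hk0 : 0 < k := by linarith
  have h : x / k - y / a = ((x - y) - y / a * (k - a)) / k := by field_simp; ring
  rw [h, abs_div, abs_of_pos hk0, div_le_iff₀ hk0]
  have he : 0 ≤ e := (abs_nonneg _).trans hx
  calc |x - y - y / a * (k - a)| ≤ |x - y| + |y / a * (k - a)| := abs_sub _ _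
    _ ≤ e + |y| / a * e := by
        rw [abs_mul, abs_div, abs_of_pos ha]
        exact add_le_add hx (mul_le_mul_of_nonneg_left hka (by positivity))
    _ = (2 / a + 2 * |y| / a ^ 2) * e * (a / 2) := by field_simp
    _ ≤ _ := mul_le_mul_of_nonneg_left hk (by positivity)

lemma tailMean_eq {m : ℕ} (hm : 1 ≤ m) (r : Fin m → ℝ) {a : ℝ} (ha : 0 < a) (ha1 : a < 1) (z : ℝ) :
    tailMean a r = z + ((∑ j ∈ tailSet a r, (r j - z)) / m) / ((tailSet a r).card / m) := by
  have hm0 : (m : ℝ) ≠ 0 := by exact_mod_cast (by omega : m ≠ 0)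
  have h := Finset.card_pos.mpr (tailSet_nonempty hm r ha ha1)
  have h' : ((tailSet a r).card : ℝ) ≠ 0 := by exact_mod_cast h.ne'
  rw [Finset.sum_sub_distrib, Finset.sum_const, nsmul_eq_mul, tailMean]
  field_simp
  ring

lemma tailVar_eq {m : ℕ} (hm : 1 ≤ m) (r : Fin m → ℝ) {a : ℝ} (ha : 0 < a) (ha1 : a < 1) (z : ℝ) :
    tailVar a r = ((∑ j ∈ tailSet a r, (r j - z) ^ 2) / m) / ((tailSet a r).card / m) -
      (((∑ j ∈ tailSet a r, (r j - z)) / m) / ((tailSet a r).card / m)) ^ 2 := by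
  have hm0 : (m : ℝ) ≠ 0 := by exact_mod_cast (by omega : m ≠ 0)
  have h := Finset.card_pos.mpr (tailSet_nonempty hm r ha ha1)
  have h' : ((tailSet a r).card : ℝ) ≠ 0 := by exact_mod_cast h.ne'
  have hmean := tailMean_eq hm r ha ha1 z
  set d := ((∑ j ∈ tailSet a r, (r j - z)) / m) / ((tailSet a r).card / m : ℝ) with hd
  have hsum : ∑ j ∈ tailSet a r, (r j - z) = d * (tailSet a r).card := by
    rw [hd]; field_simp
  have hexp : ∑ j ∈ tailSet a r, (r j - tailMean a r) ^ 2 =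
      ∑ j ∈ tailSet a r, (r j - z) ^ 2 - d ^ 2 * (tailSet a r).card := by
    calc _ = ∑ j ∈ tailSet a r, ((r j - z) ^ 2 - 2 * d * (r j - z) + d ^ 2) :=
          Finset.sum_congr rfl fun j _ => by rw [hmean]; ring
      _ = _ := by
          rw [Finset.sum_add_distrib, Finset.sum_sub_distrib, ← Finset.mul_sum, hsum,
            Finset.sum_const, nsmul_eq_mul]
          ring
  rw [tailVar, hexp]
  field_simp

/-- Holds for negative y as well, since `Real.sqrt` is 0 there; hence no sign information on the
argument is required. -/
lemma abs_sqrt_sub_one_le (y : ℝ) : |Real.sqrt y - 1| ≤ |y - 1| := by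
  rcases le_total 0 y with hy | hy
  · have h1 := Real.sqrt_nonneg y
    have h2 : y - 1 = (Real.sqrt y - 1) * (Real.sqrt y + 1) := by
      nlinarith [Real.mul_self_sqrt hy]
    rw [h2, abs_mul, abs_of_pos (by linarith : 0 < Real.sqrt y + 1)]
    nlinarith [abs_nonneg (Real.sqrt y - 1)]
  · rw [Real.sqrt_eq_zero_of_nonpos hy, abs_of_nonpos (by linarith : y - 1 ≤ 0)]
    norm_num
    linarith

/-! ### Concentration of the tail estimators -/

/-- The tail mean and variance are smooth functions of three averages: the tail fraction and the
first two truncated moments about z. At the exact values a, m₁, m₂ they equal the inverse Mills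
ratio and `truncVar z`, and the quotients are Lipschitz near there because the fraction stays above
a/2. -/
lemma exists_tail_estimator_error {a z : ℝ} (ha : 0 < a) (ha1 : a < 1)
    (hz : (gaussianReal 0 1).real (Ici z) = a) :
    ∃ C s₁ : ℝ, 0 < C ∧ 0 < s₁ ∧ ∀ (m : ℕ) (r : Fin m → ℝ) (s : ℝ), 1 ≤ m → 0 < s → s ≤ s₁ →
      (∀ j, z + s ≤ r j → j ∈ tailSet a r) → (∀ j ∈ tailSet a r, z - s ≤ r j) →
      |((tailSet a r).card : ℝ) / m - a| ≤ 2 * s →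
      |(∑ j, max (r j - z) 0) / m - ∫ x, max (x - z) 0 ∂(gaussianReal 0 1)| ≤ s →
      |(∑ j, max (r j - z) 0 ^ 2) / m - ∫ x, max (x - z) 0 ^ 2 ∂(gaussianReal 0 1)| ≤ s →
      |tailMean a r - invMills z| ≤ C * s ∧
        |Real.sqrt (tailVar a r / truncVar z) - 1| ≤ C * s := by
  set m₁ := ∫ x, max (x - z) 0 ∂(gaussianReal 0 1) with hm₁
  set m₂ := ∫ x, max (x - z) 0 ^ 2 ∂(gaussianReal 0 1) with hm₂
  have e1 : m₁ / a = invMills z - z := by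
    rw [hm₁, integral_posPart_gaussianReal, hz, mul_div_cancel_left₀ _ ha.ne']
  have e2 : m₂ / a = 1 - z * invMills z + z ^ 2 := by
    rw [hm₂, integral_posPart_sq_gaussianReal, hz, mul_div_cancel_left₀ _ ha.ne']
  have eδ : truncVar z = m₂ / a - (m₁ / a) ^ 2 := by
    rw [e1, e2, truncVar]; ring
  have hδ := truncVar_pos z
  set δ := truncVar z
  set C₁ := 2 / a + 2 * |m₁| / a ^ 2 with hC₁
  set C₂ := 2 / a + 2 * |m₂| / a ^ 2 with hC₂
  have hC₁0 : 0 < C₁ := by positivity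
  have hC₂0 : 0 < C₂ := by positivity
  -- Lipschitz constant of the variance W - X²: the first term is the error of W, the second that of
  -- X² written as a difference times a sum, with s ≤ 1 used in the sum.
  set D := 2 * C₂ + 2 * C₁ * (2 * C₁ + 2 * |m₁ / a|) with hD
  have hD0 : 0 < D := by positivity
  refine ⟨2 * C₁ + D / δ, min 1 (a / 4), by positivity, by positivity, ?_⟩
  intro m r s hm hs hs1 h1 h2 hk hS1 hS2
  have hsle : s ≤ 1 := hs1.trans (min_le_left _ _)
  have hsa : s ≤ a / 4 := hs1.trans (min_le_right _ _)
  have hka : a / 2 ≤ ((tailSet a r).card : ℝ) / m := by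
    have := (abs_le.mp hk).1; linarith
  have t1 := abs_sum_tail_sub_le hm r (tailSet a r) hs.le h1 h2 one_ne_zero
  have t2 := abs_sum_tail_sub_le hm r (tailSet a r) hs.le h1 h2 two_ne_zero
  simp only [pow_one] at t1
  have hs2 : s ^ 2 ≤ s := by nlinarith
  have u1 : |(∑ j ∈ tailSet a r, (r j - z)) / m - m₁| ≤ 2 * s := by
    have := abs_sub_le ((∑ j ∈ tailSet a r, (r j - z)) / m) ((∑ j, max (r j - z) 0) / m) m₁
    linarith
  have u2 : |(∑ j ∈ tailSet a r, (r j - z) ^ 2) / m - m₂| ≤ 2 * s := by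
    have := abs_sub_le ((∑ j ∈ tailSet a r, (r j - z) ^ 2) / m)
      ((∑ j, max (r j - z) 0 ^ 2) / m) m₂
    linarith
  have v1 := abs_div_sub_div_le ha hka u1 hk
  have v2 := abs_div_sub_div_le ha hka u2 hk
  rw [← hC₁] at v1
  rw [← hC₂] at v2
  have hmean := tailMean_eq hm r ha ha1 z
  have hvar := tailVar_eq hm r ha ha1 z
  set X := ((∑ j ∈ tailSet a r, (r j - z)) / m) / ((tailSet a r).card / m : ℝ)
  set W := ((∑ j ∈ tailSet a r, (r j - z) ^ 2) / m) / ((tailSet a r).card / m : ℝ)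
  constructor
  · have : tailMean a r - invMills z = X - m₁ / a := by rw [hmean, e1]; ring
    rw [this]
    have : 0 ≤ D / δ * s := by positivity
    linarith
  · refine (abs_sqrt_sub_one_le _).trans ?_
    have h3 : tailVar a r / δ - 1 = ((W - m₂ / a) - (X - m₁ / a) * ((X - m₁ / a) + 2 * (m₁ / a))) / δ := by
      rw [hvar, div_sub_one hδ.ne', eδ]; ring
    rw [h3, abs_div, abs_of_pos hδ, div_le_iff₀ hδ]
    have h4 : |X - m₁ / a + 2 * (m₁ / a)| ≤ 2 * C₁ + 2 * |m₁ / a| := by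
      refine (abs_add_le _ _).trans ?_
      rw [abs_mul, abs_two]
      nlinarith
    have h5 : |(X - m₁ / a) * (X - m₁ / a + 2 * (m₁ / a))| ≤
        C₁ * (2 * s) * (2 * C₁ + 2 * |m₁ / a|) := by
      rw [abs_mul]
      exact mul_le_mul v1 h4 (abs_nonneg _) (by positivity)
    calc _ ≤ |W - m₂ / a| + |(X - m₁ / a) * (X - m₁ / a + 2 * (m₁ / a))| := abs_sub _ _
      _ ≤ D * s := by rw [hD]; linarith
      _ ≤ (2 * C₁ + D / δ) * s * δ := by
          have : (2 * C₁ + D / δ) * s * δ = 2 * C₁ * s * δ + D * s := by field_simp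
          rw [this]
          have : 0 ≤ 2 * C₁ * s * δ := by positivity
          linarith

/-- Frequencies at `z ± s` that are close enough to probabilities straddling `a` locate the tail
set and determine its size up to `2 * s`. -/
lemma tailSet_of_frequencies {m : ℕ} (hm : 1 ≤ m) (r : Fin m → ℝ) {a c s u v z : ℝ} (ha : 0 < a)
    (ha1 : a < 1) (_hs : 0 ≤ s) (_hc1 : c ≤ 1) (hu1 : u ≤ a - c * s) (hu2 : a - s ≤ u)
    (hv1 : a + c * s ≤ v) (hv2 : v ≤ a + s)
    (hu : -(c / 2 * s) < ((Finset.univ.filter fun i => z + s ≤ r i).card : ℝ) / m - u ∧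
      ((Finset.univ.filter fun i => z + s ≤ r i).card : ℝ) / m - u < c / 2 * s)
    (hv : -(c / 2 * s) < ((Finset.univ.filter fun i => z - s ≤ r i).card : ℝ) / m - v ∧
      ((Finset.univ.filter fun i => z - s ≤ r i).card : ℝ) / m - v < c / 2 * s) :
    (∀ j, z + s ≤ r j → j ∈ tailSet a r) ∧ (∀ j ∈ tailSet a r, z - s ≤ r j) ∧
      |((tailSet a r).card : ℝ) / m - a| ≤ 2 * s := by
  have hm0 : (0 : ℝ) < m := by exact_mod_cast hm
  have hcs : 0 < c / 2 * s := by linarith [hu.1, hu.2]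
  have hcs1 : c / 2 * s ≤ s := by nlinarith
  obtain ⟨k1, k2⟩ := tailSet_sandwich hm r ha ha1 (u := z - s) (v := z + s)
    ((div_lt_iff₀ hm0).mp (by linarith [hu.2])).le ((lt_div_iff₀ hm0).mp (by linarith [hv.1]))
  have g1 : ((Finset.univ.filter fun i => z + s ≤ r i).card : ℝ) / m ≤
      ((tailSet a r).card : ℝ) / m := by
    refine div_le_div_of_nonneg_right ?_ hm0.le
    exact_mod_cast Finset.card_le_card fun j hj => k1 j (Finset.mem_filter.mp hj).2
  have g2 : ((tailSet a r).card : ℝ) / m ≤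
      ((Finset.univ.filter fun i => z - s ≤ r i).card : ℝ) / m := by
    refine div_le_div_of_nonneg_right ?_ hm0.le
    exact_mod_cast Finset.card_le_card fun j hj =>
      Finset.mem_filter.mpr ⟨Finset.mem_univ j, k2 j hj⟩
  refine ⟨k1, k2, abs_le.mpr ⟨?_, ?_⟩⟩
  · linarith [hu.1]
  · linarith [hv.2]

lemma sum_indicator_Ici {m : ℕ} (r : Fin m → ℝ) (t : ℝ) :
    ∑ j, (Ici t).indicator (fun _ => (1 : ℝ)) (r j) =
      ((Finset.univ.filter fun i => t ≤ r i).card : ℝ) := by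
  simp only [indicator_apply, mem_Ici]
  rw [Finset.sum_boole]

lemma HasStdGaussianTail.measureReal_Ici {α : ℝ} {P : Measure ℝ} (h : HasStdGaussianTail α P)
    {t : ℝ} (ht : normalQuantile α ≤ t) : P.real (Ici t) = (gaussianReal 0 1).real (Ici t) := by
  have h1 := congrArg (fun ν => ν.real (Ici t)) h
  simp only [measureReal_restrict_apply measurableSet_Ici] at h1
  rwa [inter_eq_left.mpr (Ici_subset_Ici.mpr ht)] at h1

/-- Since Y vanishes below the quantile, its law under P is its law under the standard normal. The
constants c and t are therefore fixed before P. -/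
lemma HasStdGaussianTail.measure_empiricalMean_le {α : ℝ} (hα : 0 < α) (hα1 : α < 1)
    {Y : ℝ → ℝ} (hY : Measurable Y) (hY0 : ∀ x < normalQuantile α, Y x = 0) {τ : ℝ} (hτ : 0 < τ)
    (hYi : Integrable (fun x => Real.exp (τ * |Y x|)) (gaussianReal 0 1)) :
    ∃ c t : ℝ, 0 < c ∧ 0 < t ∧ ∀ (P : Measure ℝ) [IsProbabilityMeasure P],
      HasStdGaussianTail α P → ∀ m : ℕ, 1 ≤ m → ∀ ε : ℝ, 0 ≤ ε → ε ≤ t →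
      (Measure.pi fun _ : Fin m => P).real
        {x | ε ≤ |(∑ j, Y (x j)) / m - ∫ y, Y y ∂(gaussianReal 0 1)|} ≤
        2 * Real.exp (-(c * m * ε ^ 2)) := by
  have := Measure.isProbabilityMeasure_map (μ := gaussianReal 0 1) hY.aemeasurable
  obtain ⟨c, t, hc, ht, h⟩ := exists_measure_empiricalMean_le ((gaussianReal 0 1).map Y) hτ (by
    rw [integrable_map_measure (by fun_prop) hY.aemeasurable]
    exact hYi)
  refine ⟨c, t, hc, ht, fun P _ hP m hm ε hε hεt => ?_⟩
  rw [measure_empiricalMean_comp_eq P hY, hP.map_eq hα hα1 hY hY0]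
  have := h m hm ε hε hεt
  rwa [integral_map hY.aemeasurable (by fun_prop)] at this

/-- Four averages have to be accurate: the frequencies above z + s and z - s, and the two truncated
moments. Each fails with probability at most 2 exp(-c m s²). Using the level α/2 rather than α puts
z strictly above q, so for small s both z ± s lie where P is Gaussian. -/
lemma exists_measure_tail_estimator_error {α : ℝ} (hα : 0 < α) (hα1 : α < 1) :
    ∃ C c s₀ : ℝ, 0 < C ∧ 0 < c ∧ 0 < s₀ ∧ ∀ (P : Measure ℝ) [IsProbabilityMeasure P],
      HasStdGaussianTail α P → ∀ m : ℕ, 1 ≤ m → ∀ s : ℝ, 0 < s → s ≤ s₀ →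
      (Measure.pi fun _ : Fin m => P).real
        {r | ¬(|tailMean (α / 2) r - invMills (normalQuantile (α / 2))| ≤ C * s ∧
          |sigmaHat α r - 1| ≤ C * s)} ≤ 8 * Real.exp (-(c * m * s ^ 2)) := by
  set a := α / 2 with ha_def
  have ha : 0 < a := by rw [ha_def]; linarith
  have ha1 : a < 1 := by rw [ha_def]; linarith
  set z := normalQuantile a with hz_def
  set q := normalQuantile α with hq_def
  have hz : (gaussianReal 0 1).real (Ici z) = a := gaussianReal_Ici_normalQuantile ha ha1
  have hq : (gaussianReal 0 1).real (Ici q) = α := gaussianReal_Ici_normalQuantile hα hα1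
  have hqz : q < z := by
    rw [← gaussianReal_std_Ici_strictAnti.lt_iff_gt]
    rw [hz, hq, ha_def]; linarith
  obtain ⟨C, s₁, hC, hs₁, hdet⟩ := exists_tail_estimator_error ha ha1 hz
  obtain ⟨τ, hτ, hi2, hi1⟩ := exists_integrable_exp_posPart_sq z
  have hzero : ∀ x < q, max (x - z) 0 = 0 := fun x hx => max_eq_right (by linarith)
  obtain ⟨c₁, t₁, hc₁, ht₁, hb1⟩ := HasStdGaussianTail.measure_empiricalMean_le hα hα1
    (Y := fun x => max (x - z) 0) (by fun_prop) hzero hτ hi1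
  obtain ⟨c₂, t₂, hc₂, ht₂, hb2⟩ := HasStdGaussianTail.measure_empiricalMean_le hα hα1
    (Y := fun x => max (x - z) 0 ^ 2) (by fun_prop)
    (fun x hx => by rw [hzero x hx]; norm_num) hτ hi2
  -- A lower bound for the density on [z - 1, z + 1]. It separates the probabilities above z ± s
  -- from a by at least c₀ s, so frequencies with error below c₀ s / 2 still straddle a.
  set c₀ := gaussianPDFReal 0 1 (|z| + 1) with hc₀
  have hc₀pos : 0 < c₀ := gaussianPDFReal_pos 0 1 _ one_ne_zero
  have hc₀1 : c₀ ≤ 1 := gaussianPDFReal_std_le_one _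
  set c₃ := 1 / (4 * Real.exp 1) * (c₀ / 2) ^ 2 with hc₃
  have hc₃pos : 0 < c₃ := by positivity
  set c := min c₃ (min c₁ c₂) with hc_def
  refine ⟨C, c, min (min s₁ 1) (min (z - q) (min t₁ t₂)), hC, by positivity,
    by have := sub_pos.mpr hqz; positivity, ?_⟩
  intro P _ hP m hm s hs hss
  have hs_s₁ : s ≤ s₁ := hss.trans ((min_le_left _ _).trans (min_le_left _ _))
  have hs_1 : s ≤ 1 := hss.trans ((min_le_left _ _).trans (min_le_right _ _))
  have hs_q : s ≤ z - q := hss.trans ((min_le_right _ _).trans (min_le_left _ _))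
  have hs_t₁ : s ≤ t₁ :=
    hss.trans ((min_le_right _ _).trans ((min_le_right _ _).trans (min_le_left _ _)))
  have hs_t₂ : s ≤ t₂ :=
    hss.trans ((min_le_right _ _).trans ((min_le_right _ _).trans (min_le_right _ _)))
  have hm0 : (0 : ℝ) < m := by exact_mod_cast hm
  have hpdf : ∀ x, |x - z| ≤ s → c₀ ≤ gaussianPDFReal 0 1 x := fun x hx =>
    gaussianPDFReal_std_anti (by
      have := abs_sub_abs_le_abs_sub x z
      linarith)
  have gu : (gaussianReal 0 1).real (Ici (z + s)) ≤ a - c₀ * s ∧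
      a - s ≤ (gaussianReal 0 1).real (Ici (z + s)) := by
    have h1 := gaussianReal_std_Ici_sub (s := z) (t := z + s) (by linarith)
    have h2 := gaussianReal_std_Ico_le (s := z) (t := z + s) (by linarith)
    have h3 := le_gaussianReal_std_Ico (s := z) (t := z + s) (c := c₀) (by linarith) fun x hx =>
      hpdf x (by rw [abs_le]; constructor <;> linarith [hx.1, hx.2])
    rw [add_sub_cancel_left] at h2 h3
    constructor <;> linarith
  have gl : a + c₀ * s ≤ (gaussianReal 0 1).real (Ici (z - s)) ∧
      (gaussianReal 0 1).real (Ici (z - s)) ≤ a + s := by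
    have h1 := gaussianReal_std_Ici_sub (s := z - s) (t := z) (by linarith)
    have h2 := gaussianReal_std_Ico_le (s := z - s) (t := z) (by linarith)
    have h3 := le_gaussianReal_std_Ico (s := z - s) (t := z) (c := c₀) (by linarith) fun x hx =>
      hpdf x (by rw [abs_le]; constructor <;> linarith [hx.1, hx.2])
    rw [sub_sub_cancel] at h2 h3
    constructor <;> linarith
  rw [← hP.measureReal_Ici (by linarith : q ≤ z + s)] at gu
  rw [← hP.measureReal_Ici (by linarith : q ≤ z - s)] at gl
  set Q := Measure.pi fun _ : Fin m => P
  have hc₀s : 0 ≤ c₀ / 2 * s := by positivity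
  have hc₀s1 : c₀ / 2 * s ≤ 1 := by nlinarith
  have hle : ∀ {c' : ℝ}, c ≤ c' →
      2 * Real.exp (-(c' * m * s ^ 2)) ≤ 2 * Real.exp (-(c * m * s ^ 2)) := fun h => by
    gcongr
  have hc₃e : 1 / (4 * Real.exp 1) * m * (c₀ / 2 * s) ^ 2 = c₃ * m * s ^ 2 := by
    rw [hc₃]; ring
  have p1 := measure_empiricalMean_indicator_le P (measurableSet_Ici (a := z + s)) hc₀s hc₀s1 hm
  have p2 := measure_empiricalMean_indicator_le P (measurableSet_Ici (a := z - s)) hc₀s hc₀s1 hm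
  rw [hc₃e] at p1 p2
  have p3 := hb1 P hP m hm s hs.le hs_t₁
  have p4 := hb2 P hP m hm s hs.le hs_t₂
  have q1 := p1.trans (hle (min_le_left _ _))
  have q2 := p2.trans (hle (min_le_left _ _))
  have q3 := p3.trans (hle ((min_le_right _ _).trans (min_le_left _ _)))
  have q4 := p4.trans (hle ((min_le_right _ _).trans (min_le_right _ _)))
  simp only [sum_indicator_Ici] at q1 q2
  set B1 := {x : Fin m → ℝ | c₀ / 2 * s ≤
    |((Finset.univ.filter fun i => z + s ≤ x i).card : ℝ) / m - P.real (Ici (z + s))|}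
  set B2 := {x : Fin m → ℝ | c₀ / 2 * s ≤
    |((Finset.univ.filter fun i => z - s ≤ x i).card : ℝ) / m - P.real (Ici (z - s))|}
  set B3 := {x : Fin m → ℝ | s ≤
    |(∑ j, max (x j - z) 0) / m - ∫ y, max (y - z) 0 ∂(gaussianReal 0 1)|}
  set B4 := {x : Fin m → ℝ | s ≤
    |(∑ j, max (x j - z) 0 ^ 2) / m - ∫ y, max (y - z) 0 ^ 2 ∂(gaussianReal 0 1)|}
  have hsub : {r : Fin m → ℝ | ¬(|tailMean a r - invMills z| ≤ C * s ∧
      |sigmaHat α r - 1| ≤ C * s)} ⊆ (B1 ∪ B2) ∪ (B3 ∪ B4) := by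
    intro r hr
    by_contra hnot
    simp only [B1, B2, B3, B4, mem_union, not_or, mem_ofPred_eq, not_le] at hnot
    obtain ⟨⟨n1, n2⟩, n3, n4⟩ := hnot
    obtain ⟨k1, k2, hk⟩ := tailSet_of_frequencies hm r ha ha1 hs.le hc₀1 gu.1 gu.2 gl.1 gl.2
      (abs_lt.mp n1) (abs_lt.mp n2)
    exact hr (hdet m r s hm hs hs_s₁ k1 k2 hk n3.le n4.le)
  calc Q.real _ ≤ Q.real ((B1 ∪ B2) ∪ (B3 ∪ B4)) := measureReal_mono hsub
    _ ≤ Q.real (B1 ∪ B2) + Q.real (B3 ∪ B4) := measureReal_union_le _ _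
    _ ≤ (Q.real B1 + Q.real B2) + (Q.real B3 + Q.real B4) :=
        add_le_add (measureReal_union_le _ _) (measureReal_union_le _ _)
    _ ≤ _ := by linarith

/-- After standardization the prediction error is the error of the tail mean plus (E(N) - λ) times
the error of the scale estimate, where λ is the inverse Mills ratio. The scale error is amplified by
E(N), which accounts for the factor 1 + E(N). -/
lemma exists_measure_predictedValue_error {α : ℝ} (hα : 0 < α) (hα1 : α < 1) :
    ∃ C c s₀ : ℝ, 0 < C ∧ 0 < c ∧ 0 < s₀ ∧ ∀ (P : Measure ℝ) [IsProbabilityMeasure P] (μ σ : ℝ),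
      0 < σ → HasGaussianTail P α μ σ → ∀ N m : ℕ, 1 ≤ N → 1 ≤ m → ∀ s : ℝ, 0 < s → s ≤ s₀ →
      (Measure.pi fun _ : Fin m => P).real
        {r | σ * (C * s * (1 + expectedMax (gaussianReal 0 1) N)) <
          |predictedValue α N r - (μ + σ * expectedMax (gaussianReal 0 1) N)|} ≤
        8 * Real.exp (-(c * m * s ^ 2)) := by
  obtain ⟨C, c, s₀, hC, hc, hs₀, h⟩ := exists_measure_tail_estimator_error hα hα1
  set l := invMills (normalQuantile (α / 2)) with hl
  have hl0 : 0 ≤ l := invMills_nonneg _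
  refine ⟨C * (1 + l), c, s₀, by positivity, hc, hs₀, ?_⟩
  intro P _ μ σ hσ hP N m hN hm s hs hss
  set E := expectedMax (gaussianReal 0 1) N
  have hE : 0 ≤ E := expectedMax_gaussian_nonneg hN
  have hT : Measurable fun x : ℝ => (x - μ) / σ := by fun_prop
  have := Measure.isProbabilityMeasure_map (μ := P) hT.aemeasurable
  refine le_trans ?_ (h (P.map fun x => (x - μ) / σ) (hP.standardize hα hα1 hσ) m hm s hs hss)
  set B := {r : Fin m → ℝ | ¬(|tailMean (α / 2) r - l| ≤ C * s ∧ |sigmaHat α r - 1| ≤ C * s)}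
  rw [← map_pi_comp P hT, measureReal_def, measureReal_def]
  refine ENNReal.toReal_mono (measure_ne_top _ _) ?_
  have hTm : Measurable fun (x : Fin m → ℝ) k => (x k - μ) / σ :=
    measurable_pi_lambda _ fun k => hT.comp (measurable_pi_apply k)
  -- This inequality for image measures holds for every set, so measurability of the bad event is
  -- not required.
  refine le_trans (measure_mono ?_) (Measure.le_map_apply hTm.aemeasurable B)
  intro r hr
  simp only [mem_ofPred_eq] at hr
  by_contra hnot
  simp only [B, mem_preimage, mem_ofPred_eq, not_not] at hnot
  obtain ⟨h1, h2⟩ := hnot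
  set r' : Fin m → ℝ := fun k => (r k - μ) / σ with hr'
  have hrr' : r = fun k => μ + σ * r' k := by
    funext k
    rw [hr']
    field_simp
    ring
  rw [hrr', predictedValue_affine hm r' hα hα1 N μ hσ, add_sub_add_left_eq_sub, ← mul_sub, abs_mul,
    abs_of_pos hσ] at hr
  have hlt := lt_of_mul_lt_mul_left hr hσ.le
  have hpe : predictedValue α N r' - E =
      (tailMean (α / 2) r' - l) - l * (sigmaHat α r' - 1) + E * (sigmaHat α r' - 1) := by
    rw [predictedValue, muHat]; ring
  have h3 : |predictedValue α N r' - E| ≤ C * s + l * (C * s) + E * (C * s) := by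
    rw [hpe]
    refine (abs_add_le _ _).trans (add_le_add ((abs_sub _ _).trans (add_le_add h1 ?_)) ?_)
    · rw [abs_mul, abs_of_nonneg hl0]; exact mul_le_mul_of_nonneg_left h2 hl0
    · rw [abs_mul, abs_of_nonneg hE]; exact mul_le_mul_of_nonneg_left h2 hE
  have h4 : 0 ≤ l * E * (C * s) := by positivity
  nlinarith

/-! ### Selecting a coordinate by partial information -/

lemma apply_eq_sum_indicator {n : ℕ} {A : Type*} (p : A → Fin n) (f : Fin n → A → ℝ) (x : A) :
    f (p x) x = ∑ i, {x | p x = i}.indicator (f i) x := by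
  rw [Finset.sum_eq_single (p x)]
  · rw [indicator_of_mem (show x ∈ {y | p y = p x} from rfl)]
  · intro i _ hi
    exact indicator_of_notMem (show x ∉ {y | p y = i} from fun h => hi (Eq.symm h)) _
  · exact fun h => absurd (Finset.mem_univ _) h

lemma measurable_apply_fin {n : ℕ} {A : Type*} [MeasurableSpace A] {p : A → Fin n}
    (hp : Measurable p) {f : Fin n → A → ℝ} (hf : ∀ i, Measurable (f i)) :
    Measurable fun x => f (p x) x := by
  simp_rw [apply_eq_sum_indicator p f]
  exact Finset.measurable_fun_sum _ fun i _ => (hf i).indicator (hp (measurableSet_singleton i))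

lemma integrable_apply_fin {n : ℕ} {A : Type*} [MeasurableSpace A] {Q : Measure A} {p : A → Fin n}
    (hp : Measurable p) {f : Fin n → A → ℝ} (hf : ∀ i, Integrable (f i) Q) :
    Integrable (fun x => f (p x) x) Q := by
  simp_rw [apply_eq_sum_indicator p f]
  exact integrable_finsetSum _ fun i _ => (hf i).indicator (hp (measurableSet_singleton i))

/-- With the other n - 1 coordinates frozen at w, selecting i is an event about π(ω i) alone; Fubini
then gives the formula. The sets B(w) are chosen before g, so that two integrands can be compared
over the same sets. -/
lemma integral_indicator_pick {Z Z' : Type*} [MeasurableSpace Z] [MeasurableSpace Z']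
    (ν : Measure Z) [IsProbabilityMeasure ν] {π : Z → Z'} (hπ : Measurable π) {n : ℕ} {pick : (Fin n → Z') → Fin n} (hpick : Measurable pick)
    (i : Fin n) :
    ∃ (B : (Fin (n - 1) → Z) → Set Z'), (∀ w, MeasurableSet (B w)) ∧
      ∀ g : Z → ℝ, Integrable g ν →
      ∫ ω : Fin n → Z, {ω | pick (fun j => π (ω j)) = i}.indicator (fun ω => g (ω i)) ω
          ∂(Measure.pi fun _ => ν) =
        ∫ w : Fin (n - 1) → Z, ∫ x in π ⁻¹' (B w), g x ∂ν ∂(Measure.pi fun _ => ν) := by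
  obtain ⟨k, rfl⟩ : ∃ k, n = k + 1 := ⟨n - 1, by have := i.2; omega⟩
  rw [Nat.add_sub_cancel]
  let B : (Fin k → Z) → Set Z' := fun w =>
    {b | pick (i.insertNth (α := fun _ => Z') b fun j => π (w j)) = i}
  have hB : ∀ w, MeasurableSet (B w) := fun w => by
    refine (hpick.comp ?_) (measurableSet_singleton i)
    refine measurable_pi_lambda _ (i.forall_iff_succAbove.2 ⟨?_, fun j => ?_⟩)
    · simp [measurable_id']
    · simp
  refine ⟨B, hB, fun g hg => ?_⟩
  have hmp := (measurePreserving_piFinSuccAbove (fun _ : Fin (k + 1) => ν) i).symm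
  have hpm : Measurable fun ω : Fin (k + 1) → Z => pick fun j => π (ω j) :=
    hpick.comp (measurable_pi_lambda _ fun j => hπ.comp (measurable_pi_apply j))
  have hgi : Integrable (fun ω : Fin (k + 1) → Z => g (ω i)) (Measure.pi fun _ => ν) :=
    (measurePreserving_eval_pi ν i).integrable_comp_of_integrable hg
  have hint := hgi.indicator (hpm (measurableSet_singleton i))
  rw [← hmp.integral_comp', integral_prod_symm]
  · congr 1 with w
    rw [← integral_indicator (hπ (hB w))]
    congr 1 with x
    have e1 : (MeasurableEquiv.piFinSuccAbove (fun _ => Z) i).symm (x, w) =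
        i.insertNth (α := fun _ => Z) x w := rfl
    have e2 : (fun j => π (i.insertNth (α := fun _ => Z) x w j)) =
        i.insertNth (α := fun _ => Z') (π x) fun j => π (w j) := by
      funext j
      refine i.succAboveCases ?_ (fun j => ?_) j <;> simp
    rw [e1]
    by_cases hx : pick (i.insertNth (α := fun _ => Z') (π x) fun j => π (w j)) = i
    · rw [indicator_of_mem (show i.insertNth (α := fun _ => Z) x w ∈
        {ω : Fin (k + 1) → Z | pick (fun j => π (ω j)) = i} by rw [mem_ofPred_eq, e2]; exact hx),
        indicator_of_mem (show x ∈ π ⁻¹' B w from hx)]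
      simp
    · rw [indicator_of_notMem (show i.insertNth (α := fun _ => Z) x w ∉
        {ω : Fin (k + 1) → Z | pick (fun j => π (ω j)) = i} by rw [mem_ofPred_eq, e2]; exact hx),
        indicator_of_notMem (show x ∉ π ⁻¹' B w from hx)]
  · exact hmp.integrable_comp_of_integrable hint

/-- If `h` and `v` have the same integral over every event that depends on `π` only, then a
coordinate selected by means of `π` gives the same expectation to `h` and to `v`. -/
lemma integral_pick_eq {Z Z' : Type*} [MeasurableSpace Z] [MeasurableSpace Z']
    (ν : Measure Z) [IsProbabilityMeasure ν] {π : Z → Z'} (hπ : Measurable π) {h v : Z → ℝ}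
    (hh : Integrable h ν) (hv : Integrable v ν)
    (heq : ∀ B, MeasurableSet B → ∫ z in π ⁻¹' B, h z ∂ν = ∫ z in π ⁻¹' B, v z ∂ν)
    {n : ℕ} {pick : (Fin n → Z') → Fin n} (hpick : Measurable pick) :
    ∫ ω : Fin n → Z, h (ω (pick fun j => π (ω j))) ∂(Measure.pi fun _ => ν) =
      ∫ ω : Fin n → Z, v (ω (pick fun j => π (ω j))) ∂(Measure.pi fun _ => ν) := by
  have hpm : Measurable fun ω : Fin n → Z => pick fun j => π (ω j) :=
    hpick.comp (measurable_pi_lambda _ fun j => hπ.comp (measurable_pi_apply j))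
  have key : ∀ g : Z → ℝ, Integrable g ν →
      ∫ ω : Fin n → Z, g (ω (pick fun j => π (ω j))) ∂(Measure.pi fun _ => ν) =
        ∑ i, ∫ ω : Fin n → Z, {ω | pick (fun j => π (ω j)) = i}.indicator (fun ω => g (ω i)) ω
          ∂(Measure.pi fun _ => ν) := fun g hg => by
    rw [← integral_finsetSum]
    · congr 1 with ω
      exact apply_eq_sum_indicator (fun ω : Fin n → Z => pick fun j => π (ω j))
        (fun i ω => g (ω i)) ω
    · exact fun i _ => ((measurePreserving_eval_pi ν i).integrable_comp_of_integrable hg).indicator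
        (hpm (measurableSet_singleton i))
  rw [key h hh, key v hv]
  refine Finset.sum_congr rfl fun i _ => ?_
  obtain ⟨B, hB, hB'⟩ := integral_indicator_pick ν hπ hpick i
  rw [hB' h hh, hB' v hv]
  congr 1 with w
  exact heq _ (hB w)

/-! ### The run as a product space; responses not used by the selection -/

namespace TwoStageModel

variable {S Y : Type*} [MeasurableSpace S] [MeasurableSpace Y] (M : TwoStageModel S Y)

/-- Joint law of a state and the i.i.d. sequence of responses generated from it. -/
def unitLaw : Measure (S × (ℕ → Y)) := M.stateLaw ⊗ₘ iidKernel M.response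

instance : IsProbabilityMeasure M.unitLaw := by unfold unitLaw; infer_instance

instance : IsProbabilityMeasure M.runLaw := by unfold runLaw; infer_instance

instance (s : S) : IsProbabilityMeasure (M.rewardLaw s) :=
  Measure.isProbabilityMeasure_map M.measurable_reward.aemeasurable

lemma measurePreserving_run {n : ℕ} :
    MeasurePreserving (fun (ω : ℕ → S × (ℕ → Y)) (i : Fin n) => ω i) M.runLaw
      (Measure.pi fun _ : Fin n => M.unitLaw) :=
  ⟨by fun_prop, map_infinitePi_of_injective M.unitLaw (e := fun i : Fin n => (i : ℕ))
    Fin.val_injective⟩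

lemma measurePreserving_run_eval (i : ℕ) :
    MeasurePreserving (fun ω : ℕ → S × (ℕ → Y) => ω i) M.runLaw M.unitLaw :=
  measurePreserving_eval_infinitePi (fun _ : ℕ => M.unitLaw) i

lemma measurePreserving_fst : MeasurePreserving Prod.fst M.unitLaw M.stateLaw :=
  ⟨measurable_fst, Measure.fst_compProd _ _⟩

lemma measurePreserving_state (i : ℕ) :
    MeasurePreserving (fun ω : ℕ → S × (ℕ → Y) => (ω i).1) M.runLaw M.stateLaw :=
  M.measurePreserving_fst.comp (M.measurePreserving_run_eval i)

lemma measurable_reward_eval (j : ℕ) : Measurable fun y : ℕ → Y => M.reward (y j) :=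
  M.measurable_reward.comp (measurable_pi_apply j)

lemma measurePreserving_rewards (s : S) {ι : Type*} [Fintype ι] {e : ι → ℕ}
    (he : Function.Injective e) :
    MeasurePreserving (fun (y : ℕ → Y) k => M.reward (y (e k))) (iidKernel M.response s)
      (Measure.pi fun _ : ι => M.rewardLaw s) := by
  refine ⟨measurable_pi_lambda _ fun k => M.measurable_reward_eval (e k), ?_⟩
  rw [rewardLaw, ← map_pi_comp _ M.measurable_reward, ← map_infinitePi_of_injective _ he,
    Measure.map_map (g := fun (x : ι → Y) k => M.reward (x k)) (measurable_pi_lambda _ fun k =>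
      M.measurable_reward.comp (measurable_pi_apply k)) (by fun_prop)]
  rfl

lemma stateValue_eq (n : ℕ) (s : S) :
    M.stateValue n s = ∫ y, ⨆ l : Fin n, M.reward (y l) ∂(iidKernel M.response s) := by
  have h := M.measurePreserving_rewards s (e := fun l : Fin n => (l : ℕ)) Fin.val_injective
  rw [stateValue, expectedMax, ← h.map_eq, integral_map h.measurable.aemeasurable]
  exact (measurable_iSup_fin fun i => measurable_pi_apply i).aestronglyMeasurable

lemma measurable_stateValue (n : ℕ) : Measurable (M.stateValue n) := by
  have h : M.stateValue n = fun s => ∫ y, ⨆ l : Fin n, M.reward (y l) ∂(iidKernel M.response s) :=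
    funext fun s => M.stateValue_eq n s
  rw [h]
  exact (StronglyMeasurable.integral_kernel
    (measurable_iSup_fin fun i : Fin n => M.measurable_reward_eval i).stronglyMeasurable).measurable

/-- The index blocks 0, ..., m - 1 and m, ..., m + n - 1 are disjoint, so given the state the
exploration rewards and the later ones are independent. -/
lemma measurePreserving_rewards_prod (s : S) (m n : ℕ) :
    MeasurePreserving (fun y : ℕ → Y => ((fun j : Fin m => M.reward (y j)),
      fun l : Fin n => M.reward (y (m + l)))) (iidKernel M.response s)
      ((Measure.pi fun _ : Fin m => M.rewardLaw s).prod
        (Measure.pi fun _ : Fin n => M.rewardLaw s)) := by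
  let e : Fin m ⊕ Fin n → ℕ := Sum.elim (fun j => (j : ℕ)) fun l => m + (l : ℕ)
  have he : Function.Injective e := by
    rintro (a | a) (b | b) hab
    · exact congrArg Sum.inl (Fin.val_injective hab)
    · have : (a : ℕ) = m + b := hab
      have := a.2; omega
    · have : m + (a : ℕ) = b := hab
      have := b.2; omega
    · have : m + (a : ℕ) = m + b := hab
      exact congrArg Sum.inr (Fin.ext (by omega))
  exact (measurePreserving_sumPiEquivProdPi (fun _ : Fin m ⊕ Fin n => M.rewardLaw s)).comp
    (M.measurePreserving_rewards s he)

/-- State together with the first `m` rewards generated from it. -/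
def firstRewards (m : ℕ) (z : S × (ℕ → Y)) : S × (Fin m → ℝ) :=
  (z.1, fun j => M.reward (z.2 j))

lemma measurable_firstRewards (m : ℕ) : Measurable (M.firstRewards m) :=
  measurable_fst.prodMk (measurable_pi_lambda _ fun j =>
    (M.measurable_reward_eval j).comp measurable_snd)

/-- Best of the `n` rewards that follow the first `m` ones. -/
def laterBest (m n : ℕ) (z : S × (ℕ → Y)) : ℝ := ⨆ l : Fin n, M.reward (z.2 (m + l))

lemma measurable_laterBest (m n : ℕ) : Measurable (M.laterBest m n) :=
  measurable_iSup_fin fun l => (M.measurable_reward_eval (m + l)).comp measurable_snd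

lemma integrable_laterBest (hR : ∀ j : ℕ, Integrable (fun z : S × (ℕ → Y) => M.reward (z.2 j)) M.unitLaw)
    (m n : ℕ) : Integrable (M.laterBest m n) M.unitLaw :=
  integrable_iSup_fin (fun l => (M.measurable_reward_eval (m + l)).comp measurable_snd)
    fun l => hR (m + l)

lemma integrable_stateValue
    (hR : ∀ j : ℕ, Integrable (fun z : S × (ℕ → Y) => M.reward (z.2 j)) M.unitLaw)
    (n : ℕ) : Integrable (M.stateValue n) M.stateLaw := by
  have h := (Measure.integrable_compProd_iff
    (M.measurable_laterBest 0 n).aestronglyMeasurable).mp (M.integrable_laterBest hR 0 n)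
  refine h.2.mono' (M.measurable_stateValue n).aestronglyMeasurable (ae_of_all _ fun s => ?_)
  rw [M.stateValue_eq]
  refine (norm_integral_le_integral_norm _).trans_eq ?_
  simp [laterBest]

/-- Given s, the indicator of the event depends on the first m rewards and the best later reward on
the others. The inner integral factorizes, and its second factor is V_n(s). -/
lemma setIntegral_laterBest
    (hR : ∀ j : ℕ, Integrable (fun z : S × (ℕ → Y) => M.reward (z.2 j)) M.unitLaw)
    (m n : ℕ) {B : Set (S × (Fin m → ℝ))} (hB : MeasurableSet B) :
    ∫ z in M.firstRewards m ⁻¹' B, M.laterBest m n z ∂M.unitLaw =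
      ∫ z in M.firstRewards m ⁻¹' B, M.stateValue n z.1 ∂M.unitLaw := by
  have hBm := M.measurable_firstRewards m hB
  have hv : Integrable (fun z : S × (ℕ → Y) => M.stateValue n z.1) M.unitLaw :=
    M.measurePreserving_fst.integrable_comp_of_integrable (M.integrable_stateValue hR n)
  rw [← integral_indicator hBm, ← integral_indicator hBm, unitLaw,
    Measure.integral_compProd ((M.integrable_laterBest hR m n).indicator hBm),
    Measure.integral_compProd (hv.indicator hBm)]
  congr 1 with s
  have hmp := M.measurePreserving_rewards_prod s m n
  have hBs : MeasurableSet {r : Fin m → ℝ | (s, r) ∈ B} := measurable_prodMk_left hB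
  have hind : Measurable ({r : Fin m → ℝ | (s, r) ∈ B}.indicator fun _ => (1 : ℝ)) :=
    measurable_const.indicator hBs
  have hsup : Measurable fun r : Fin n → ℝ => ⨆ l, r l :=
    measurable_iSup_fin fun i => measurable_pi_apply i
  have e1 : ∀ y : ℕ → Y, (M.firstRewards m ⁻¹' B).indicator (M.laterBest m n) (s, y) =
      {r : Fin m → ℝ | (s, r) ∈ B}.indicator (fun _ => (1 : ℝ)) (fun j => M.reward (y j)) *
        ⨆ l : Fin n, M.reward (y (m + l)) := fun y => by
    by_cases hy : (s, fun j : Fin m => M.reward (y j)) ∈ B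
    · rw [indicator_of_mem (show (s, y) ∈ M.firstRewards m ⁻¹' B from hy),
        indicator_of_mem (show (fun j : Fin m => M.reward (y j)) ∈
          {r : Fin m → ℝ | (s, r) ∈ B} from hy), one_mul]
      rfl
    · rw [indicator_of_notMem (show (s, y) ∉ M.firstRewards m ⁻¹' B from hy),
        indicator_of_notMem (show (fun j : Fin m => M.reward (y j)) ∉
          {r : Fin m → ℝ | (s, r) ∈ B} from hy), zero_mul]
  have e2 : ∀ y : ℕ → Y, (M.firstRewards m ⁻¹' B).indicator
      (fun z : S × (ℕ → Y) => M.stateValue n z.1) (s, y) =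
      {r : Fin m → ℝ | (s, r) ∈ B}.indicator (fun _ => (1 : ℝ)) (fun j => M.reward (y j)) *
        M.stateValue n s := fun y => by
    by_cases hy : (s, fun j : Fin m => M.reward (y j)) ∈ B
    · rw [indicator_of_mem (show (s, y) ∈ M.firstRewards m ⁻¹' B from hy),
        indicator_of_mem (show (fun j : Fin m => M.reward (y j)) ∈
          {r : Fin m → ℝ | (s, r) ∈ B} from hy), one_mul]
    · rw [indicator_of_notMem (show (s, y) ∉ M.firstRewards m ⁻¹' B from hy),
        indicator_of_notMem (show (fun j : Fin m => M.reward (y j)) ∉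
          {r : Fin m → ℝ | (s, r) ∈ B} from hy), zero_mul]
  simp_rw [e1, e2]
  rw [integral_mul_const]
  have h1 := integral_map (μ := iidKernel M.response s) hmp.measurable.aemeasurable
    (f := fun p : (Fin m → ℝ) × (Fin n → ℝ) =>
      {r : Fin m → ℝ | (s, r) ∈ B}.indicator (fun _ => (1 : ℝ)) p.1 * ⨆ l, p.2 l)
    ((hind.comp measurable_fst).mul (hsup.comp measurable_snd)).aestronglyMeasurable
  have h2 := integral_map (μ := iidKernel M.response s)
    (M.measurePreserving_rewards s (e := fun l : Fin m => (l : ℕ))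
      Fin.val_injective).measurable.aemeasurable
    (f := {r : Fin m → ℝ | (s, r) ∈ B}.indicator (fun _ => (1 : ℝ))) hind.aestronglyMeasurable
  rw [(M.measurePreserving_rewards s (e := fun l : Fin m => (l : ℕ)) Fin.val_injective).map_eq]
    at h2
  rw [hmp.map_eq, integral_prod_mul] at h1
  rw [← h1, ← h2]
  rfl

/-- Responses that the selection did not use are as good as fresh ones. -/
lemma integral_laterBest_pick
    (hR : ∀ j : ℕ, Integrable (fun z : S × (ℕ → Y) => M.reward (z.2 j)) M.unitLaw)
    (m n : ℕ) {K : ℕ} {pick : (Fin K → S × (Fin m → ℝ)) → Fin K} (hpick : Measurable pick) :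
    ∫ ω, M.laterBest m n (ω (pick fun i : Fin K => M.firstRewards m (ω i))) ∂M.runLaw =
      ∫ ω, M.stateValue n (ω (pick fun i : Fin K => M.firstRewards m (ω i))).1 ∂M.runLaw := by
  have hv : Integrable (fun z : S × (ℕ → Y) => M.stateValue n z.1) M.unitLaw :=
    M.measurePreserving_fst.integrable_comp_of_integrable (M.integrable_stateValue hR n)
  have h := integral_pick_eq M.unitLaw (M.measurable_firstRewards m) (M.integrable_laterBest hR m n)
    hv (fun B hB => M.setIntegral_laterBest hR m n hB) hpick
  have hmp := M.measurePreserving_run (n := K)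
  have hpm : Measurable fun ω : Fin K → S × (ℕ → Y) => pick fun j => M.firstRewards m (ω j) :=
    hpick.comp (measurable_pi_lambda _ fun j =>
      (M.measurable_firstRewards m).comp (measurable_pi_apply j))
  have key : ∀ g : S × (ℕ → Y) → ℝ, Measurable g →
      ∫ ω : Fin K → S × (ℕ → Y), g (ω (pick fun j => M.firstRewards m (ω j)))
        ∂(Measure.pi fun _ => M.unitLaw) =
      ∫ ω, g (ω (pick fun i : Fin K => M.firstRewards m (ω i))) ∂M.runLaw := fun g hg => by
    rw [← hmp.map_eq, integral_map hmp.measurable.aemeasurable]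
    exact (measurable_apply_fin hpm (f := fun i ω => g (ω i)) fun i =>
      hg.comp (measurable_pi_apply i)).aestronglyMeasurable
  rw [← key _ (M.measurable_laterBest m n), h,
    key (fun z => M.stateValue n z.1) ((M.measurable_stateValue n).comp measurable_fst)]

end TwoStageModel

/-! ### Consequences of the Gaussian tail assumption -/

/-- The bounds involve |C| because `ENNReal.ofReal C` is 0 for negative C. -/
lemma integrable_of_lintegral_sq_le {A : Type*} [MeasurableSpace A] {P : Measure A}
    [IsProbabilityMeasure P] {f : A → ℝ} (hf : Measurable f) {C : ℝ}
    (h : ∫⁻ x, ENNReal.ofReal (f x ^ 2) ∂P ≤ ENNReal.ofReal C) :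
    Integrable (fun x => f x ^ 2) P ∧ ∫ x, f x ^ 2 ∂P ≤ |C| ∧ Integrable f P ∧
      ∫ x, |f x| ∂P ≤ 1 + |C| := by
  have hi : Integrable (fun x => f x ^ 2) P := by
    rw [← lintegral_ofReal_ne_top_iff_integrable (by fun_prop) (ae_of_all _ fun x => sq_nonneg _)]
    exact ne_top_of_le_ne_top ENNReal.ofReal_ne_top h
  have hle : ∫ x, f x ^ 2 ∂P ≤ |C| := by
    rw [integral_eq_lintegral_of_nonneg_ae (ae_of_all _ fun x => sq_nonneg _) (by fun_prop)]
    refine (ENNReal.toReal_mono ENNReal.ofReal_ne_top h).trans ?_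
    rw [ENNReal.toReal_ofReal']
    exact max_le (le_abs_self C) (abs_nonneg C)
  have hb : ∀ x, |f x| ≤ 1 + f x ^ 2 := fun x => by
    rw [← sq_abs]; nlinarith [sq_nonneg (|f x| - 1), abs_nonneg (f x)]
  have hif : Integrable f P :=
    ((integrable_const (1 : ℝ)).add hi).mono' (by fun_prop) (ae_of_all _ hb)
  refine ⟨hi, hle, hif, ?_⟩
  calc _ ≤ ∫ x, (1 + f x ^ 2) ∂P := integral_mono hif.abs ((integrable_const _).add hi) hb
    _ = 1 + ∫ x, f x ^ 2 ∂P := by rw [integral_add (integrable_const _) hi]; simp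
    _ ≤ _ := by linarith

namespace HasGaussianTail

variable {P : Measure ℝ} [IsProbabilityMeasure P] {α μ σ : ℝ}

lemma expectedMax_eq (hσ : 0 < σ) (hP : Integrable (fun x => x) P) {n : ℕ} (hn : 1 ≤ n) :
    expectedMax P n = μ + σ * expectedMax (P.map fun x => (x - μ) / σ) n := by
  have hT : Measurable fun x : ℝ => (x - μ) / σ := by fun_prop
  have := Measure.isProbabilityMeasure_map (μ := P) hT.aemeasurable
  have hi : Integrable (fun x => x) (P.map fun x => (x - μ) / σ) := by
    rw [integrable_map_measure (by fun_prop) hT.aemeasurable]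
    exact (hP.sub (integrable_const μ)).div_const σ
  rw [← expectedMax_map_affine hi hn μ hσ.le, Measure.map_map (by fun_prop) hT]
  have : (fun x => μ + σ * x) ∘ (fun x : ℝ => (x - μ) / σ) = id := by
    funext x
    simp only [Function.comp, id]
    field_simp
    ring
  rw [this, Measure.map_id]

lemma expectedMax_le (h : HasGaussianTail P α μ σ) (hα : 0 < α) (hα1 : α < 1) (hσ : 0 < σ)
    (hP : Integrable (fun x => x) P) {n : ℕ} (hn : 1 ≤ n) :
    expectedMax P n ≤ μ + σ * (expectedMax (gaussianReal 0 1) n +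
      (1 - α) ^ (n - 1) * ∫ x, max (normalQuantile α - x) 0 ∂(gaussianReal 0 1)) := by
  have hT : Measurable fun x : ℝ => (x - μ) / σ := by fun_prop
  have := Measure.isProbabilityMeasure_map (μ := P) hT.aemeasurable
  have hi : Integrable (fun x => x) (P.map fun x => (x - μ) / σ) := by
    rw [integrable_map_measure (by fun_prop) hT.aemeasurable]
    exact (hP.sub (integrable_const μ)).div_const σ
  rw [expectedMax_eq (μ := μ) hσ hP hn]
  have := mul_le_mul_of_nonneg_left ((h.standardize hα hα1 hσ).expectedMax_le hα hα1 hi hn) hσ.le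
  linarith

/-- The tail does not control how far P reaches below its quantile, so the shortfall is paid with
the first absolute moment of P. That moment is bounded only on average over states, hence it stays
explicit here. -/
lemma le_expectedMax (h : HasGaussianTail P α μ σ) (hα : 0 < α) (hα1 : α < 1) (hσ : 0 < σ)
    (hP : Integrable (fun x => x) P) {n : ℕ} (hn : 1 ≤ n) :
    μ + σ * expectedMax (gaussianReal 0 1) n -
      (1 - α) ^ (n - 1) * (σ * |normalQuantile α| + |μ| + ∫ x, |x| ∂P) ≤ expectedMax P n := by
  have hT : Measurable fun x : ℝ => (x - μ) / σ := by fun_prop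
  have := Measure.isProbabilityMeasure_map (μ := P) hT.aemeasurable
  have hi : Integrable (fun x => x) (P.map fun x => (x - μ) / σ) := by
    rw [integrable_map_measure (by fun_prop) hT.aemeasurable]
    exact (hP.sub (integrable_const μ)).div_const σ
  rw [expectedMax_eq (μ := μ) hσ hP hn]
  have h1 := mul_le_mul_of_nonneg_left ((h.standardize hα hα1 hσ).le_expectedMax hα hα1 hi hn) hσ.le
  have h2 : σ * ∫ x, max (normalQuantile α - x) 0 ∂(P.map fun x => (x - μ) / σ) ≤
      σ * |normalQuantile α| + |μ| + ∫ x, |x| ∂P := by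
    rw [integral_map hT.aemeasurable (by fun_prop), ← integral_const_mul]
    calc _ ≤ ∫ x, (σ * |normalQuantile α| + |μ| + |x|) ∂P := by
          refine integral_mono ?_ ((integrable_const _).add hP.abs) fun x => ?_
          · exact (((integrable_const _).sub ((hP.sub (integrable_const μ)).div_const σ)).pos_part).const_mul σ
          · simp only
            rw [mul_max_of_nonneg _ _ hσ.le, mul_zero]
            refine max_le ?_ (by positivity)
            rw [mul_sub, mul_div_cancel₀ _ hσ.ne']
            have e1 := mul_le_mul_of_nonneg_left (le_abs_self (normalQuantile α)) hσ.le
            have e2 := le_abs_self μ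
            have e3 := neg_abs_le x
            linarith
      _ = _ := by rw [integral_add (integrable_const _) hP.abs]; simp
  have h3 := mul_le_mul_of_nonneg_left h2 (pow_nonneg (by linarith : 0 ≤ 1 - α) (n - 1))
  linarith

end HasGaussianTail

namespace TwoStageModel

variable {S Y : Type*} [MeasurableSpace S] [MeasurableSpace Y] (M : TwoStageModel S Y)

lemma measurePreserving_reward_eval (s : S) (j : ℕ) :
    MeasurePreserving (fun y : ℕ → Y => M.reward (y j)) (iidKernel M.response s)
      (M.rewardLaw s) :=
  (⟨M.measurable_reward, rfl⟩ : MeasurePreserving M.reward (M.response s) (M.rewardLaw s)).comp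
    (measurePreserving_eval_infinitePi (fun _ : ℕ => M.response s) j)

/-- First absolute moment of the reward of a response generated from a state. -/
def absMoment (s : S) : ℝ := ∫ x, |x| ∂(M.rewardLaw s)

namespace UniformGaussianTail

variable {M} {μ σ : S → ℝ} {α σmin σmax CR Mμ : ℝ}

lemma integrable_reward_sq (H : M.UniformGaussianTail μ σ α σmin σmax CR Mμ) (j : ℕ) :
    Integrable (fun z : S × (ℕ → Y) => M.reward (z.2 j)) M.unitLaw ∧
      ∫ z, |M.reward (z.2 j)| ∂M.unitLaw ≤ 1 + |CR| := by
  have hr : Measurable fun z : S × (ℕ → Y) => M.reward (z.2 j) :=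
    (M.measurable_reward_eval j).comp measurable_snd
  have h : ∫⁻ z, ENNReal.ofReal (M.reward (z.2 j) ^ 2) ∂M.unitLaw ≤ ENNReal.ofReal CR := by
    rw [unitLaw, Measure.lintegral_compProd (hr.pow_const 2).ennreal_ofReal]
    refine le_of_eq_of_le ?_ H.reward_sq
    congr 1 with s
    exact (M.measurePreserving_reward_eval s j).lintegral_comp
      (f := fun r => ENNReal.ofReal (r ^ 2)) (by fun_prop)
  exact (integrable_of_lintegral_sq_le hr h).2.2

lemma integrable_reward (H : M.UniformGaussianTail μ σ α σmin σmax CR Mμ) (j : ℕ) :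
    Integrable (fun z : S × (ℕ → Y) => M.reward (z.2 j)) M.unitLaw :=
  (H.integrable_reward_sq j).1

lemma ae_integrable_rewardLaw (H : M.UniformGaussianTail μ σ α σmin σmax CR Mμ) :
    ∀ᵐ s ∂M.stateLaw, Integrable (fun x => x) (M.rewardLaw s) := by
  have h := ((Measure.integrable_compProd_iff
    (H.integrable_reward 0).aestronglyMeasurable).mp (H.integrable_reward 0)).1
  filter_upwards [h] with s hs
  have hmp := M.measurePreserving_reward_eval s 0
  rw [← hmp.map_eq, integrable_map_measure (by fun_prop) hmp.measurable.aemeasurable]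
  exact hs

lemma integrable_absMoment (H : M.UniformGaussianTail μ σ α σmin σmax CR Mμ) :
    Integrable M.absMoment M.stateLaw ∧ ∫ s, M.absMoment s ∂M.stateLaw ≤ 1 + |CR| := by
  have he : M.absMoment = fun s => ∫ y, ‖M.reward (y 0)‖ ∂(iidKernel M.response s) := by
    funext s
    have hmp := M.measurePreserving_reward_eval s 0
    rw [absMoment, ← hmp.map_eq, integral_map hmp.measurable.aemeasurable (by fun_prop)]
    rfl
  have hi := ((Measure.integrable_compProd_iff
    (H.integrable_reward 0).aestronglyMeasurable).mp (H.integrable_reward 0)).2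
  rw [he]
  refine ⟨hi, ?_⟩
  have h2 := (H.integrable_reward_sq 0).2
  rwa [unitLaw, Measure.integral_compProd (H.integrable_reward 0).abs] at h2

lemma integrable_mu_sq (H : M.UniformGaussianTail μ σ α σmin σmax CR Mμ) :
    Integrable (fun s => μ s ^ 2) M.stateLaw ∧ ∫ s, μ s ^ 2 ∂M.stateLaw ≤ |Mμ| ∧
      Integrable μ M.stateLaw ∧ ∫ s, |μ s| ∂M.stateLaw ≤ 1 + |Mμ| :=
  integrable_of_lintegral_sq_le H.measurable_mu H.mu_sq

lemma stateValue_le (H : M.UniformGaussianTail μ σ α σmin σmax CR Mμ) (hα : 0 < α) (hα1 : α < 1)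
    (hσmin : 0 < σmin) {n : ℕ} (hn : 1 ≤ n) : ∀ᵐ s ∂M.stateLaw,
      M.stateValue n s ≤ μ s + σmax * (expectedMax (gaussianReal 0 1) n +
        (1 - α) ^ (n - 1) * ∫ x, max (normalQuantile α - x) 0 ∂(gaussianReal 0 1)) := by
  filter_upwards [H.tail, H.sigma_mem, H.ae_integrable_rewardLaw] with s hs hσs hi
  refine (hs.expectedMax_le hα hα1 (hσmin.trans_le hσs.1) hi hn).trans ?_
  have h1 := expectedMax_gaussian_nonneg hn
  have h2 : 0 ≤ (1 - α) ^ (n - 1) * ∫ x, max (normalQuantile α - x) 0 ∂(gaussianReal 0 1) :=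
    mul_nonneg (pow_nonneg (by linarith) _) (integral_nonneg fun x => le_max_right _ _)
  have := mul_le_mul_of_nonneg_right hσs.2 (add_nonneg h1 h2)
  linarith

lemma le_stateValue (H : M.UniformGaussianTail μ σ α σmin σmax CR Mμ) (hα : 0 < α) (hα1 : α < 1)
    (hσmin : 0 < σmin) {n : ℕ} (hn : 1 ≤ n) : ∀ᵐ s ∂M.stateLaw,
      μ s + σ s * expectedMax (gaussianReal 0 1) n -
        (1 - α) ^ (n - 1) * (σmax * |normalQuantile α| + |μ s| + M.absMoment s) ≤
        M.stateValue n s := by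
  filter_upwards [H.tail, H.sigma_mem, H.ae_integrable_rewardLaw] with s hs hσs hi
  refine le_trans ?_ (hs.le_expectedMax hα hα1 (hσmin.trans_le hσs.1) hi hn)
  have h1 := mul_le_mul_of_nonneg_right hσs.2 (abs_nonneg (normalQuantile α))
  have h2 : σ s * |normalQuantile α| + |μ s| + ∫ x, |x| ∂(M.rewardLaw s) ≤
      σmax * |normalQuantile α| + |μ s| + M.absMoment s := by
    rw [absMoment]; linarith
  have := mul_le_mul_of_nonneg_left h2 (pow_nonneg (by linarith : 0 ≤ 1 - α) (n - 1))
  linarith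

/-- With high probability the predicted value of a random state is accurate. -/
lemma exists_unitLaw_prediction_error (hα : 0 < α) (hα1 : α < 1) (hσmin : 0 < σmin) :
    ∃ C c s₀ : ℝ, 0 < C ∧ 0 < c ∧ 0 < s₀ ∧
      ∀ {S Y : Type*} [MeasurableSpace S] [MeasurableSpace Y] {M : TwoStageModel S Y} {μ σ : S → ℝ},
      M.UniformGaussianTail μ σ α σmin σmax CR Mμ →
      ∀ N m : ℕ, 1 ≤ N → 1 ≤ m → ∀ s : ℝ, 0 < s → s ≤ s₀ →
      M.unitLaw.real {z | σmax * (C * s * (1 + expectedMax (gaussianReal 0 1) N)) <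
          |predictedValue α N (fun j : Fin m => M.reward (z.2 j)) -
            (μ z.1 + σ z.1 * expectedMax (gaussianReal 0 1) N)|} ≤
        8 * Real.exp (-(c * m * s ^ 2)) := by
  obtain ⟨C, c, s₀, hC, hc, hs₀, h⟩ := exists_measure_predictedValue_error hα hα1
  refine ⟨C, c, s₀, hC, hc, hs₀, ?_⟩
  intro S Y _ _ M μ σ H N m hN hm s hs hss
  set E := expectedMax (gaussianReal 0 1) N
  have hE : 0 ≤ E := expectedMax_gaussian_nonneg hN
  have hpred := measurable_predictedValue (m := m) hα hα1 N
  set B := {z : S × (ℕ → Y) | σmax * (C * s * (1 + E)) <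
    |predictedValue α N (fun j : Fin m => M.reward (z.2 j)) - (μ z.1 + σ z.1 * E)|}
  have hBm : MeasurableSet B := by
    refine measurableSet_lt measurable_const (Measurable.abs (Measurable.sub ?_ ?_))
    · exact hpred.comp (measurable_pi_lambda _ fun j =>
        (M.measurable_reward_eval j).comp measurable_snd)
    · exact (H.measurable_mu.comp measurable_fst).add
        ((H.measurable_sigma.comp measurable_fst).mul_const E)
  have hfib : ∀ᵐ t ∂M.stateLaw, iidKernel M.response t (Prod.mk t ⁻¹' B) ≤
      ENNReal.ofReal (8 * Real.exp (-(c * m * s ^ 2))) := by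
    filter_upwards [H.tail, H.sigma_mem] with t ht hσt
    have hσ0 : 0 < σ t := hσmin.trans_le hσt.1
    have h1 := h (M.rewardLaw t) (μ t) (σ t) hσ0 ht N m hN hm s hs hss
    have hmp := M.measurePreserving_rewards t (e := fun j : Fin m => (j : ℕ)) Fin.val_injective
    have hBt : MeasurableSet {r : Fin m → ℝ | σ t * (C * s * (1 + E)) <
        |predictedValue α N r - (μ t + σ t * E)|} :=
      measurableSet_lt measurable_const (hpred.sub_const _).abs
    rw [measureReal_def, ← hmp.measure_preimage hBt.nullMeasurableSet] at h1
    refine (measure_mono ?_).trans ((ENNReal.le_ofReal_iff_toReal_le (measure_ne_top _ _)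
      (by positivity)).mpr h1)
    intro y hy
    have hy' : σmax * (C * s * (1 + E)) <
      |predictedValue α N (fun j : Fin m => M.reward (y j)) - (μ t + σ t * E)| := hy
    have hle : σ t * (C * s * (1 + E)) ≤ σmax * (C * s * (1 + E)) :=
      mul_le_mul_of_nonneg_right hσt.2 (by positivity)
    exact lt_of_le_of_lt hle hy'
  rw [measureReal_def, unitLaw, Measure.compProd_apply hBm]
  refine ENNReal.toReal_le_of_le_ofReal (by positivity) ?_
  calc _ ≤ ∫⁻ _, ENNReal.ofReal (8 * Real.exp (-(c * m * s ^ 2))) ∂M.stateLaw :=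
        lintegral_mono_ae hfib
    _ = _ := by simp

end UniformGaussianTail

end TwoStageModel

/-! ### Maxima of `μ + e σ` for independent `μ` and `σ` -/

/-- The maximum is restricted to the indices with v i ≥ τ. As v is fixed, the corresponding u are
still i.i.d. from P, and only their number matters. -/
lemma integral_iSup_add_mul_ge (P : Measure ℝ) [IsProbabilityMeasure P]
    (hP : Integrable (fun x => x) P) {K : ℕ} {e : ℝ} (he : 0 ≤ e) (v : Fin K → ℝ) (τ : ℝ)
    (hJ : 1 ≤ (Finset.univ.filter fun i => τ ≤ v i).card) :
    expectedMax P (Finset.univ.filter fun i => τ ≤ v i).card + τ * e ≤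
      ∫ u : Fin K → ℝ, ⨆ i, (u i + v i * e) ∂(Measure.pi fun _ => P) := by
  set J := Finset.univ.filter fun i => τ ≤ v i with hJdef
  set j := J.card with hj
  have hne : Nonempty (Fin j) := ⟨⟨0, hJ⟩⟩
  let f : Fin j ↪o Fin K := J.orderEmbOfFin rfl
  have hf : ∀ l, τ ≤ v (f l) := fun l =>
    (Finset.mem_filter.mp (J.orderEmbOfFin_mem rfl l)).2
  have hmap := map_pi_of_injective P f.injective
  have hsup : Measurable fun x : Fin j → ℝ => ⨆ l, x l :=
    measurable_iSup_fin fun i => measurable_pi_apply i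
  have hfm : Measurable fun (u : Fin K → ℝ) l => u (f l) := by fun_prop
  have h1 : expectedMax P j = ∫ u : Fin K → ℝ, ⨆ l, u (f l) ∂(Measure.pi fun _ => P) := by
    rw [expectedMax, ← hmap, integral_map hfm.aemeasurable hsup.aestronglyMeasurable]
  have hi1 : Integrable (fun u : Fin K → ℝ => ⨆ l, u (f l)) (Measure.pi fun _ => P) :=
    integrable_iSup_fin (fun l => measurable_pi_apply _) fun l => integrable_eval_pi hP _
  have hi2 : Integrable (fun u : Fin K → ℝ => ⨆ i, (u i + v i * e)) (Measure.pi fun _ => P) :=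
    integrable_iSup_fin (fun i => (measurable_pi_apply i).add_const _) fun i =>
      (integrable_eval_pi hP i).add (integrable_const _)
  calc expectedMax P j + τ * e
      = ∫ u : Fin K → ℝ, ((⨆ l, u (f l)) + τ * e) ∂(Measure.pi fun _ => P) := by
        rw [integral_add hi1 (integrable_const _), h1]; simp
    _ ≤ _ := integral_mono (hi1.add (integrable_const _)) hi2 fun u => by
        obtain ⟨l, hl⟩ := exists_eq_ciSup_of_finite (f := fun l => u (f l))
        simp only
        rw [← hl]
        refine le_trans ?_ (le_iSup_fin (fun i => u i + v i * e) (f l))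
        have := mul_le_mul_of_nonneg_right (hf l) he
        linarith

/-- Condition on the second coordinates v. Unless their frequency above τ deviates by p/2 or more,
at least Kp/2 of them exceed τ and the conditional mean is at least A + τ e. On the exceptional
event a single coordinate gives the bound -b, so the loss there is A + τ e + b. -/
lemma le_integral_iSup_prod (P ν : Measure ℝ) [IsProbabilityMeasure P] [IsProbabilityMeasure ν]
    (hP : Integrable (fun x => x) P) (hν : Integrable (fun x => x) ν) (hν0 : ∀ᵐ v ∂ν, 0 ≤ v)
    {K : ℕ} (hK : 1 ≤ K) {e τ A b : ℝ} (he : 0 ≤ e) (hp : 0 < ν.real (Ici τ))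
    (hA : ∀ j : ℕ, K * ν.real (Ici τ) / 2 ≤ j → j ≤ K → A ≤ expectedMax P j)
    (hb : -b ≤ ∫ x, x ∂P) (hAb : 0 ≤ A + τ * e + b) :
    A + τ * e - 2 * Real.exp (-(1 / (4 * Real.exp 1) * K * (ν.real (Ici τ) / 2) ^ 2)) *
        (A + τ * e + b) ≤
      ∫ x : Fin K → ℝ × ℝ, ⨆ i, ((x i).1 + (x i).2 * e) ∂(Measure.pi fun _ => P.prod ν) := by
  set p := ν.real (Ici τ) with hp_def
  have hK0 : (0 : ℝ) < K := by exact_mod_cast hK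
  have hne : Nonempty (Fin K) := ⟨⟨0, hK⟩⟩
  set PK := Measure.pi fun _ : Fin K => P
  set νK := Measure.pi fun _ : Fin K => ν
  have hmp := measurePreserving_arrowProdEquivProdArrow ℝ ℝ (Fin K) (fun _ => P) (fun _ => ν)
  have hint : Integrable (fun q : (Fin K → ℝ) × (Fin K → ℝ) => ⨆ i, (q.1 i + q.2 i * e))
      (PK.prod νK) := by
    refine integrable_iSup_fin (fun i => by fun_prop) fun i => ?_
    exact ((integrable_eval_pi hP i).comp_fst νK).add
      (((integrable_eval_pi hν i).comp_snd PK).mul_const e)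
  have e1 : ∫ x : Fin K → ℝ × ℝ, ⨆ i, ((x i).1 + (x i).2 * e)
      ∂(Measure.pi fun _ => P.prod ν) =
      ∫ q, ⨆ i, (q.1 i + q.2 i * e) ∂(PK.prod νK) :=
    hmp.integral_comp' (fun q : (Fin K → ℝ) × (Fin K → ℝ) => ⨆ i, (q.1 i + q.2 i * e))
  rw [e1, integral_prod_symm _ hint]
  set Bad := {v : Fin K → ℝ | p / 2 ≤
    |(∑ j, (Ici τ).indicator (fun _ => (1 : ℝ)) (v j)) / K - p|} with hBad
  have hBadm : MeasurableSet Bad := by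
    refine measurableSet_le measurable_const (Measurable.abs (Measurable.sub_const ?_ _))
    refine Measurable.div_const (Finset.measurable_fun_sum _ fun j _ => ?_) _
    exact (measurable_const.indicator measurableSet_Ici).comp (measurable_pi_apply j)
  have hprob : νK.real Bad ≤ 2 * Real.exp (-(1 / (4 * Real.exp 1) * K * (p / 2) ^ 2)) :=
    measure_empiricalMean_indicator_le ν measurableSet_Ici (by positivity)
      (by have : p ≤ 1 := measureReal_le_one
          linarith) hK
  have hpos : ∀ᵐ v ∂νK, ∀ i, 0 ≤ v i := by
    rw [ae_all_iff]
    exact fun i => (measurePreserving_eval_pi ν i).quasiMeasurePreserving.ae hν0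
  have hlow : ∀ᵐ v ∂νK, (A + τ * e) - Bad.indicator (fun _ => A + τ * e + b) v ≤
      ∫ u, ⨆ i, (u i + v i * e) ∂PK := by
    filter_upwards [hpos] with v hv
    by_cases hvB : v ∈ Bad
    · rw [indicator_of_mem hvB]
      have hi2 : Integrable (fun u : Fin K → ℝ => ⨆ i, (u i + v i * e)) PK :=
        integrable_iSup_fin (fun i => (measurable_pi_apply i).add_const _) fun i =>
          (integrable_eval_pi hP i).add (integrable_const _)
      have h2 : ∫ u : Fin K → ℝ, u ⟨0, hK⟩ ∂PK = ∫ x, x ∂P :=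
        integral_eval_pi hP.aestronglyMeasurable _
      have h3 : ∫ u : Fin K → ℝ, u ⟨0, hK⟩ ∂PK ≤ ∫ u, ⨆ i, (u i + v i * e) ∂PK := by
        refine integral_mono (integrable_eval_pi hP _) hi2 fun u => ?_
        refine le_trans ?_ (le_iSup_fin (fun i => u i + v i * e) ⟨0, hK⟩)
        have := mul_nonneg (hv ⟨0, hK⟩) he
        simp only
        linarith
      linarith
    · rw [indicator_of_notMem hvB, sub_zero]
      rw [hBad, mem_ofPred_eq, not_le, sum_indicator_Ici] at hvB
      have h1 := (abs_lt.mp hvB).1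
      have h2 : p / 2 < ((Finset.univ.filter fun i => τ ≤ v i).card : ℝ) / K := by linarith
      rw [lt_div_iff₀ hK0] at h2
      have h3 : 1 ≤ (Finset.univ.filter fun i => τ ≤ v i).card := by
        have : (0 : ℝ) < ((Finset.univ.filter fun i => τ ≤ v i).card : ℝ) :=
          lt_trans (by positivity) h2
        exact_mod_cast this
      have h4 := integral_iSup_add_mul_ge P hP he v τ h3
      have h5 := hA (Finset.univ.filter fun i => τ ≤ v i).card (by linarith) (by
        simpa using Finset.card_filter_le (Finset.univ : Finset (Fin K)) fun i => τ ≤ v i)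
      linarith
  have hiB : Integrable (Bad.indicator fun _ => A + τ * e + b) νK :=
    (integrable_const _).indicator hBadm
  calc _ ≤ A + τ * e - νK.real Bad * (A + τ * e + b) := by
        have := mul_le_mul_of_nonneg_right hprob hAb
        linarith
    _ = ∫ v, ((A + τ * e) - Bad.indicator (fun _ => A + τ * e + b) v) ∂νK := by
        rw [integral_sub (integrable_const _) hiB, integral_indicator_const _ hBadm]
        simp
    _ ≤ _ := integral_mono_ae ((integrable_const _).sub hiB) hint.integral_prod_right hlow

/-! ### Values of the two algorithms at a fixed budget -/

/-- Choosing a maximizer of approximate scores loses at most twice the accuracy, outside the event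
that some score is inaccurate; there the loss is controlled by second moments. -/
lemma iSup_sub_le_of_argmax {K : ℕ} {W V : Fin K → ℝ} {p : Fin K} (hp : ∀ i, V i ≤ V p) {ε B : ℝ}
    (hε : 0 ≤ ε) (hB : 0 < B) :
    (⨆ i, W i) - 2 * ε - ∑ i, {x : ℝ | ε < |x|}.indicator (fun _ => B) (V i - W i) -
      B⁻¹ * ∑ i, W i ^ 2 ≤ W p := by
  have : Nonempty (Fin K) := ⟨p⟩
  obtain ⟨i, hi⟩ := exists_eq_ciSup_of_finite (f := W)
  rw [← hi]
  have hsq : ∀ j, W j ^ 2 ≤ ∑ i, W i ^ 2 := fun j =>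
    Finset.single_le_sum (f := fun i => W i ^ 2) (fun j _ => sq_nonneg _) (Finset.mem_univ j)
  have hind : ∀ j, 0 ≤ {x : ℝ | ε < |x|}.indicator (fun _ => B) (V j - W j) := fun j =>
    indicator_nonneg (fun _ _ => hB.le) _
  have hS : 0 ≤ B⁻¹ * ∑ i, W i ^ 2 :=
    mul_nonneg (inv_nonneg.mpr hB.le) (Finset.sum_nonneg fun j _ => sq_nonneg _)
  by_cases hbad : ∃ j, ε < |V j - W j|
  · obtain ⟨j, hj⟩ := hbad
    have h1 : B ≤ ∑ i, {x : ℝ | ε < |x|}.indicator (fun _ => B) (V i - W i) := by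
      refine le_trans ?_ (Finset.single_le_sum (f := fun i => {x : ℝ | ε < |x|}.indicator
        (fun _ => B) (V i - W i)) (fun j _ => hind j) (Finset.mem_univ j))
      rw [indicator_of_mem (show V j - W j ∈ {x : ℝ | ε < |x|} from hj)]
    -- From 2|w| ≤ B + w²/B. Two such bounds cover the gap between the best score and the selected
    -- one; the part B is charged to the indicator and the rest to the second moments.
    have h2 : ∀ k, |W k| ≤ (B + B⁻¹ * ∑ i, W i ^ 2) / 2 := fun k => by
      have h3 := mul_le_mul_of_nonneg_left (hsq k) (inv_nonneg.mpr hB.le)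
      have h4 : 2 * |W k| ≤ B + B⁻¹ * W k ^ 2 := by
        have h5 : B + B⁻¹ * W k ^ 2 - 2 * |W k| = B⁻¹ * (B - |W k|) ^ 2 := by
          rw [← sq_abs (W k)]; field_simp; ring
        have := mul_nonneg (inv_nonneg.mpr hB.le) (sq_nonneg (B - |W k|))
        linarith
      linarith
    have h6 := h2 i
    have h7 := h2 p
    have h8 := le_abs_self (W i)
    have h9 := neg_abs_le (W p)
    linarith
  · push Not at hbad
    have h1 := (abs_le.mp (hbad i)).1
    have h2 := (abs_le.mp (hbad p)).2
    have h3 := hp i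
    have h4 := Finset.sum_nonneg fun j (_ : j ∈ (Finset.univ : Finset (Fin K))) => hind j
    linarith

namespace TwoStageModel

variable {S Y : Type*} [MeasurableSpace S] [MeasurableSpace Y] (M : TwoStageModel S Y)

lemma measurePreserving_states_comp {B : Type*} [MeasurableSpace B] {f : S → B} (hf : Measurable f)
    {n : ℕ} : MeasurePreserving (fun (ω : ℕ → S × (ℕ → Y)) (i : Fin n) => f (ω i).1) M.runLaw
      (Measure.pi fun _ : Fin n => M.stateLaw.map f) := by
  have h1 := M.measurePreserving_run (n := n)
  refine ⟨by fun_prop, ?_⟩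
  rw [← M.measurePreserving_fst.map_eq, Measure.map_map hf measurable_fst,
    ← map_pi_comp M.unitLaw (hf.comp measurable_fst), ← h1.map_eq, Measure.map_map (by fun_prop)
    (by fun_prop)]
  rfl

lemma integral_run_state {f : S → ℝ} (hf : AEStronglyMeasurable f M.stateLaw) (i : ℕ) :
    ∫ ω, f (ω i).1 ∂M.runLaw = ∫ s, f s ∂M.stateLaw := by
  have h := M.measurePreserving_state i
  conv_rhs => rw [← h.map_eq]
  rw [integral_map h.measurable.aemeasurable (by rwa [h.map_eq])]

lemma integrable_run_state {f : S → ℝ} (hf : Integrable f M.stateLaw) (i : ℕ) :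
    Integrable (fun ω : ℕ → S × (ℕ → Y) => f (ω i).1) M.runLaw :=
  (M.measurePreserving_state i).integrable_comp_of_integrable hf

namespace UniformGaussianTail

variable {M} {μ σ : S → ℝ} {α σmin σmax CR Mμ : ℝ}

lemma integrable_laterBest_pick (H : M.UniformGaussianTail μ σ α σmin σmax CR Mμ) (m n : ℕ) {K : ℕ}
    {pick : (Fin K → S × (Fin m → ℝ)) → Fin K} (hpick : Measurable pick) :
    Integrable (fun ω => M.laterBest m n (ω (pick fun i : Fin K => M.firstRewards m (ω i))))
      M.runLaw :=
  integrable_apply_fin (f := fun (i : Fin K) (ω : ℕ → S × (ℕ → Y)) => M.laterBest m n (ω i))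
    (hpick.comp (measurable_pi_lambda _ fun _ =>
      (M.measurable_firstRewards m).comp (measurable_pi_apply _)))
    fun i => (M.measurePreserving_run_eval i).integrable_comp_of_integrable
      (M.integrable_laterBest H.integrable_reward m n)

lemma integrable_stateValue_pick (H : M.UniformGaussianTail μ σ α σmin σmax CR Mμ) (m n : ℕ) {K : ℕ}
    {pick : (Fin K → S × (Fin m → ℝ)) → Fin K} (hpick : Measurable pick) :
    Integrable (fun ω => M.stateValue n (ω (pick fun i : Fin K => M.firstRewards m (ω i))).1)
      M.runLaw :=
  integrable_apply_fin (f := fun (i : Fin K) (ω : ℕ → S × (ℕ → Y)) => M.stateValue n (ω i).1)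
    (hpick.comp (measurable_pi_lambda _ fun _ =>
      (M.measurable_firstRewards m).comp (measurable_pi_apply _)))
    fun i => M.integrable_run_state (M.integrable_stateValue H.integrable_reward n) i

/-- The oracle selects from the states alone, which is the case of m = 0 exploration rewards, so its
outcome has the mean of V_N at the selected state. Bounding σ by σmax leaves μ plus a constant, and
the selected μ is at most the largest one. -/
lemma oracle_le (H : M.UniformGaussianTail μ σ α σmin σmax CR Mμ) (hα : 0 < α) (hα1 : α < 1)
    (hσmin : 0 < σmin) {N : ℕ} (hN : 1 ≤ N) {pick : (Fin N → ℝ) → Fin N}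
    (hpick : IsArgmaxRule pick) :
    Integrable (M.oracleOutcome N pick) M.runLaw ∧
      M.oracleValue N pick ≤ expectedMax (M.stateLaw.map μ) N +
        σmax * (expectedMax (gaussianReal 0 1) N +
        (1 - α) ^ (N - 1) * ∫ x, max (normalQuantile α - x) 0 ∂(gaussianReal 0 1)) := by
  have hpm : Measurable fun w : Fin N → S × (Fin 0 → ℝ) =>
      pick fun i => M.stateValue N (w i).1 :=
    hpick.measurable.comp (measurable_pi_lambda _ fun i =>
      (M.measurable_stateValue N).comp (measurable_fst.comp (measurable_pi_apply i)))
  have he : M.oracleOutcome N pick = fun ω => M.laterBest 0 N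
      (ω ((fun w : Fin N → S × (Fin 0 → ℝ) => pick fun i => M.stateValue N (w i).1)
        fun i : Fin N => M.firstRewards 0 (ω i))) := by
    funext ω
    simp only [oracleOutcome, laterBest, firstRewards, zero_add]
  have hi := H.integrable_laterBest_pick 0 N hpm
  refine ⟨by rw [he]; exact hi, ?_⟩
  rw [oracleValue, he, M.integral_laterBest_pick H.integrable_reward 0 N hpm]
  set c := σmax * (expectedMax (gaussianReal 0 1) N +
        (1 - α) ^ (N - 1) * ∫ x, max (normalQuantile α - x) 0 ∂(gaussianReal 0 1)) with hc
  have hae : ∀ᵐ ω ∂M.runLaw, ∀ i : ℕ, M.stateValue N (ω i).1 ≤ μ (ω i).1 + c := by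
    rw [ae_all_iff]
    exact fun i => (M.measurePreserving_state i).quasiMeasurePreserving.ae
      (H.stateValue_le hα hα1 hσmin hN)
  have hμi : ∀ i : Fin N, Integrable (fun ω : ℕ → S × (ℕ → Y) => μ (ω i).1) M.runLaw := fun i =>
    M.integrable_run_state H.integrable_mu_sq.2.2.1 i
  have hsup : Integrable (fun ω : ℕ → S × (ℕ → Y) => ⨆ i : Fin N, μ (ω i).1) M.runLaw :=
    integrable_iSup_fin (fun i => H.measurable_mu.comp
      (measurable_fst.comp (measurable_pi_apply _))) hμi
  have hE : ∫ ω, ⨆ i : Fin N, μ (ω i).1 ∂M.runLaw = expectedMax (M.stateLaw.map μ) N := by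
    have hmp := M.measurePreserving_states_comp H.measurable_mu (n := N)
    rw [expectedMax, ← hmp.map_eq, integral_map hmp.measurable.aemeasurable]
    exact (measurable_iSup_fin fun i => measurable_pi_apply i).aestronglyMeasurable
  calc _ ≤ ∫ ω, ((⨆ i : Fin N, μ (ω i).1) + c) ∂M.runLaw := by
        refine integral_mono_ae (H.integrable_stateValue_pick 0 N hpm)
          (hsup.add (integrable_const c)) ?_
        filter_upwards [hae] with ω hω
        exact (hω _).trans (add_le_add (le_iSup_fin (fun i : Fin N => μ (ω i).1) _) le_rfl)
    _ = _ := by rw [integral_add hsup (integrable_const c), hE]; simp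

/-- For the lower bound the exploration rewards are discarded; what remains was not used in the
selection, so it can be replaced by the value of the selected state. -/
lemma integrable_slgOutcome (H : M.UniformGaussianTail μ σ α σmin σmax CR Mμ) (hα : 0 < α)
    (hα1 : α < 1) {N K m : ℕ} {pick : (Fin K → ℝ) → Fin K} (hpick : IsArgmaxRule pick) :
    Integrable (M.slgOutcome α N K m pick) M.runLaw ∧
    Measurable (fun w : Fin K → S × (Fin m → ℝ) => pick fun i => predictedValue α N (w i).2) ∧
    ∫ ω, M.stateValue (N - K * m) (ω (M.slgChoice α N K m pick ω)).1 ∂M.runLaw ≤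
      M.slgValue α N K m pick := by
  have hpm : Measurable fun w : Fin K → S × (Fin m → ℝ) =>
      pick fun i => predictedValue α N (w i).2 :=
    hpick.measurable.comp (measurable_pi_lambda _ fun i =>
      (measurable_predictedValue hα hα1 N).comp (measurable_snd.comp (measurable_pi_apply i)))
  have hi := H.integrable_laterBest_pick m (N - K * m) hpm
  have hr : ∀ i j : ℕ, Measurable fun ω : ℕ → S × (ℕ → Y) => M.reward ((ω i).2 j) := fun i j =>
    (M.measurable_reward_eval j).comp (measurable_snd.comp (measurable_pi_apply i))
  have h1 : Integrable (fun ω : ℕ → S × (ℕ → Y) =>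
      ⨆ i : Fin K, ⨆ j : Fin m, M.reward ((ω i).2 j)) M.runLaw :=
    integrable_iSup_fin (fun i => measurable_iSup_fin fun j => hr i j) fun i =>
      integrable_iSup_fin (fun j => hr i j) fun j =>
        (M.measurePreserving_run_eval i).integrable_comp_of_integrable (H.integrable_reward j)
  have hint : Integrable (M.slgOutcome α N K m pick) M.runLaw := h1.sup hi
  refine ⟨hint, hpm, ?_⟩
  have h2 := M.integral_laterBest_pick H.integrable_reward m (N - K * m) hpm
  refine (h2.symm.trans_le ?_)
  exact integral_mono hi hint fun ω => le_max_right _ _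

/-- Lower bound for SLG search in terms of the best exact score `μ + σ E(N)` of the sampled
states. -/
lemma le_slgValue (H : M.UniformGaussianTail μ σ α σmin σmax CR Mμ) (hα : 0 < α) (hα1 : α < 1)
    (hσmin : 0 < σmin) (hσ : σmin ≤ σmax) {N K m : ℕ} (hN : 1 ≤ N) (hn : 1 ≤ N - K * m)
    {pick : (Fin K → ℝ) → Fin K} (hpick : IsArgmaxRule pick) {ε B Δ q : ℝ} (hε : 0 ≤ ε)
    (hB : 0 < B) (hΔ : expectedMax (gaussianReal 0 1) N -
      expectedMax (gaussianReal 0 1) (N - K * m) ≤ Δ) (hΔ0 : 0 ≤ Δ)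
    (hq : M.unitLaw.real {z | ε < |predictedValue α N (fun j : Fin m => M.reward (z.2 j)) -
      (μ z.1 + σ z.1 * expectedMax (gaussianReal 0 1) N)|} ≤ q) :
    ∫ ω, ⨆ i : Fin K, (μ (ω i).1 + σ (ω i).1 * expectedMax (gaussianReal 0 1) N) ∂M.runLaw -
      2 * ε - K * (B * q) -
      B⁻¹ * (K * (2 * |Mμ| + 2 * (σmax * expectedMax (gaussianReal 0 1) N) ^ 2)) - σmax * Δ -
      (1 - α) ^ (N - K * m - 1) *
        (K * (σmax * |normalQuantile α| + (1 + |Mμ|) + (1 + |CR|))) ≤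
      M.slgValue α N K m pick := by
  set n := N - K * m with hn_def
  set E := expectedMax (gaussianReal 0 1) N with hE_def
  have hE : 0 ≤ E := expectedMax_gaussian_nonneg hN
  obtain ⟨-, hpm, hle⟩ := H.integrable_slgOutcome hα hα1 (N := N) (m := m) hpick
  refine le_trans ?_ hle
  have hσmax : 0 < σmax := hσmin.trans_le hσ
  set W : S → ℝ := fun s => μ s + σ s * E with hW
  set g : S → ℝ := fun s => σmax * |normalQuantile α| + |μ s| + M.absMoment s with hg
  set d : S × (ℕ → Y) → ℝ := fun z =>
    predictedValue α N (fun j : Fin m => M.reward (z.2 j)) - W z.1 with hd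
  obtain ⟨hμ2, hμ2le, hμi, hμle⟩ := H.integrable_mu_sq
  obtain ⟨hai, hale⟩ := H.integrable_absMoment
  have hσi : Integrable σ M.stateLaw := by
    refine Integrable.of_bound H.measurable_sigma.aestronglyMeasurable σmax ?_
    filter_upwards [H.sigma_mem] with s hs
    rw [Real.norm_of_nonneg (hσmin.le.trans hs.1)]
    exact hs.2
  have hWm : Measurable W := H.measurable_mu.add (H.measurable_sigma.mul_const E)
  have hWi : Integrable W M.stateLaw := hμi.add (hσi.mul_const E)
  have hgi : Integrable g M.stateLaw := ((integrable_const _).add hμi.abs).add hai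
  have hgE : ∫ s, g s ∂M.stateLaw ≤
      σmax * |normalQuantile α| + (1 + |Mμ|) + (1 + |CR|) := by
    rw [integral_add (f := fun s => σmax * |normalQuantile α| + |μ s|)
      ((integrable_const _).add hμi.abs) hai, integral_add (integrable_const _) hμi.abs]
    simp only [integral_const, probReal_univ, one_smul]
    linarith
  have hW2le : ∀ᵐ s ∂M.stateLaw, W s ^ 2 ≤ 2 * μ s ^ 2 + 2 * (σmax * E) ^ 2 := by
    filter_upwards [H.sigma_mem] with s hs
    have h1 : (σ s * E) ^ 2 ≤ (σmax * E) ^ 2 :=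
      pow_le_pow_left₀ (mul_nonneg (hσmin.le.trans hs.1) hE)
        (mul_le_mul_of_nonneg_right hs.2 hE) 2
    rw [hW]
    nlinarith [sq_nonneg (μ s - σ s * E)]
  have hbi : Integrable (fun s => 2 * μ s ^ 2 + 2 * (σmax * E) ^ 2) M.stateLaw :=
    (hμ2.const_mul 2).add (integrable_const _)
  have hW2i : Integrable (fun s => W s ^ 2) M.stateLaw :=
    hbi.mono' (hWm.pow_const 2).aestronglyMeasurable (by
      filter_upwards [hW2le] with s hs
      rwa [Real.norm_of_nonneg (sq_nonneg _)])
  have hW2E : ∫ s, W s ^ 2 ∂M.stateLaw ≤ 2 * |Mμ| + 2 * (σmax * E) ^ 2 := by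
    refine (integral_mono_ae hW2i hbi hW2le).trans ?_
    rw [integral_add (hμ2.const_mul 2) (integrable_const _), integral_const_mul]
    simp only [integral_const, probReal_univ, one_smul]
    linarith
  have hdm : Measurable d :=
    ((measurable_predictedValue hα hα1 N).comp (measurable_pi_lambda _ fun j =>
      (M.measurable_reward_eval j).comp measurable_snd)).sub (hWm.comp measurable_fst)
  have hset : MeasurableSet {x : ℝ | ε < |x|} := measurableSet_lt measurable_const (by fun_prop)
  have hbadi : Integrable (fun z => {x : ℝ | ε < |x|}.indicator (fun _ => B) (d z)) M.unitLaw :=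
    (integrable_const B).indicator (s := d ⁻¹' {x : ℝ | ε < |x|}) (hdm hset)
  have hbadE : ∫ z, {x : ℝ | ε < |x|}.indicator (fun _ => B) (d z) ∂M.unitLaw ≤ B * q := by
    have : ∫ z, {x : ℝ | ε < |x|}.indicator (fun _ => B) (d z) ∂M.unitLaw =
        ∫ z, (d ⁻¹' {x : ℝ | ε < |x|}).indicator (fun _ => B) z ∂M.unitLaw := rfl
    rw [this, integral_indicator_const _ (hdm hset), smul_eq_mul, mul_comm]
    exact mul_le_mul_of_nonneg_left hq hB.le
  have hα0 : 0 ≤ (1 - α) ^ (n - 1) := pow_nonneg (by linarith) _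
  have hae : ∀ᵐ ω ∂M.runLaw, ∀ i : ℕ, W (ω i).1 - σmax * Δ - (1 - α) ^ (n - 1) * g (ω i).1 ≤
      M.stateValue n (ω i).1 ∧ 0 ≤ g (ω i).1 := by
    rw [ae_all_iff]
    suffices hs : ∀ᵐ s ∂M.stateLaw, W s - σmax * Δ - (1 - α) ^ (n - 1) * g s ≤ M.stateValue n s ∧
        0 ≤ g s from
      fun i => (M.measurePreserving_state i).quasiMeasurePreserving.ae hs
    filter_upwards [H.le_stateValue hα hα1 hσmin hn, H.sigma_mem] with s hs hσs
    refine ⟨le_trans ?_ hs, ?_⟩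
    · have h1 : σ s * (E - expectedMax (gaussianReal 0 1) n) ≤ σmax * Δ :=
        (mul_le_mul_of_nonneg_left hΔ (hσmin.le.trans hσs.1)).trans
          (mul_le_mul_of_nonneg_right hσs.2 hΔ0)
      simp only [hW, hg]
      linarith
    · have : 0 ≤ M.absMoment s := integral_nonneg fun x => abs_nonneg x
      simp only [hg]
      positivity
  have i1 : Integrable (fun ω : ℕ → S × (ℕ → Y) => ⨆ i : Fin K, W (ω i).1) M.runLaw :=
    integrable_iSup_fin (fun i => hWm.comp (measurable_fst.comp (measurable_pi_apply _)))
      fun i => M.integrable_run_state hWi i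
  have i2 : Integrable (fun ω : ℕ → S × (ℕ → Y) =>
      ∑ i : Fin K, {x : ℝ | ε < |x|}.indicator (fun _ => B) (d (ω i))) M.runLaw :=
    integrable_finsetSum _ fun i _ =>
      (M.measurePreserving_run_eval i).integrable_comp_of_integrable hbadi
  have i3 : Integrable (fun ω : ℕ → S × (ℕ → Y) => B⁻¹ * ∑ i : Fin K, W (ω i).1 ^ 2) M.runLaw :=
    (integrable_finsetSum Finset.univ fun (i : Fin K) _ =>
      M.integrable_run_state hW2i i).const_mul B⁻¹
  have i4 : Integrable (fun ω : ℕ → S × (ℕ → Y) =>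
      (1 - α) ^ (n - 1) * ∑ i : Fin K, g (ω i).1) M.runLaw :=
    (integrable_finsetSum Finset.univ fun (i : Fin K) _ =>
      M.integrable_run_state hgi i).const_mul _
  -- The selected state is correlated with g, so g at that state is replaced by the sum over all K
  -- states. The factor K is harmless against (1 - α)^(n - 1).
  have hpt : ∀ᵐ ω ∂M.runLaw, (⨆ i : Fin K, W (ω i).1) - 2 * ε -
      (∑ i : Fin K, {x : ℝ | ε < |x|}.indicator (fun _ => B) (d (ω i))) -
      (B⁻¹ * ∑ i : Fin K, W (ω i).1 ^ 2) - σmax * Δ -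
      ((1 - α) ^ (n - 1) * ∑ i : Fin K, g (ω i).1) ≤
      M.stateValue n (ω (M.slgChoice α N K m pick ω)).1 := by
    filter_upwards [hae] with ω hω
    set p := M.slgChoice α N K m pick ω with hp
    have h1 := iSup_sub_le_of_argmax (W := fun i : Fin K => W (ω i).1)
      (V := fun i : Fin K => predictedValue α N fun j : Fin m => M.reward ((ω i).2 j)) (p := p)
      (fun i => hpick.le (fun i : Fin K => predictedValue α N fun j : Fin m =>
        M.reward ((ω i).2 j)) i) hε hB
    have h2 := (hω p).1
    have h3 : g (ω p).1 ≤ ∑ i : Fin K, g (ω i).1 :=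
      Finset.single_le_sum (f := fun i : Fin K => g (ω i).1) (fun i _ => (hω i).2)
        (Finset.mem_univ p)
    have h4 := mul_le_mul_of_nonneg_left h3 hα0
    simp only [hd]
    linarith
  have hint := H.integrable_stateValue_pick m n hpm
  have j1 := i1.sub (integrable_const (2 * ε))
  have j2 := j1.sub i2
  have j3 := j2.sub i3
  have j4 := j3.sub (integrable_const (σmax * Δ))
  have hmono := integral_mono_ae (j4.sub i4) hint hpt
  refine le_trans ?_ hmono
  have e1 := integral_sub j4 i4
  have e2 := integral_sub j3 (integrable_const (σmax * Δ))
  have e3 := integral_sub j2 i3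
  have e4 := integral_sub j1 i2
  have e5 := integral_sub i1 (integrable_const (2 * ε))
  simp only [Pi.sub_apply] at e1 e2 e3 e4 e5 ⊢
  rw [e1, e2, e3, e4, e5]
  have k2 : ∫ ω, ∑ i : Fin K, {x : ℝ | ε < |x|}.indicator (fun _ => B) (d (ω i)) ∂M.runLaw ≤
      K * (B * q) := by
    have hbadr : ∀ i : Fin K, Integrable (fun ω : ℕ → S × (ℕ → Y) =>
        {x : ℝ | ε < |x|}.indicator (fun _ => B) (d (ω i))) M.runLaw := fun i =>
      (M.measurePreserving_run_eval i).integrable_comp_of_integrable hbadi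
    rw [integral_finsetSum _ fun (i : Fin K) _ => hbadr i]
    have : ∀ i : Fin K, ∫ ω, {x : ℝ | ε < |x|}.indicator (fun _ => B) (d (ω i)) ∂M.runLaw ≤
        B * q := fun i => by
      have hmp := M.measurePreserving_run_eval i
      refine le_of_eq_of_le ?_ hbadE
      conv_rhs => rw [← hmp.map_eq]
      rw [integral_map hmp.measurable.aemeasurable (by rw [hmp.map_eq]; exact hbadi.1)]
    calc _ ≤ ∑ _i : Fin K, B * q := Finset.sum_le_sum fun i _ => this i
      _ = _ := by rw [Finset.sum_const, Finset.card_univ, Fintype.card_fin, nsmul_eq_mul]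
  have k3 : ∫ ω, B⁻¹ * ∑ i : Fin K, W (ω i).1 ^ 2 ∂M.runLaw ≤
      B⁻¹ * (K * (2 * |Mμ| + 2 * (σmax * E) ^ 2)) := by
    rw [integral_const_mul, integral_finsetSum _ fun (i : Fin K) _ => M.integrable_run_state hW2i i]
    refine mul_le_mul_of_nonneg_left ?_ (inv_nonneg.mpr hB.le)
    calc _ ≤ ∑ _i : Fin K, (2 * |Mμ| + 2 * (σmax * E) ^ 2) := Finset.sum_le_sum fun i _ => by
          rw [M.integral_run_state (f := fun s => W s ^ 2) hW2i.1 i]; exact hW2E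
      _ = _ := by rw [Finset.sum_const, Finset.card_univ, Fintype.card_fin, nsmul_eq_mul]
  have k4 : ∫ ω, (1 - α) ^ (n - 1) * ∑ i : Fin K, g (ω i).1 ∂M.runLaw ≤
      (1 - α) ^ (n - 1) * (K * (σmax * |normalQuantile α| + (1 + |Mμ|) + (1 + |CR|))) := by
    rw [integral_const_mul, integral_finsetSum _ fun (i : Fin K) _ => M.integrable_run_state hgi i]
    refine mul_le_mul_of_nonneg_left ?_ hα0
    calc _ ≤ ∑ _i : Fin K, (σmax * |normalQuantile α| + (1 + |Mμ|) + (1 + |CR|)) :=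
          Finset.sum_le_sum fun i _ => by
            rw [M.integral_run_state hgi.1 i]; exact hgE
      _ = _ := by rw [Finset.sum_const, Finset.card_univ, Fintype.card_fin, nsmul_eq_mul]
  simp only [integral_const, probReal_univ, one_smul]
  linarith

end UniformGaussianTail

end TwoStageModel

/-! ### The rate along the schedule -/

/-- Lower bound for the expected maximum of `n` means in terms of `x = log n`. -/
def scalingBound (μ₀ Cμ γ β Cβ x : ℝ) : ℝ := μ₀ + Cμ * x ^ γ - |Cβ| * x ^ (-β)

/-- Monotonicity is the reason for |Cβ| in the definition: a lower bound on the number of good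
states then suffices. -/
lemma scalingBound_mono {μ₀ Cμ γ β Cβ x y : ℝ} (hCμ : 0 < Cμ) (hγ : 0 < γ) (hβ : 0 < β)
    (hx : 0 < x) (hxy : x ≤ y) :
    scalingBound μ₀ Cμ γ β Cβ x ≤ scalingBound μ₀ Cμ γ β Cβ y := by
  have h1 := Real.rpow_le_rpow hx.le hxy hγ.le
  have h2 := Real.rpow_le_rpow_of_nonpos hx hxy (neg_nonpos.mpr hβ.le)
  have h3 := mul_le_mul_of_nonneg_left h1 hCμ.le
  have h4 := mul_le_mul_of_nonneg_left h2 (abs_nonneg Cβ)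
  unfold scalingBound
  linarith

/-- For γ < 1 and u = d/L in [0, 1) one has 1 - u ≤ (1 - u)^γ, so the main term drops by at most d
L^(γ - 1). As d ≤ L/2, the remainder grows by a factor of at most 2^β. -/
lemma sub_scalingBound_le {μ₀ Cμ γ β Cβ L d : ℝ} (hCμ : 0 < Cμ) (hγ1 : γ < 1)
    (hβ : 0 < β) (hL : 0 < L) (hd : 0 ≤ d) (hdL : d ≤ L / 2) :
    μ₀ + Cμ * L ^ γ + |Cβ| * L ^ (-β) - scalingBound μ₀ Cμ γ β Cβ (L - d) ≤
      Cμ * (d * L ^ (γ - 1)) + |Cβ| * (1 + 2 ^ β) * L ^ (-β) := by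
  have h1 : L ^ γ - d * L ^ (γ - 1) ≤ (L - d) ^ γ := by
    have e1 : L - d = L * (1 - d / L) := by field_simp
    have h01 : 0 < 1 - d / L := by
      rw [sub_pos, div_lt_one hL]; linarith
    have h11 : 1 - d / L ≤ 1 := by
      have := div_nonneg hd hL.le
      linarith
    have h2 : (1 - d / L) ≤ (1 - d / L) ^ γ := by
      conv_lhs => rw [← Real.rpow_one (1 - d / L)]
      exact Real.rpow_le_rpow_of_exponent_ge h01 h11 hγ1.le
    have h3 : d * L ^ (γ - 1) = L ^ γ * (d / L) := by
      rw [Real.rpow_sub_one hL.ne']; field_simp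
    rw [e1, Real.mul_rpow hL.le h01.le, h3]
    have := mul_le_mul_of_nonneg_left h2 (Real.rpow_nonneg hL.le γ)
    linarith
  have h2 : (L - d) ^ (-β) ≤ 2 ^ β * L ^ (-β) := by
    have h3 : (L - d) ^ (-β) ≤ (L / 2) ^ (-β) :=
      Real.rpow_le_rpow_of_nonpos (by linarith) (by linarith) (neg_nonpos.mpr hβ.le)
    refine h3.trans_eq ?_
    rw [Real.div_rpow hL.le (by norm_num), Real.rpow_neg (by norm_num : (0:ℝ) ≤ 2)]
    field_simp
  have h3 := mul_le_mul_of_nonneg_left h1 hCμ.le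
  have h4 := mul_le_mul_of_nonneg_left h2 (abs_nonneg Cβ)
  unfold scalingBound
  linarith

lemma IsSchedule.bounds {a₁ a₂ b₁ b₂ ρ : ℝ} {N K m : ℕ} (h : IsSchedule a₁ a₂ b₁ b₂ ρ N K m)
    (ha₁ : 0 < a₁) (hb₁ : 0 < b₁) (hρ : ρ < 1) (hN : 1 ≤ N) (hL : 0 < Real.log N) :
    1 ≤ m ∧ 1 ≤ K ∧ K ≤ N ∧ (1 - ρ) * N ≤ ((N - K * m : ℕ) : ℝ) ∧ 1 ≤ N - K * m := by
  have hN0 : (0 : ℝ) < N := by exact_mod_cast hN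
  have hm : 1 ≤ m := by
    have h1 : (0 : ℝ) < m := lt_of_lt_of_le (by positivity) h.le_m
    exact_mod_cast h1
  have hK : 1 ≤ K := by
    have h1 : (0 : ℝ) < K := lt_of_lt_of_le (by positivity) h.le_K
    exact_mod_cast h1
  have hlt : K * m < N := by
    have h1 : (K * m : ℝ) < N := h.budget.trans_lt (by nlinarith)
    exact_mod_cast h1
  refine ⟨hm, hK, (Nat.le_mul_of_pos_right K hm).trans hlt.le, ?_, by omega⟩
  rw [Nat.cast_sub hlt.le, Nat.cast_mul]
  linarith [h.budget]

lemma one_sub_pow_pred_le {α : ℝ} (hα1 : α < 1) {n : ℕ} (hn : 1 ≤ n) :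
    (1 - α) ^ (n - 1) ≤ Real.exp α * Real.exp (-(α * n)) := by
  have h1 : 1 - α ≤ Real.exp (-α) := by linarith [Real.add_one_le_exp (-α)]
  refine (pow_le_pow_left₀ (by linarith) h1 _).trans_eq ?_
  rw [← Real.exp_nat_mul, ← Real.exp_add, Nat.cast_sub hn]
  congr 1
  push_cast
  ring

namespace TwoStageModel.UniformGaussianTail

variable {S Y : Type*} [MeasurableSpace S] [MeasurableSpace Y] {M : TwoStageModel S Y}
  {μ σ : S → ℝ} {α σmin σmax CR Mμ κ δ₀ μ₀ Cμ γ β Cβ : ℝ}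

/-- Independence makes the joint law of μ and σ a product, and the mass assumption bounds the
probability of σ ≥ σmax - δ below by δ^κ. -/
lemma le_integral_iSup_score (H : M.UniformGaussianTail μ σ α σmin σmax CR Mμ)
    (hreg : M.RegularParameters μ σ σmax κ δ₀ μ₀ Cμ γ β Cβ) (hσmin : 0 < σmin) {K : ℕ}
    (hK : 1 ≤ K) {e δ A : ℝ} (he : 0 ≤ e) (hδ : 0 < δ) (hδ₀ : δ ≤ δ₀) (hδσ : δ ≤ σmax)
    (hA0 : 0 ≤ A)
    (hA : ∀ j : ℕ, K * δ ^ κ / 2 ≤ j → A ≤ expectedMax (M.stateLaw.map μ) j) :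
    A + (σmax - δ) * e - 2 * Real.exp (-(1 / (4 * Real.exp 1) * K * (δ ^ κ / 2) ^ 2)) *
      (A + (σmax - δ) * e + (1 + |Mμ|)) ≤
      ∫ ω, ⨆ i : Fin K, (μ (ω i).1 + σ (ω i).1 * e) ∂M.runLaw := by
  obtain ⟨-, -, hμi, hμle⟩ := H.integrable_mu_sq
  have hσi : Integrable σ M.stateLaw := by
    refine Integrable.of_bound H.measurable_sigma.aestronglyMeasurable σmax ?_
    filter_upwards [H.sigma_mem] with s hs
    rw [Real.norm_of_nonneg (hσmin.le.trans hs.1)]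
    exact hs.2
  have hμp : IsProbabilityMeasure (M.stateLaw.map μ) :=
    Measure.isProbabilityMeasure_map H.measurable_mu.aemeasurable
  have hσp : IsProbabilityMeasure (M.stateLaw.map σ) :=
    Measure.isProbabilityMeasure_map H.measurable_sigma.aemeasurable
  have hp : δ ^ κ ≤ (M.stateLaw.map σ).real (Ici (σmax - δ)) := by
    rw [map_measureReal_apply H.measurable_sigma measurableSet_Ici]
    exact hreg.mass δ hδ hδ₀
  have hδκ : 0 < δ ^ κ := Real.rpow_pos_of_pos hδ κ
  have hb : -(1 + |Mμ|) ≤ ∫ x, x ∂(M.stateLaw.map μ) := by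
    rw [integral_map (f := fun x : ℝ => x) H.measurable_mu.aemeasurable aestronglyMeasurable_id]
    have h1 := neg_abs_le (∫ s, μ s ∂M.stateLaw)
    have h2 := abs_integral_le_integral_abs (f := μ) (μ := M.stateLaw)
    linarith
  have hAb : 0 ≤ A + (σmax - δ) * e + (1 + |Mμ|) := by
    have := mul_nonneg (sub_nonneg.mpr hδσ) he
    positivity
  have hmain := le_integral_iSup_prod (M.stateLaw.map μ) (M.stateLaw.map σ)
    (τ := σmax - δ) (e := e) (K := K) (A := A) (b := 1 + |Mμ|)
    ((integrable_map_measure aestronglyMeasurable_id H.measurable_mu.aemeasurable).mpr hμi)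
    ((integrable_map_measure aestronglyMeasurable_id H.measurable_sigma.aemeasurable).mpr hσi)
    ((ae_map_iff H.measurable_sigma.aemeasurable measurableSet_Ici).mpr (by
      filter_upwards [H.sigma_mem] with s hs
      exact hσmin.le.trans hs.1))
    hK he (hδκ.trans_le hp)
    (fun j hj _ => hA j (le_trans (by gcongr) hj)) hb hAb
  have hmp := M.measurePreserving_states_comp (H.measurable_mu.prodMk H.measurable_sigma) (n := K)
  rw [(indepFun_iff_map_prod_eq_prod_map_map H.measurable_mu.aemeasurable
    H.measurable_sigma.aemeasurable).mp hreg.indep] at hmp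
  have hI : ∫ ω, ⨆ i : Fin K, (μ (ω i).1 + σ (ω i).1 * e) ∂M.runLaw =
      ∫ x : Fin K → ℝ × ℝ, ⨆ i, ((x i).1 + (x i).2 * e)
        ∂(Measure.pi fun _ => (M.stateLaw.map μ).prod (M.stateLaw.map σ)) := by
    rw [← hmp.map_eq, integral_map hmp.measurable.aemeasurable]
    exact (measurable_iSup_fin fun i => by fun_prop).aestronglyMeasurable
  rw [hI]
  refine le_trans ?_ hmain
  gcongr

end TwoStageModel.UniformGaussianTail

lemma eventually_le_rpow {a b γ : ℝ} (hb : 0 < b) (hγ : 0 < γ) :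
    ∀ᶠ x : ℝ in Filter.atTop, a ≤ b * (x / 2) ^ γ := by
  have h := ((tendsto_rpow_atTop hγ).comp
    (Filter.tendsto_id.atTop_div_const (by norm_num : (0:ℝ) < 2))).const_mul_atTop hb
  exact h.eventually_ge_atTop a

/-- Along the schedule the number of sampled states beats the squared mass `(L⁻¹ ^ κ) ^ 2`, with
`L = log N`. -/
lemma IsSchedule.exp_bounds {a₁ a₂ b₁ b₂ ρ κ L : ℝ} {N K m : ℕ}
    (h : IsSchedule a₁ a₂ b₁ b₂ ρ N K m) (hN : 1 ≤ N) (hLN : Real.log N = L) (hL : 1 ≤ L)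
    (hb₁ : 0 < b₁)
    (hk : (4 + 2 * κ) * Real.log L ≤ L) :
    b₁ * L ≤ K * (L⁻¹ ^ κ) ^ 2 := by
  have hL0 : 0 < L := by linarith
  have hN0 : (0 : ℝ) < N := by exact_mod_cast hN
  have h1 := h.le_K
  rw [hLN] at h1
  have h2 : (L⁻¹ ^ κ) ^ 2 = L ^ (-(2 * κ)) := by
    rw [← Real.rpow_natCast, Real.inv_rpow hL0.le, ← Real.rpow_neg hL0.le, ← Real.rpow_mul hL0.le]
    congr 1
    push_cast
    ring
  have h3 : L ^ (4 + 2 * κ) ≤ N := by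
    rw [Real.rpow_def_of_pos hL0, ← Real.exp_log hN0, hLN]
    exact Real.exp_le_exp.mpr (by linarith)
  have h4 : L ≤ N / L ^ 3 * L ^ (-(2 * κ)) := by
    have h5 : L ^ (4 + 2 * κ) = L * L ^ 3 * L ^ (2 * κ) := by
      rw [Real.rpow_add hL0]
      congr 1
      rw [show (4 : ℝ) = ((4 : ℕ) : ℝ) by norm_num, Real.rpow_natCast]
      ring
    have h6 : 0 < L ^ (2 * κ) := Real.rpow_pos_of_pos hL0 _
    rw [Real.rpow_neg hL0.le, div_mul_eq_mul_div, le_div_iff₀ (by positivity), ← div_eq_mul_inv,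
      le_div_iff₀ h6, ← h5]
    exact h3
  rw [h2]
  calc b₁ * L ≤ b₁ * (N / L ^ 3 * L ^ (-(2 * κ))) := by gcongr
    _ = b₁ * (N / L ^ 3) * L ^ (-(2 * κ)) := by ring
    _ ≤ _ := by gcongr

/-- The count is at least (b₁/2) N L^(-3 - κ). One further log L absorbs the constant log(b₁/2),
which turns 3 + κ into 4 + κ. -/
lemma IsSchedule.le_log {a₁ a₂ b₁ b₂ ρ κ L : ℝ} {N K m : ℕ}
    (h : IsSchedule a₁ a₂ b₁ b₂ ρ N K m) (hN : 1 ≤ N) (hLN : Real.log N = L) (hL : 1 ≤ L)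
    (hb₁ : 0 < b₁) (hk : -Real.log (b₁ / 2) ≤ Real.log L) {x : ℝ}
    (hx : K * L⁻¹ ^ κ / 2 ≤ x) : L - (4 + κ) * Real.log L ≤ Real.log x := by
  have hL0 : 0 < L := by linarith
  have hN0 : (0 : ℝ) < N := by exact_mod_cast hN
  have h1 := h.le_K
  rw [hLN] at h1
  have hp : 0 < L⁻¹ ^ κ := by positivity
  have h2 : b₁ / 2 * (N / L ^ 3) * L⁻¹ ^ κ ≤ x := by
    refine le_trans ?_ hx
    have := mul_le_mul_of_nonneg_right h1 hp.le
    linarith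
  have h3 := Real.log_le_log (by positivity) h2
  rw [Real.log_mul (by positivity) hp.ne', Real.log_mul (by positivity) (by positivity),
    Real.log_div hN0.ne' (by positivity), Real.log_pow, Real.log_rpow (by positivity),
    Real.log_inv, hLN] at h3
  push_cast at h3
  linarith

lemma log_mul_rpow_neg_le {L θ a : ℝ} (hL : 1 ≤ L) (ha : θ ≤ a) :
    Real.log L * L ^ (-a) ≤ Real.log L / L ^ θ := by
  rw [div_eq_mul_inv, ← Real.rpow_neg (by linarith)]
  exact mul_le_mul_of_nonneg_left
    (Real.rpow_le_rpow_of_exponent_le hL (by linarith)) (Real.log_nonneg hL)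

lemma rpow_neg_le_log_div {L θ a : ℝ} (hL : Real.exp 1 ≤ L) (ha : θ ≤ a) :
    L ^ (-a) ≤ Real.log L / L ^ θ := by
  have h1 : 1 ≤ L := (Real.one_le_exp zero_le_one).trans hL
  refine le_trans ?_ (log_mul_rpow_neg_le h1 ha)
  exact le_mul_of_one_le_left (Real.rpow_nonneg (by linarith) _)
    ((Real.le_log_iff_exp_le (by linarith)).mpr hL)

lemma scalingBound_nonneg {μ₀ Cμ γ β Cβ L x : ℝ} (hCμ : 0 < Cμ) (hγ : 0 < γ) (hβ : 0 < β)
    (hL : 0 ≤ L) (hLx : L / 2 ≤ x) (hx : 1 ≤ x) (h : |μ₀| + |Cβ| ≤ Cμ * (L / 2) ^ γ) :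
    0 ≤ scalingBound μ₀ Cμ γ β Cβ x := by
  have h1 : (L / 2) ^ γ ≤ x ^ γ := Real.rpow_le_rpow (by linarith) hLx hγ.le
  have h2 := mul_le_mul_of_nonneg_left h1 hCμ.le
  have h3 : x ^ (-β) ≤ 1 := Real.rpow_le_one_of_one_le_of_nonpos hx (by linarith)
  have h4 := mul_le_mul_of_nonneg_left h3 (abs_nonneg Cβ)
  have h5 := neg_abs_le μ₀
  rw [scalingBound]
  linarith

lemma scalingBound_le {μ₀ Cμ γ β Cβ L x : ℝ} (hCμ : 0 < Cμ) (hγ1 : γ < 1) (hx : 1 ≤ x)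
    (hxL : x ≤ L) : scalingBound μ₀ Cμ γ β Cβ x ≤ (|μ₀| + Cμ) * L := by
  have h1 : x ^ γ ≤ L := by
    calc x ^ γ ≤ x ^ (1 : ℝ) := Real.rpow_le_rpow_of_exponent_le hx hγ1.le
      _ = x := Real.rpow_one _
      _ ≤ L := hxL
  have h2 := mul_le_mul_of_nonneg_left h1 hCμ.le
  have h3 : 0 ≤ |Cβ| * x ^ (-β) := mul_nonneg (abs_nonneg _) (Real.rpow_nonneg (by linarith) _)
  have h4 := le_abs_self μ₀
  have h5 := le_mul_of_one_le_right (abs_nonneg μ₀) (hx.trans hxL)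
  rw [scalingBound]
  linarith

/-- The deviation term of the number of sampled states with `σ` close to `σmax`. -/
lemma exp_deviation_mul_le {c b₁ Kp L A T b R : ℝ} (hc : 0 ≤ c) (h : b₁ * L ≤ Kp) (hL : 0 < L)
    (hexp : L * L * Real.exp (-(c * b₁ * L)) ≤ 1) (hR : L⁻¹ ≤ R) (hb : 0 ≤ b)
    (hT0 : 0 ≤ T) (hT : T ≤ A * L + b * L) (hA : 0 ≤ A) :
    2 * Real.exp (-(c * Kp)) * T ≤ 2 * (A + b) * R := by
  have h1 : Real.exp (-(c * Kp)) ≤ Real.exp (-(c * b₁ * L)) := by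
    refine Real.exp_le_exp.mpr (neg_le_neg ?_)
    have := mul_le_mul_of_nonneg_left h hc
    linarith
  have h2 : Real.exp (-(c * b₁ * L)) * L ≤ R := by
    refine le_trans ?_ hR
    rw [← one_div, le_div_iff₀ hL]
    linarith
  calc 2 * Real.exp (-(c * Kp)) * T ≤ 2 * Real.exp (-(c * b₁ * L)) * (A * L + b * L) := by gcongr
    _ = 2 * (A + b) * (Real.exp (-(c * b₁ * L)) * L) := by ring
    _ ≤ _ := by gcongr

/-- The union bound over the sampled states for an inaccurate prediction. -/
lemma IsSchedule.prediction_failure_le {a₁ a₂ b₁ b₂ ρ c D L R : ℝ} {N K m : ℕ}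
    (h : IsSchedule a₁ a₂ b₁ b₂ ρ N K m) (hN : 1 ≤ N) (hKN : K ≤ N) (hLN : Real.log N = L)
    (hL : 0 < L) (hc : 0 < c) (hD : c * a₁ * D ^ 2 = 4) (hR : (N : ℝ)⁻¹ ≤ R) :
    K * ((N : ℝ) ^ 2 * (8 * Real.exp (-(c * m * (D / L) ^ 2)))) ≤ 8 * R := by
  have hNpos : (0 : ℝ) < N := by exact_mod_cast hN
  have hKN' : (K : ℝ) ≤ N := by exact_mod_cast hKN
  have hm := h.le_m
  rw [hLN] at hm
  have h1 : 4 * L ≤ c * m * (D / L) ^ 2 := by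
    calc 4 * L = c * a₁ * D ^ 2 * L := by rw [hD]
      _ = c * (a₁ * L ^ 3) * (D / L) ^ 2 := by field_simp
      _ ≤ _ := by gcongr
  have h2 : Real.exp (-(c * m * (D / L) ^ 2)) ≤ ((N : ℝ) ^ 4)⁻¹ := by
    rw [← Real.exp_log hNpos, hLN, ← Real.exp_nat_mul, ← Real.exp_neg]
    exact Real.exp_le_exp.mpr (by push_cast; linarith)
  calc _ ≤ N * ((N : ℝ) ^ 2 * (8 * ((N : ℝ) ^ 4)⁻¹)) := by gcongr
    _ = 8 * (N : ℝ)⁻¹ := by field_simp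
    _ ≤ _ := by gcongr

/-- For the penalty B = N², the K ≤ N second moments, each of order L, contribute only O(L/N). -/
lemma inv_sq_mul_second_moment_le {L E R s M : ℝ} {N K : ℕ} (hN : 1 ≤ N) (hKN : K ≤ N)
    (hL : 1 ≤ L) (hE : E ^ 2 ≤ 2 * L) (hR : L / N ≤ R) (hM : 0 ≤ M) :
    ((N : ℝ) ^ 2)⁻¹ * (K * (2 * M + 2 * (s * E) ^ 2)) ≤ (2 * M + 4 * s ^ 2) * R := by
  have hNpos : (0 : ℝ) < N := by exact_mod_cast hN
  have hKN' : (K : ℝ) ≤ N := by exact_mod_cast hKN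
  have h1 : 2 * M + 2 * (s * E) ^ 2 ≤ (2 * M + 4 * s ^ 2) * L := by
    have h2 := mul_le_mul_of_nonneg_left hE (sq_nonneg s)
    have h3 := le_mul_of_one_le_right hM hL
    rw [mul_pow]
    linarith
  calc _ ≤ ((N : ℝ) ^ 2)⁻¹ * (N * ((2 * M + 4 * s ^ 2) * L)) := by gcongr
    _ = (2 * M + 4 * s ^ 2) * (L / N) := by field_simp
    _ ≤ _ := by gcongr

lemma mul_one_sub_pow_pred_le {α ρ R : ℝ} {N K n : ℕ} (hα : 0 < α) (hα1 : α < 1) (hN : 1 ≤ N)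
    (hKN : K ≤ N) (hn : 1 ≤ n) (hnN : (1 - ρ) * N ≤ n)
    (hexp : N * N * Real.exp (-(α * (1 - ρ) * N)) ≤ 1) (hR : (N : ℝ)⁻¹ ≤ R) :
    K * (1 - α) ^ (n - 1) ≤ Real.exp α * R := by
  have hNpos : (0 : ℝ) < N := by exact_mod_cast hN
  have hKN' : (K : ℝ) ≤ N := by exact_mod_cast hKN
  have h1 : Real.exp (-(α * n)) ≤ Real.exp (-(α * (1 - ρ) * N)) := by
    refine Real.exp_le_exp.mpr ?_
    have := mul_le_mul_of_nonneg_left hnN hα.le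
    linarith
  have h2 : N * Real.exp (-(α * (1 - ρ) * N)) ≤ R := by
    refine le_trans ?_ hR
    rw [← one_div, le_div_iff₀ hNpos]
    linarith
  have h4 : (1 - α) ^ (n - 1) ≤ Real.exp α * Real.exp (-(α * (1 - ρ) * N)) :=
    (one_sub_pow_pred_le hα1 hn).trans (by gcongr)
  calc _ ≤ N * (Real.exp α * Real.exp (-(α * (1 - ρ) * N))) :=
        mul_le_mul hKN' h4 (pow_nonneg (by linarith) _) hNpos.le
    _ = Real.exp α * (N * Real.exp (-(α * (1 - ρ) * N))) := by ring
    _ ≤ _ := by gcongr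

/-- Conditions on `L = log N` from which the rate follows. -/
lemma eventually_rate_conditions {δ₀ κ μ₀ Cμ γ Cβ b₁ c₀ : ℝ} (hCμ : 0 < Cμ) (hγ : 0 < γ)
    (hc₀ : 0 < c₀) (s t : ℝ) :
    ∀ᶠ L : ℝ in Filter.atTop, Real.exp 1 ≤ L ∧ 2 ≤ L ∧ δ₀⁻¹ ≤ L ∧ s ≤ L ∧
      t ≤ L ∧ (4 + κ) * Real.log L ≤ L / 2 ∧ (4 + 2 * κ) * Real.log L ≤ L ∧
      -Real.log (b₁ / 2) ≤ Real.log L ∧ L * L * Real.exp (-(c₀ * L)) ≤ 1 ∧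
      |μ₀| + |Cβ| ≤ Cμ * (L / 2) ^ γ := by
  filter_upwards [Filter.eventually_ge_atTop (Real.exp 1), Filter.eventually_ge_atTop 2,
    Filter.eventually_ge_atTop δ₀⁻¹, Filter.eventually_ge_atTop s, Filter.eventually_ge_atTop t,
    eventually_mul_log_add_le (4 + κ) 0 (1 / 2) (by norm_num),
    eventually_mul_log_add_le (4 + 2 * κ) 0 1 one_pos,
    Real.tendsto_log_atTop.eventually_ge_atTop (-Real.log (b₁ / 2)),
    eventually_mul_exp_neg_le c₀ 0 hc₀, eventually_le_rpow (a := |μ₀| + |Cβ|) hCμ hγ]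
    with L h1 h2 h3 h4 h5 h6 h7 h8 h9 h10
  exact ⟨h1, h2, h3, h4, h5, by linarith, by linarith, h8, by rwa [add_zero] at h9, h10⟩

/-- Bounds on `E(N)` and on powers of `N` by powers of `L = log N`. -/
lemma gaussianMax_bounds {N : ℕ} {L R : ℝ} (hN : 2 ≤ N) (hLN : Real.log N = L) (hL : 1 ≤ L)
    (hk : 2 * Real.log L ≤ L) (hR : L⁻¹ ≤ R) :
    0 ≤ expectedMax (gaussianReal 0 1) N ∧ expectedMax (gaussianReal 0 1) N ^ 2 ≤ 2 * L ∧
      expectedMax (gaussianReal 0 1) N ≤ 2 * √L ∧ expectedMax (gaussianReal 0 1) N ≤ 2 * L ∧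
      L / N ≤ R ∧ (N : ℝ)⁻¹ ≤ R := by
  have hE0 : 0 ≤ expectedMax (gaussianReal 0 1) N := expectedMax_gaussian_nonneg (by omega)
  have hL0 : 0 < L := by linarith
  have hNpos : (0 : ℝ) < N := by exact_mod_cast (by omega : 0 < N)
  have hE2 : expectedMax (gaussianReal 0 1) N ^ 2 ≤ 2 * L := by
    have h1 := expectedMax_gaussian_le hN
    rw [hLN] at h1
    calc _ ≤ √(2 * L) ^ 2 := pow_le_pow_left₀ hE0 h1 2
      _ = _ := Real.sq_sqrt (by positivity)
  have hEs : expectedMax (gaussianReal 0 1) N ≤ 2 * √L := by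
    refine le_of_sq_le_sq ?_ (by positivity)
    rw [mul_pow, Real.sq_sqrt hL0.le]; linarith
  have hsL : √L ≤ L := by
    rw [Real.sqrt_le_left hL0.le]; nlinarith
  have hLN2 : L ^ 2 ≤ N := by
    rw [← Real.exp_log hNpos, hLN, ← Real.exp_log hL0, ← Real.exp_nat_mul]
    refine Real.exp_le_exp.mpr ?_
    push_cast
    rwa [Real.exp_log hL0]
  have hLR : L / N ≤ R := by
    refine le_trans ?_ hR
    rw [div_le_iff₀ hNpos, inv_mul_eq_div, le_div_iff₀ hL0]
    linarith
  refine ⟨hE0, hE2, hEs, by linarith, hLR, le_trans ?_ hLR⟩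
  rw [inv_eq_one_div]
  gcongr

end

/-! ### Assembly of the rate -/

theorem corollary2
    (α σmin σmax CR Mμ : ℝ) (κ δ₀ μ₀ Cμ γ β Cβ : ℝ) (a₁ a₂ b₁ b₂ ρ : ℝ)
    (hα : 0 < α) (hα1 : α < 1) (hσmin : 0 < σmin) (hσ : σmin ≤ σmax)
    (hκ : 0 < κ) (hδ₀ : 0 < δ₀) (hCμ : 0 < Cμ) (hγ : 0 < γ) (hγ1 : γ < 1) (hβ : 0 < β)
    (ha₁ : 0 < a₁) (hb₁ : 0 < b₁) (hρ : ρ < 1) :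
    ∃ c : ℝ, 0 < c ∧ ∃ N₀ : ℕ,
      ∀ (S Y : Type*) [MeasurableSpace S] [MeasurableSpace Y] (M : TwoStageModel S Y)
        (μ σ : S → ℝ),
        M.UniformGaussianTail μ σ α σmin σmax CR Mμ →
        M.RegularParameters μ σ σmax κ δ₀ μ₀ Cμ γ β Cβ →
        ∀ N K m : ℕ, N₀ ≤ N → IsSchedule a₁ a₂ b₁ b₂ ρ N K m →
        ∀ (pick : (Fin N → ℝ) → Fin N) (pick' : (Fin K → ℝ) → Fin K),
          IsArgmaxRule pick → IsArgmaxRule pick' →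
          Integrable (M.oracleOutcome N pick) M.runLaw ∧
          Integrable (M.slgOutcome α N K m pick') M.runLaw ∧
          M.oracleValue N pick - M.slgValue α N K m pick' ≤
            c * Real.log (Real.log N) / Real.log N ^ (min β (min (1 - γ) (1 / 2))) := by
  have hσmax : 0 < σmax := hσmin.trans_le hσ
  obtain ⟨C, c, s₀, hC, hc, hs₀, hpred⟩ :=
    TwoStageModel.UniformGaussianTail.exists_unitLaw_prediction_error (α := α) (σmin := σmin)
      (σmax := σmax) (CR := CR) (Mμ := Mμ) hα hα1 hσmin
  obtain ⟨CE, hCE, hEev⟩ := exists_expectedMax_gaussian_sub_le hρ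
  -- With accuracy D / L and m ≥ a₁ L³ the exponent c m (D / L)² is at least 4L, so a prediction
  -- fails with probability at most 8 N⁻⁴. This beats the union bound over K ≤ N states and the
  -- penalty N².
  obtain ⟨D, hD0, hDsq⟩ : ∃ D : ℝ, 0 < D ∧ c * a₁ * D ^ 2 = 4 :=
    ⟨√(4 / (c * a₁)), Real.sqrt_pos.mpr (by positivity), by
      rw [Real.sq_sqrt (by positivity)]; field_simp⟩
  obtain ⟨cα, hcα⟩ : ∃ cα, cα = ∫ x, max (normalQuantile α - x) 0 ∂(gaussianReal 0 1) := ⟨_, rfl⟩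
  have hcα0 : 0 ≤ cα := hcα ▸ integral_nonneg fun x => le_max_right _ _
  obtain ⟨G, hG⟩ : ∃ G, G = σmax * |normalQuantile α| + (1 + |Mμ|) + (1 + |CR|) := ⟨_, rfl⟩
  have hG0 : 0 ≤ G := by rw [hG]; positivity
  -- The Bernstein constant for indicators, with 1/4 from the deviation p/2, times the constant of
  -- the lower bound b₁ L ≤ K p² at p = L^(-κ).
  have hc₀ : 0 < 1 / (4 * Real.exp 1) / 4 * b₁ := by positivity
  obtain ⟨θ, hθ⟩ : ∃ θ, θ = min β (min (1 - γ) (1 / 2)) := ⟨_, rfl⟩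
  have hθβ : θ ≤ β := hθ ▸ min_le_left _ _
  have hθγ : θ ≤ 1 - γ := hθ ▸ (min_le_right _ _).trans (min_le_left _ _)
  have hθ2 : θ ≤ 1 / 2 := hθ ▸ (min_le_right _ _).trans (min_le_right _ _)
  have hNexp := tendsto_natCast_atTop_atTop (R := ℝ) |>.eventually
    (eventually_mul_exp_neg_le (α * (1 - ρ)) 0 (mul_pos hα (by linarith)))
  obtain ⟨N₀, hN₀⟩ := Filter.eventually_atTop.mp ((Filter.eventually_ge_atTop 2).and
    ((tendsto_log_natCast.eventually (eventually_rate_conditions (δ₀ := δ₀) (κ := κ) (μ₀ := μ₀)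
      (Cβ := Cβ) (b₁ := b₁) hCμ hγ hc₀ (D / s₀) σmax⁻¹)).and (hEev.and hNexp)))
  -- The summands are, in order, the coefficients of R = log L / L^θ in `t1` to `t10` below.
  refine ⟨Cμ * (4 + κ) + |Cβ| * (1 + 2 ^ β) + σmax * (Real.exp α * cα) + 2 +
    2 * (|μ₀| + Cμ + 2 * σmax + (1 + |Mμ|)) + 2 * (σmax * C * D * 3) + 8 +
    (2 * |Mμ| + 4 * σmax ^ 2) + σmax * CE + Real.exp α * G, by positivity, N₀, ?_⟩
  intro S Y _ _ M μ σ H hreg N K m hN hsch pick pick' hpick hpick'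
  obtain ⟨hN2, ⟨hLe, hL2, hLδ, hLs, hLσ, hLk, hLk2, hLb, hLexp, hLA⟩, hEN, hNe⟩ := hN₀ N hN
  have hoμ := (abs_le.mp (hreg.scaling N hN2)).2
  obtain ⟨L, hLN⟩ : ∃ L, Real.log N = L := ⟨_, rfl⟩
  rw [hLN] at hLe hL2 hLδ hLs hLσ hLk hLk2 hLb hLexp hLA hEN hoμ ⊢
  have hN1 : 1 ≤ N := by omega
  have hL0 : 0 < L := by linarith
  have hL1 : 1 ≤ L := by linarith
  have hℓ0 : 0 ≤ Real.log L := Real.log_nonneg hL1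
  obtain ⟨hm, hK, hKN, hnρ, hn⟩ := hsch.bounds ha₁ hb₁ hρ hN1 (hLN ▸ hL0)
  rw [← hθ]
  obtain ⟨R, hR⟩ : ∃ R, R = Real.log L / L ^ θ := ⟨_, rfl⟩
  have hRinv : L⁻¹ ≤ R := by
    rw [← Real.rpow_neg_one, hR]
    exact rpow_neg_le_log_div hLe (by linarith)
  have hRsqrt : (√L)⁻¹ ≤ R := by
    rw [Real.sqrt_eq_rpow, ← Real.rpow_neg hL0.le, hR]
    exact rpow_neg_le_log_div hLe hθ2
  have hRsqrtℓ : Real.log L / √L ≤ R := by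
    rw [Real.sqrt_eq_rpow, div_eq_mul_inv, ← Real.rpow_neg hL0.le, hR]
    exact log_mul_rpow_neg_le hL1 hθ2
  have hRγ : Real.log L * L ^ (γ - 1) ≤ R := by
    rw [← neg_sub, hR]
    exact log_mul_rpow_neg_le hL1 hθγ
  have hRβ : L ^ (-β) ≤ R := hR ▸ rpow_neg_le_log_div hLe hθβ
  have hκℓ : 0 ≤ κ * Real.log L := mul_nonneg hκ.le hℓ0
  obtain ⟨hE0, hE2, hEs, hEL, hLNR, hNR⟩ := gaussianMax_bounds hN2 hLN hL1 (by linarith) hRinv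
  have hoint := H.oracle_le hα hα1 hσmin hN1 hpick
  refine ⟨hoint.1, (H.integrable_slgOutcome hα hα1 hpick').1, ?_⟩
  have hx1 : 1 ≤ L - (4 + κ) * Real.log L := by linarith
  have hδσ : L⁻¹ ≤ σmax := (inv_le_comm₀ hL0 hσmax).mpr hLσ
  have hA0 := scalingBound_nonneg (β := β) hCμ hγ hβ hL0.le
    (by linarith : L / 2 ≤ L - (4 + κ) * Real.log L) hx1 hLA
  have hAj : ∀ j : ℕ, K * L⁻¹ ^ κ / 2 ≤ j →
      scalingBound μ₀ Cμ γ β Cβ (L - (4 + κ) * Real.log L) ≤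
        expectedMax (M.stateLaw.map μ) j := by
    intro j hj
    have h1 := hsch.le_log hN1 hLN hL1 hb₁ hLb hj
    have h2 : 2 ≤ j := by
      by_contra! h3
      have : Real.log j ≤ 0 := Real.log_nonpos (by positivity) (by exact_mod_cast (by omega))
      linarith
    refine (scalingBound_mono hCμ hγ hβ (by linarith) h1).trans ?_
    have h3 := (abs_le.mp (hreg.scaling j h2)).1
    have h4 := mul_le_mul_of_nonneg_right (le_abs_self Cβ)
      (Real.rpow_nonneg (by linarith : 0 ≤ Real.log j) (-β))
    rw [scalingBound]
    linarith
  -- Taking δ = 1/L costs E(N) / L = O(L^(-1/2)) in the score and only κ log L in the logarithm of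
  -- the number of good states.
  have hscore := H.le_integral_iSup_score hreg hσmin hK hE0 (inv_pos.mpr hL0)
    ((inv_le_comm₀ hL0 hδ₀).mpr hLδ) hδσ hA0 hAj
  have hsle : D / L ≤ s₀ := by
    rw [div_le_iff₀ hL0]; rw [div_le_iff₀ hs₀] at hLs; linarith
  -- Applied with B = N² and score accuracy σmax C (D / L)(1 + E(N)), which is of order L^(-1/2).
  have hslg := H.le_slgValue hα hα1 hσmin hσ hN1 hn hpick'
    (by positivity : 0 ≤ σmax * (C * (D / L) * (1 + expectedMax (gaussianReal 0 1) N)))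
    (show (0 : ℝ) < (N : ℝ) ^ 2 by positivity) (hEN _ (Nat.sub_le _ _) hnρ) (by positivity)
    (hpred H N m hN1 hm (D / L) (by positivity) hsle)
  have ho := hoint.2
  rw [← hcα] at ho
  rw [← hG] at hslg
  have hoβ := mul_le_mul_of_nonneg_right (le_abs_self Cβ) (Real.rpow_nonneg hL0.le (-β))
  have hsub := sub_scalingBound_le (μ₀ := μ₀) (Cβ := Cβ) hCμ hγ1 hβ hL0
    (by positivity : 0 ≤ (4 + κ) * Real.log L) hLk
  have hAle := scalingBound_le (μ₀ := μ₀) (β := β) (Cβ := Cβ) hCμ hγ1 hx1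
    (by linarith : L - (4 + κ) * Real.log L ≤ L)
  obtain ⟨A, hA⟩ : ∃ A, scalingBound μ₀ Cμ γ β Cβ (L - (4 + κ) * Real.log L) = A := ⟨_, rfl⟩
  obtain ⟨E, hE⟩ : ∃ E, expectedMax (gaussianReal 0 1) N = E := ⟨_, rfl⟩
  rw [hA] at hA0 hAle hscore hsub
  rw [hE] at hscore hslg ho hE0 hE2 hEs hEL
  have t1 := mul_le_mul_of_nonneg_left hRγ (by positivity : 0 ≤ Cμ * (4 + κ))
  have t2 := mul_le_mul_of_nonneg_left hRβ (by positivity : 0 ≤ |Cβ| * (1 + 2 ^ β))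
  have t4 : L⁻¹ * E ≤ 2 * R := by
    have h1 := mul_le_mul_of_nonneg_left hEs (inv_nonneg.mpr hL0.le)
    have h2 : L⁻¹ * (2 * √L) = 2 * (√L)⁻¹ := by
      rw [mul_left_comm, inv_mul_eq_div, Real.sqrt_div_self]
    linarith
  have t5 : 2 * Real.exp (-(1 / (4 * Real.exp 1) / 4 * (K * (L⁻¹ ^ κ) ^ 2))) *
      (A + (σmax - L⁻¹) * E + (1 + |Mμ|)) ≤
      2 * (|μ₀| + Cμ + 2 * σmax + (1 + |Mμ|)) * R := by
    have h2 : 0 ≤ (σmax - L⁻¹) * E := mul_nonneg (sub_nonneg.mpr hδσ) hE0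
    refine exp_deviation_mul_le (by positivity) (hsch.exp_bounds hN1 hLN hL1 hb₁ hLk2) hL0 hLexp
      hRinv (by positivity) (by positivity) ?_ (by positivity)
    have h4 := mul_le_mul_of_nonneg_left hEL hσmax.le
    have h5 := mul_nonneg (inv_nonneg.mpr hL0.le) hE0
    have h6 := le_mul_of_one_le_right (by positivity : 0 ≤ 1 + |Mμ|) hL1
    linarith
  have t6 : 2 * (σmax * (C * (D / L) * (1 + E))) ≤ 2 * (σmax * C * D * 3) * R := by
    have h1 : 1 + E ≤ 3 * √L := by linarith [Real.one_le_sqrt.mpr hL1]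
    calc _ ≤ 2 * (σmax * (C * (D / L) * (3 * √L))) := by gcongr
      _ = 2 * (σmax * C * D * 3) * (√L / L) := by ring
      _ ≤ _ := by rw [Real.sqrt_div_self]; gcongr
  have t7 := hsch.prediction_failure_le hN1 hKN hLN hL0 hc hDsq hNR
  have t8 := inv_sq_mul_second_moment_le (s := σmax) hN1 hKN hL1 hE2 hLNR (abs_nonneg Mμ)
  have t9 : σmax * (CE * Real.log L / √L) ≤ σmax * CE * R := by
    rw [mul_div_assoc, ← mul_assoc]
    gcongr
  have hpow := mul_one_sub_pow_pred_le hα hα1 hN1 hKN hn hnρ (by rwa [add_zero] at hNe) hNR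
  have t10 := mul_le_mul_of_nonneg_right hpow hG0
  -- The oracle's power is at most the one for N - Km draws, and K ≥ 1, so the bound for SLG covers
  -- it.
  have t3 : σmax * ((1 - α) ^ (N - 1) * cα) ≤ σmax * (Real.exp α * R * cα) := by
    have hα0 : 0 ≤ 1 - α := by linarith
    have h1 : (1 - α) ^ (N - 1) ≤ Real.exp α * R := by
      refine le_trans ?_ hpow
      refine (pow_le_pow_of_le_one hα0 (by linarith) (by omega : N - K * m - 1 ≤ N - 1)).trans ?_
      exact le_mul_of_one_le_left (pow_nonneg hα0 _) (by exact_mod_cast hK)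
    gcongr
  have hexpeq : 1 / (4 * Real.exp 1) * K * (L⁻¹ ^ κ / 2) ^ 2 =
      1 / (4 * Real.exp 1) / 4 * (K * (L⁻¹ ^ κ) ^ 2) := by ring
  rw [hexpeq] at hscore
  rw [mul_div_assoc, ← hR]
  linarith only [ho, hoμ, hoβ, hslg, hscore, hsub, t1, t2, t3, t4, t5, t6, t7, t8, t9, t10]
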